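/- Let $N\ge 1$, $1<p<2$, $0<s<1$, $0<C_1\le C_2$, $r>1$, and put $\lambda_r=N(p-2)+rps$. There is a constant $\gamma>0$, depending only on $N,p,s,C_1,C_2,r$, such that the following holds. Let $\Omega\subset\mathbb R^N$ be open, $T\in(0,\infty]$, and let $K:\mathbb R^N\times\mathbb R^N\times(0,T)\to\mathbb R$ be measurable with $K(x,y,\tau)=K(y,x,\tau)$ and $C_1\le K(x,y,\tau)|x-y|^{N+ps}\le C_2$ almost everywhere. Let $u:\mathbb R^N\times[0,T)\to\mathbb R$ be a local weak solution of $$u_t+\mathcal L_Ku=0,\qquad \mathcal L_Ku(x,t)=2\,\mathrm{p.v.}\!\int_{\mathbb R^N}|u(x,t)-u(y,t)|^{p-2}(u(x,t)-u(y,t))K(x,y,t)\,dy,$$ in $\Omega\times[0,T)$. That is, $u$ is measurable, $u\in C([0,T);L^2_{\rm loc}(\Omega))\cap L^p_{\rm loc}(0,T;W^{s,p}_{\rm loc}(\Omega))$, and for all open $\Omega'\Subset\Omega$ and all $0<t_1<t_2<T$: (i) for all $\varphi\in W^{1,2}_{\rm loc}(0,T;L^2(\Omega'))\cap L^p_{\rm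 loc}(0,T;W^{s,p}_0(\Omega'))$, where $W^{s,p}_0(\Omega')$ is the set of $v\in W^{s,p}(\mathbb R^N)$ with $v=0$ a.e. outside $\Omega'$, $$0=\int_{\Omega'}u\varphi\,dx\Big|_{t_1}^{t_2}-\int_{t_1}^{t_2}\!\int_{\Omega'}u\varphi_\tau\,dx\,d\tau+\int_{t_1}^{t_2}\!\iint_{\mathbb R^N\times\mathbb R^N}|u(x,\tau)-u(y,\tau)|^{p-2}(u(x,\tau)-u(y,\tau))(\varphi(x,\tau)-\varphi(y,\tau))K(x,y,\tau)\,dx\,dy\,d\tau;$$ (ii) $\displaystyle\operatorname*{ess\,sup}_{t_1<\tau<t_2}\int_{\mathbb R^N}\frac{|u(x,\tau)|^{p-1}}{(1+|x|)^{N+ps}}\,dx<\infty$. Suppose that $u$ is locally bounded in $\Omega\times[0,T)$ (essentially bounded on $A\times(0,t')$ for every compact $A\subset\Omega$ and every $t'\in(0,T)$), that $\rho>0$, $0<t\le T$, $t<\infty$, $B_{4\rho}(x_0)\subset\Omega$, that $u\ge 0$ a.e. in $B_{4\rho}(x_0)\times(0,t)$, and that $u\in L^r(\mathbb R^N\times(0,T))$.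 Then, as an inequality in $[0,\infty]$, $$\sup_{0<\tau<t}\int_{B_\rho(x_0)}u^r(x,\tau)\,dx\le\max\Big\{\operatorname*{ess\,sup}_{0<\tau<t}\int_{\mathbb R^N\setminus B_\rho(x_0)}u_+^r(x,\tau)\,dx,\ \ \gamma\int_{B_{2\rho}(x_0)}u^r(x,0)\,dx+\gamma\Big(\frac{t^r}{\rho^{\lambda_r}}\Big)^{\frac1{2-p}}\Big\}.$$ -/

import Mathlib

open MeasureTheory Set Filter Topology
open scoped ENNReal

noncomputable section

namespace FracPLap

/-- The open time interval `(0, T)`, for `T ∈ (0, ∞]`. -/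
def timeDomain (T : EReal) : Set ℝ := {τ : ℝ | 0 < τ ∧ (τ : EReal) < T}

/-- The half-open time interval `[0, T)`, for `T ∈ (0, ∞]`. -/
def timeDomain₀ (T : EReal) : Set ℝ := {τ : ℝ | 0 ≤ τ ∧ (τ : EReal) < T}

/-- `Ω' ⋐ Ω`: an open set with compact closure contained in `Ω`. -/
def CompactlyInside {N : ℕ} (Ω' Ω : Set (EuclideanSpace ℝ (Fin N))) : Prop :=
  IsOpen Ω' ∧ IsCompact (closure Ω') ∧ closure Ω' ⊆ Ω

/-- The number `λ_r = N (p - 2) + r p s`. -/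
def lam (N : ℕ) (p s r : ℝ) : ℝ := (N : ℝ) * (p - 2) + r * p * s

/-- A measurable kernel on `ℝ^N × ℝ^N × (0, T)` which almost everywhere is symmetric and
satisfies `C₁ ≤ K(x, y, τ) |x - y|^{N + p s} ≤ C₂`. -/
structure IsKernel (N : ℕ) (p s C₁ C₂ : ℝ) (T : EReal)
    (K : EuclideanSpace ℝ (Fin N) → EuclideanSpace ℝ (Fin N) → ℝ → ℝ) : Prop where
  measurable : AEMeasurable
    (fun z : (EuclideanSpace ℝ (Fin N) × EuclideanSpace ℝ (Fin N)) × ℝ => K z.1.1 z.1.2 z.2)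
    (volume.restrict (univ ×ˢ timeDomain T))
  symm : ∀ᵐ z : (EuclideanSpace ℝ (Fin N) × EuclideanSpace ℝ (Fin N)) × ℝ
    ∂(volume.restrict (univ ×ˢ timeDomain T)), K z.1.1 z.1.2 z.2 = K z.1.2 z.1.1 z.2
  bounds : ∀ᵐ z : (EuclideanSpace ℝ (Fin N) × EuclideanSpace ℝ (Fin N)) × ℝ
    ∂(volume.restrict (univ ×ˢ timeDomain T)),
      C₁ ≤ K z.1.1 z.1.2 z.2 * ‖z.1.1 - z.1.2‖ ^ ((N : ℝ) + p * s) ∧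
      K z.1.1 z.1.2 z.2 * ‖z.1.1 - z.1.2‖ ^ ((N : ℝ) + p * s) ≤ C₂

/-- The `p`-th power of the norm of `W^{s,p}(U)`:
`∫_U |v|^p + ∬_{U × U} |v(x) - v(y)|^p / |x - y|^{N + p s}`. -/
def sobolevEnergy {N : ℕ} (p s : ℝ) (U : Set (EuclideanSpace ℝ (Fin N)))
    (v : EuclideanSpace ℝ (Fin N) → ℝ) : ℝ≥0∞ :=
  (∫⁻ x in U, ENNReal.ofReal (|v x| ^ p)) +
    ∫⁻ z in U ×ˢ U, ENNReal.ofReal (|v z.1 - v z.2| ^ p / ‖z.1 - z.2‖ ^ ((N : ℝ) + p * s))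

/-- `φ ∈ W^{1,2}_loc(0, T; L²(Ω')) ∩ L^p_loc(0, T; W^{s,p}_0(Ω'))`, with weak time derivative `φt`.
As usual `φ` denotes the representative that is continuous in time with values in `L²(Ω')`, and
that `φt` is its weak time derivative is expressed by `φ(t₂) - φ(t₁) = ∫_{t₁}^{t₂} φt(τ) dτ`. -/
structure IsTestFunction {N : ℕ} (p s : ℝ) (T : EReal) (Ω' : Set (EuclideanSpace ℝ (Fin N)))
    (φ φt : EuclideanSpace ℝ (Fin N) → ℝ → ℝ) : Prop where
  measurable : AEMeasurable (Function.uncurry φ) (volume.restrict (univ ×ˢ timeDomain T))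
  eq_zero : ∀ᵐ z : EuclideanSpace ℝ (Fin N) × ℝ
    ∂(volume.restrict (Ω'ᶜ ×ˢ timeDomain T)), φ z.1 z.2 = 0
  memLp : ∀ t₁ ∈ timeDomain T, ∀ t₂ ∈ timeDomain T, t₁ < t₂ →
    MemLp (Function.uncurry φ) 2 (volume.restrict (Ω' ×ˢ Ioo t₁ t₂))
  memLp_deriv : ∀ t₁ ∈ timeDomain T, ∀ t₂ ∈ timeDomain T, t₁ < t₂ →
    MemLp (Function.uncurry φt) 2 (volume.restrict (Ω' ×ˢ Ioo t₁ t₂))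
  deriv : ∀ t₁ ∈ timeDomain T, ∀ t₂ ∈ timeDomain T, t₁ < t₂ →
    ∀ᵐ x ∂(volume.restrict Ω'), φ x t₂ - φ x t₁ = ∫ τ in t₁..t₂, φt x τ
  sobolev : ∀ t₁ ∈ timeDomain T, ∀ t₂ ∈ timeDomain T, t₁ < t₂ →
    ∫⁻ τ in Ioo t₁ t₂, sobolevEnergy p s univ (fun x => φ x τ) < ∞

/-- `u` is a local weak solution of `u_t + L_K u = 0` in `Ω × [0, T]`. -/
structure IsLocalWeakSolution {N : ℕ} (p s : ℝ) (Ω : Set (EuclideanSpace ℝ (Fin N))) (T : EReal)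
    (K : EuclideanSpace ℝ (Fin N) → EuclideanSpace ℝ (Fin N) → ℝ → ℝ)
    (u : EuclideanSpace ℝ (Fin N) → ℝ → ℝ) : Prop where
  measurable : AEMeasurable (Function.uncurry u) (volume.restrict (univ ×ˢ timeDomain T))
  /-- `u ∈ C([0, T); L²_loc(Ω))`: each time slice is locally square integrable. -/
  memLp : ∀ Ω', CompactlyInside Ω' Ω → ∀ τ ∈ timeDomain₀ T,
    MemLp (fun x => u x τ) 2 (volume.restrict Ω')
  /-- `u ∈ C([0, T); L²_loc(Ω))`: continuity in time, the initial time included. -/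
  continuous : ∀ Ω', CompactlyInside Ω' Ω → ∀ τ₀ ∈ timeDomain₀ T,
    Tendsto (fun τ => eLpNorm (fun x => u x τ - u x τ₀) 2 (volume.restrict Ω'))
      (𝓝[timeDomain₀ T] τ₀) (𝓝 0)
  /-- `u ∈ L^p_loc(0, T; W^{s,p}_loc(Ω))`. -/
  sobolev : ∀ Ω', CompactlyInside Ω' Ω →
    ∀ t₁ ∈ timeDomain T, ∀ t₂ ∈ timeDomain T, t₁ < t₂ →
      ∫⁻ τ in Ioo t₁ t₂, sobolevEnergy p s Ω' (fun x => u x τ) < ∞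
  weak_eq : ∀ Ω', CompactlyInside Ω' Ω →
    ∀ t₁ ∈ timeDomain T, ∀ t₂ ∈ timeDomain T, t₁ < t₂ →
    ∀ φ φt : EuclideanSpace ℝ (Fin N) → ℝ → ℝ, IsTestFunction p s T Ω' φ φt →
      0 = ((∫ x in Ω', u x t₂ * φ x t₂) - ∫ x in Ω', u x t₁ * φ x t₁)
        - (∫ τ in t₁..t₂, ∫ x in Ω', u x τ * φt x τ)
        + ∫ τ in t₁..t₂, ∫ z : EuclideanSpace ℝ (Fin N) × EuclideanSpace ℝ (Fin N),
            |u z.1 τ - u z.2 τ| ^ (p - 2) * (u z.1 τ - u z.2 τ) * (φ z.1 τ - φ z.2 τ)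
              * K z.1 z.2 τ
  tail : ∀ t₁ ∈ timeDomain T, ∀ t₂ ∈ timeDomain T, t₁ < t₂ →
    essSup (fun τ => ∫⁻ x, ENNReal.ofReal (|u x τ| ^ (p - 1) / (1 + ‖x‖) ^ ((N : ℝ) + p * s)))
      (volume.restrict (Ioo t₁ t₂)) < ∞

/-- `u` is locally (essentially) bounded in `Ω × [0, T)`: it is bounded on `A × (0, t')` for every
compact `A ⊆ Ω` and `t' < T`. -/
def LocallyBounded {N : ℕ} (Ω : Set (EuclideanSpace ℝ (Fin N))) (T : EReal)
    (u : EuclideanSpace ℝ (Fin N) → ℝ → ℝ) : Prop :=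
  ∀ A ⊆ Ω, IsCompact A → ∀ t' ∈ timeDomain T, ∃ M : ℝ,
    ∀ᵐ z : EuclideanSpace ℝ (Fin N) × ℝ ∂(volume.restrict (A ×ˢ Ioo 0 t')), |u z.1 z.2| ≤ M

end FracPLap

end

namespace FracPLap

/-! ### Pointwise inequalities -/

/-! Let `X` be the supremum over time of the `r`-mass of `u` in `B_ρ`, taken on an interval where
`u` is bounded near the ball, so that `X` is finite. If `X` does not exceed the essential supremum
of the exterior mass, the first term of the maximum already bounds it. Otherwise the whole mass of
`u_+^r` over `ℝ^N` is at most `2X` at almost every time. This dichotomy is the heart of the matter: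
the nonlocal tail is then controlled by the very quantity to be estimated, and no separate tail term
appears.

The equation is tested with `(u + ε)^{r-1} ζ^p`, where `ζ` is a cutoff between `B_ρ` and `B_{2ρ}`.
The favourable part of the energy is discarded. Near the diagonal, `flux_mul_ge` bounds the
unfavourable part by `(u + ε)^{p+r-2}` times a difference of the cutoff. Away from it, `flux_ge_neg`
leaves only `u_+(y)^{p-1}` against the kernel. With `S` a bound for the mass, Hölder's inequality
turns both contributions into a multiple of `S^{1-θ} ρ^{-λ_r/r}` with `θ = (2-p)/r`
(`exists_lintegral_neg_energy_le`). Since `p < 2`, the power of `S` is strictly sublinear.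

Integrating in time, `X` is at most a multiple of the initial mass in `B_{2ρ}`, plus an `ε`-term,
plus a multiple of `t S^{1-θ} ρ^{-λ_r/r}`. With `Y = (t^r/ρ^{λ_r})^{1/(2-p)}` the last term is a
multiple of `S^{1-θ} Y^θ`, and a Young inequality (`mul_rpow_mul_rpow_le`) absorbs its `S` part. The
parameter `ε` is not sent to zero: it is fixed by `ε^r ρ^N = Y`, so that its cost is again a
multiple of `Y` (`iSup_lintegral_le`).

The delicate point is that `u` has no time derivative, so the nonlinear test function is not
directly admissible. Only test functions frozen in time are used. For small `δ`, convexity of `a ↦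
a^r/r` bounds the increment of the mass from `τ` to `τ + δ` by the increment of `u` paired with the
test function at time `τ + δ` (`Regular.mass_sub_le`). The weak equation on `(τ, τ + δ)` turns this
pairing into an energy integral. Integrating in `τ` and using Fubini, the test function appears at a
slightly shifted time, and continuity of translations in `L^p` and `L^1` makes the shift harmless
(`Regular.exists_translate_error_le`, `Regular.integral_mass_sub_le`). Division by `δ` and
continuity of the mass in time give the estimate between any two positive times
(`sub_le_of_integral_sub_le`), and continuity at time `0` brings in the initial datum (`mass_le`).
-/

/-- The nonlinearity `|a - b|^{p-2} (a - b)`. -/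
noncomputable def flux (p a b : ℝ) : ℝ := |a - b| ^ (p - 2) * (a - b)

lemma flux_symm (p a b : ℝ) : flux p a b = -flux p b a := by
  unfold flux
  rw [abs_sub_comm]
  ring

lemma flux_of_le {p a b : ℝ} (hp : 1 < p) (h : b ≤ a) : flux p a b = (a - b) ^ (p - 1) := by
  unfold flux
  rcases h.eq_or_lt with rfl | h
  · simp [Real.zero_rpow (by linarith : p - 1 ≠ 0)]
  · rw [abs_of_pos (sub_pos.2 h), ← Real.rpow_add_one (sub_pos.2 h).ne']
    congr 1
    ring

lemma abs_flux {p : ℝ} (hp : 1 < p) (a b : ℝ) : |flux p a b| = |a - b| ^ (p - 1) := by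
  rcases le_total b a with h | h
  · rw [flux_of_le hp h, abs_of_nonneg (by bound), abs_of_nonneg (by linarith)]
  · rw [flux_symm, abs_neg, flux_of_le hp h, abs_of_nonneg (by bound), abs_sub_comm,
      abs_of_nonneg (by linarith)]

/-- For `θ ≥ 1` one has `t^θ ≤ t`; for `θ ≤ 1` concavity puts `t^θ` below its tangent at `1`. It
makes a comparison of powers linear in `flux_mul_ge_of_le`. -/
lemma one_sub_rpow_ge {θ t : ℝ} (hθ : 0 < θ) (ht : 0 < t) (ht1 : t ≤ 1) :
    min 1 θ * (1 - t) ≤ 1 - t ^ θ := by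
  rcases le_total 1 θ with h | h
  · rw [min_eq_left h]
    have := Real.rpow_le_rpow_of_exponent_ge ht ht1 h
    rw [Real.rpow_one] at this
    linarith
  · rw [min_eq_right h]
    have := rpow_one_add_le_one_add_mul_self (s := t - 1) (by linarith) hθ.le h
    rw [add_sub_cancel] at this
    linarith

lemma rpow_sub_rpow_le {p a b : ℝ} (hp : 1 ≤ p) (hb : 0 ≤ b) (hab : b ≤ a) :
    a ^ p - b ^ p ≤ p * a ^ (p - 1) * (a - b) := by
  rcases hb.trans hab |>.eq_or_lt with rfl | ha
  · have : b = 0 := le_antisymm hab hb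
    subst this
    simp
  have h := one_add_mul_self_le_rpow_one_add (s := b / a - 1) (p := p)
    (by have : 0 ≤ b / a := by positivity
        linarith) hp
  rw [add_sub_cancel, Real.div_rpow hb ha.le, le_div_iff₀ (by positivity)] at h
  have h2 : a ^ p = a ^ (p - 1) * a := by rw [← Real.rpow_add_one ha.ne']; congr 1; ring
  have h3 : (1 + p * (b / a - 1)) * a ^ p = a ^ p + p * a ^ (p - 1) * (b - a) := by
    rw [h2]
    field_simp
  linarith

/-- The constant in the pointwise bound for the local part of the energy. -/
noncomputable def nearConst (p r : ℝ) : ℝ := p * (min 1 ((r - 1) / p))⁻¹ ^ (p - 1)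

lemma nearConst_pos {p r : ℝ} (hp : 1 < p) (hr : 1 < r) : 0 < nearConst p r := by
  unfold nearConst
  have : 0 < min 1 ((r - 1) / p) := lt_min one_pos (div_pos (by linarith) (by linarith))
  positivity

/-- Only the case where the product is negative matters. Then `a^{r-1} z^p < b^{r-1} w^p` although
`b ≤ a`, so the cutoff must jump up from `z` to `w` by enough to compensate: `(a - b) w` is
controlled by `a (w - z)`. Hence the negative part is bounded by `|z - w|^p`, with no need to keep
any of the positive energy. -/
lemma flux_mul_ge_of_le {p r a b z w : ℝ} (hp : 1 < p) (hr : 1 < r) (hb : 0 < b) (hab : b ≤ a)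
    (hz : 0 ≤ z) (hw : 0 ≤ w) :
    -(nearConst p r * (a ^ (p + r - 2) + b ^ (p + r - 2)) * |z - w| ^ p) ≤
      flux p a b * (a ^ (r - 1) * z ^ p - b ^ (r - 1) * w ^ p) := by
  have ha : 0 < a := hb.trans_le hab
  have hC := nearConst_pos hp hr
  rw [flux_of_le hp hab]
  have hd : 0 ≤ (a - b) ^ (p - 1) := Real.rpow_nonneg (by linarith) _
  have hrhs : 0 ≤ nearConst p r * (a ^ (p + r - 2) + b ^ (p + r - 2)) * |z - w| ^ p := by
    positivity
  by_cases hneg : b ^ (r - 1) * w ^ p ≤ a ^ (r - 1) * z ^ p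
  · have := mul_nonneg hd (sub_nonneg.2 hneg)
    linarith
  push Not at hneg
  have hab' : b ^ (r - 1) ≤ a ^ (r - 1) := Real.rpow_le_rpow hb.le hab (by linarith)
  have hzw : z < w := by
    by_contra! h
    have := mul_le_mul hab' (Real.rpow_le_rpow hw h (by linarith : (0 : ℝ) ≤ p)) (by positivity)
      (by positivity)
    linarith
  have hw0 : 0 < w := hz.trans_lt hzw
  set θ := (r - 1) / p with hθ
  have hθ0 : 0 < θ := div_pos (by linarith) (by linarith)
  set c := min 1 θ with hc
  have hc0 : 0 < c := lt_min one_pos hθ0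
  -- Taking `p`-th roots gives `z ≤ (b/a)^θ w`, hence `w - z ≥ (1 - (b/a)^θ) w ≥ c (1 - b/a) w`.
  have key : (a - b) * w ≤ c⁻¹ * a * (w - z) := by
    have h1 : a ^ θ * z ≤ b ^ θ * w := by
      by_contra! h
      have := Real.rpow_le_rpow (by positivity) h.le (by linarith : (0 : ℝ) ≤ p)
      rw [Real.mul_rpow (by positivity) hw, Real.mul_rpow (by positivity) hz,
        ← Real.rpow_mul hb.le, ← Real.rpow_mul ha.le, hθ,
        div_mul_cancel₀ _ (by linarith : p ≠ 0)] at this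
      linarith
    have h2 := one_sub_rpow_ge hθ0 (div_pos hb ha) ((div_le_one ha).2 hab)
    rw [Real.div_rpow hb.le ha.le] at h2
    have h3 : z ≤ b ^ θ / a ^ θ * w := by
      rw [div_mul_eq_mul_div, le_div_iff₀ (by positivity)]
      linarith
    have h4 : c * (1 - b / a) * w ≤ w - z := by
      have := mul_le_mul_of_nonneg_right h2 hw
      linarith
    have h5 : c * (1 - b / a) * w * a = c * ((a - b) * w) := by
      field_simp
    have h6 := mul_le_mul_of_nonneg_right h4 ha.le
    rw [h5] at h6
    rw [mul_assoc, ← div_eq_inv_mul, le_div_iff₀ hc0]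
    linarith
  have h7 : (a - b) ^ (p - 1) * w ^ (p - 1) ≤ c⁻¹ ^ (p - 1) * a ^ (p - 1) * (w - z) ^ (p - 1) := by
    rw [← Real.mul_rpow (by linarith) hw, ← Real.mul_rpow (by positivity) ha.le,
      ← Real.mul_rpow (by positivity) (by linarith)]
    exact Real.rpow_le_rpow (mul_nonneg (by linarith) hw) key (by linarith)
  have h8 := rpow_sub_rpow_le hp.le hz hzw.le
  have h9 : (w - z) ^ p = (w - z) ^ (p - 1) * (w - z) := by
    rw [← Real.rpow_add_one (by linarith)]; congr 1; ring
  have h10 : a ^ (p - 1) * b ^ (r - 1) ≤ a ^ (p + r - 2) + b ^ (p + r - 2) := by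
    have : a ^ (p + r - 2) = a ^ (p - 1) * a ^ (r - 1) := by
      rw [← Real.rpow_add ha]; congr 1; ring
    rw [this]
    have := mul_le_mul_of_nonneg_left hab' (by positivity : 0 ≤ a ^ (p - 1))
    have : 0 ≤ b ^ (p + r - 2) := by positivity
    linarith
  rw [abs_sub_comm, abs_of_pos (by linarith : 0 < w - z), h9]
  have hwz : 0 ≤ w - z := by linarith
  have hwz' : 0 ≤ (w - z) ^ (p - 1) := by positivity
  have h11 : b ^ (r - 1) * w ^ p - a ^ (r - 1) * z ^ p ≤ b ^ (r - 1) * (w ^ p - z ^ p) := by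
    have := mul_le_mul_of_nonneg_right hab' (by positivity : 0 ≤ z ^ p)
    linarith
  have h12 : (a - b) ^ (p - 1) * (b ^ (r - 1) * w ^ p - a ^ (r - 1) * z ^ p) ≤
      nearConst p r * (a ^ (p + r - 2) + b ^ (p + r - 2)) * ((w - z) ^ (p - 1) * (w - z)) :=
    calc _ ≤ (a - b) ^ (p - 1) * (b ^ (r - 1) * (p * w ^ (p - 1) * (w - z))) := by
            gcongr
            exact h11.trans (mul_le_mul_of_nonneg_left h8 (by positivity))
      _ = p * b ^ (r - 1) * (w - z) * ((a - b) ^ (p - 1) * w ^ (p - 1)) := by ring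
      _ ≤ p * b ^ (r - 1) * (w - z) * (c⁻¹ ^ (p - 1) * a ^ (p - 1) * (w - z) ^ (p - 1)) := by
        gcongr
      _ = (p * c⁻¹ ^ (p - 1)) * (a ^ (p - 1) * b ^ (r - 1)) * ((w - z) ^ (p - 1) * (w - z)) := by
        ring
      _ ≤ _ := by
        unfold nearConst
        gcongr
  linarith

/-- The pointwise lower bound for the local part of the energy. -/
lemma flux_mul_ge {p r a b z w : ℝ} (hp : 1 < p) (hr : 1 < r) (ha : 0 < a) (hb : 0 < b)
    (hz : 0 ≤ z) (hw : 0 ≤ w) :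
    -(nearConst p r * (a ^ (p + r - 2) + b ^ (p + r - 2)) * |z - w| ^ p) ≤
      flux p a b * (a ^ (r - 1) * z ^ p - b ^ (r - 1) * w ^ p) := by
  rcases le_total b a with h | h
  · exact flux_mul_ge_of_le hp hr hb h hz hw
  · have := flux_mul_ge_of_le hp hr ha h hw hz
    rw [flux_symm, abs_sub_comm, add_comm (a ^ _)]
    linarith

/-- The pointwise lower bound for the nonlocal part of the energy. -/
lemma flux_ge_neg {p a b : ℝ} (hp : 1 < p) (ha : 0 ≤ a) : -(max b 0 ^ (p - 1)) ≤ flux p a b := by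
  rcases le_total b a with h | h
  · rw [flux_of_le hp h]
    have : 0 ≤ (a - b) ^ (p - 1) := Real.rpow_nonneg (by linarith) _
    have : 0 ≤ max b 0 ^ (p - 1) := by positivity
    linarith
  · rw [flux_symm, flux_of_le hp h, max_eq_left (ha.trans h)]
    exact neg_le_neg (Real.rpow_le_rpow (by linarith) (by linarith) (by linarith))

lemma abs_flux_le {p : ℝ} (hp : 1 < p) (hp2 : p < 2) (a b : ℝ) :
    |flux p a b| ≤ |a| ^ (p - 1) + |b| ^ (p - 1) := by
  rw [abs_flux hp]
  calc |a - b| ^ (p - 1) ≤ (|a| + |b|) ^ (p - 1) :=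
        Real.rpow_le_rpow (abs_nonneg _) (abs_sub _ _) (by linarith)
    _ ≤ _ := Real.rpow_add_le_add_rpow (abs_nonneg _) (abs_nonneg _) (by linarith) (by linarith)

/-- Convexity of `a ↦ a ^ r / r`. -/
lemma rpow_div_sub_le {r a b : ℝ} (hr : 1 < r) (ha : 0 < a) (hb : 0 ≤ b) :
    a ^ r / r - b ^ r / r ≤ a ^ (r - 1) * (a - b) := by
  have h := one_add_mul_self_le_rpow_one_add (s := b / a - 1) (p := r)
    (by have : 0 ≤ b / a := by positivity
        linarith) hr.le
  rw [add_sub_cancel, Real.div_rpow hb ha.le, le_div_iff₀ (by positivity)] at h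
  have h2 : a ^ r = a ^ (r - 1) * a := by rw [← Real.rpow_add_one ha.ne']; congr 1; ring
  have h3 : (1 + r * (b / a - 1)) * a ^ r = a ^ r + r * (a ^ (r - 1) * (b - a)) := by
    rw [h2]
    field_simp
  rw [h3] at h
  have hr0 : 0 < r := by linarith
  rw [← sub_div, div_le_iff₀ hr0]
  linarith

/-! ### Integrals of powers, cutoff functions and the Hölder inequality -/

section PowerIntegrals

variable {N : ℕ}

lemma lintegral_comp_smul_sub (f : EuclideanSpace ℝ (Fin N) → ℝ≥0∞)
    (hf : Measurable f) (x₀ : EuclideanSpace ℝ (Fin N)) {R : ℝ} (hR : 0 < R) :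
    ∫⁻ y, f (R⁻¹ • (y - x₀)) = ENNReal.ofReal (R ^ N) * ∫⁻ z, f z := by
  rw [lintegral_sub_right_eq_self (fun y => f (R⁻¹ • y)) x₀,
    ← lintegral_map hf (measurable_const_smul R⁻¹),
    Measure.map_addHaar_smul volume (inv_ne_zero hR.ne'), lintegral_smul_measure, smul_eq_mul]
  congr 2
  rw [finrank_euclideanSpace_fin, inv_pow, inv_inv, abs_of_pos (by positivity)]

/-- The change of variables `z = (y - x₀)/R` isolates the power of `R`, which makes the constants of
the next two lemmas independent of centre and radius. -/
lemma setLIntegral_norm_rpow_scale (A : Set (EuclideanSpace ℝ (Fin N))) (hA : MeasurableSet A)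
    (x₀ : EuclideanSpace ℝ (Fin N)) {R : ℝ} (hR : 0 < R) (α : ℝ) :
    ∫⁻ y in {y | R⁻¹ • (y - x₀) ∈ A}, ENNReal.ofReal (‖y - x₀‖ ^ α) =
      ENNReal.ofReal (R ^ ((N : ℝ) + α)) * ∫⁻ z in A, ENNReal.ofReal (‖z‖ ^ α) := by
  have hm : MeasurableSet {y | R⁻¹ • (y - x₀) ∈ A} :=
    hA.preimage (by fun_prop : Measurable fun y : EuclideanSpace ℝ (Fin N) => R⁻¹ • (y - x₀))
  have hmeas : Measurable fun z : EuclideanSpace ℝ (Fin N) => ENNReal.ofReal (‖z‖ ^ α) := by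
    fun_prop
  rw [← lintegral_indicator hm, ← lintegral_indicator hA, Real.rpow_add hR, Real.rpow_natCast,
    ENNReal.ofReal_mul (by positivity), mul_comm (ENNReal.ofReal (R ^ N)), mul_assoc,
    ← lintegral_comp_smul_sub _ (hmeas.indicator hA) x₀ hR,
    ← lintegral_const_mul' _ _ ENNReal.ofReal_ne_top]
  refine lintegral_congr fun y => ?_
  by_cases hy : R⁻¹ • (y - x₀) ∈ A
  · rw [indicator_of_mem hy, indicator_of_mem (show y ∈ {y | R⁻¹ • (y - x₀) ∈ A} from hy),
      ← ENNReal.ofReal_mul (by positivity), norm_smul, norm_inv, Real.norm_of_nonneg hR.le,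
      ← Real.mul_rpow (by positivity) (by positivity), mul_inv_cancel_left₀ hR.ne']
  · rw [indicator_of_notMem hy, indicator_of_notMem (show y ∉ {y | R⁻¹ • (y - x₀) ∈ A} from hy),
      mul_zero]

lemma exists_lintegral_ball_rpow_le (hN : 1 ≤ N) {β : ℝ} (hβ : 0 < β) :
    ∃ c : ℝ, 0 < c ∧ ∀ (x : EuclideanSpace ℝ (Fin N)) (R : ℝ), 0 < R →
      ∫⁻ y in Metric.ball x R, ENNReal.ofReal (‖y - x‖ ^ (β - N)) ≤ ENNReal.ofReal (c * R ^ β) := by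
  have hint : IntegrableOn (fun z : EuclideanSpace ℝ (Fin N) => ‖z‖ ^ (β - N))
      (Metric.ball 0 1) := by
    refine integrableOn_ball_of_norm_le_rpow (C := 1) (α := N - β)
      (by rw [finrank_euclideanSpace_fin]; exact hN)
      (by rw [finrank_euclideanSpace_fin]; linarith) (Eventually.of_forall fun x => ?_)
      (by fun_prop : Measurable _).aestronglyMeasurable
    rw [one_mul, neg_sub, Real.norm_of_nonneg (by positivity)]
  set I := ∫⁻ z in Metric.ball (0 : EuclideanSpace ℝ (Fin N)) 1, ENNReal.ofReal (‖z‖ ^ (β - N))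
  have hI : I < ∞ := by
    have := hint.2
    rw [hasFiniteIntegral_iff_ofReal (Eventually.of_forall fun x => by positivity)] at this
    exact this
  -- The added `1` only makes the constant visibly positive.
  refine ⟨I.toReal + 1, by positivity, fun x R hR => ?_⟩
  have hset : Metric.ball x R = {y | R⁻¹ • (y - x) ∈ Metric.ball (0 : EuclideanSpace ℝ (Fin N)) 1} := by
    ext y
    simp only [Metric.mem_ball, dist_eq_norm, mem_ofPred_eq, sub_zero, norm_smul, norm_inv,
      Real.norm_of_nonneg hR.le]
    rw [inv_mul_lt_one₀ hR]
  rw [hset, setLIntegral_norm_rpow_scale _ measurableSet_ball x hR, add_sub_cancel,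
    mul_comm, ENNReal.ofReal_mul (by positivity)]
  gcongr
  refine (ENNReal.ofReal_toReal hI.ne).symm.le.trans (ENNReal.ofReal_le_ofReal (by linarith))

lemma exists_lintegral_compl_ball_rpow_le {a : ℝ} (ha : (N : ℝ) < a) :
    ∃ c : ℝ, 0 < c ∧ ∀ (x : EuclideanSpace ℝ (Fin N)) (R : ℝ), 0 < R →
      ∫⁻ y in (Metric.ball x R)ᶜ, ENNReal.ofReal (‖y - x‖ ^ (-a)) ≤
        ENNReal.ofReal (c * R ^ ((N : ℝ) - a)) := by
  set I := ∫⁻ z in (Metric.ball (0 : EuclideanSpace ℝ (Fin N)) 1)ᶜ, ENNReal.ofReal (‖z‖ ^ (-a))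
  have ha0 : 0 < a := (Nat.cast_nonneg N).trans_lt ha
  have hI : I < ∞ := by
    have h := finite_integral_one_add_norm (E := EuclideanSpace ℝ (Fin N)) (r := a) (μ := volume)
      (by rw [finrank_euclideanSpace_fin]; exact ha)
    -- Outside the unit ball `1 + ‖z‖ ≤ 2‖z‖`, which gives the factor `2^a`.
    calc I ≤ ∫⁻ z in (Metric.ball (0 : EuclideanSpace ℝ (Fin N)) 1)ᶜ,
          ENNReal.ofReal (2 ^ a) * ENNReal.ofReal ((1 + ‖z‖) ^ (-a)) := by
          refine setLIntegral_mono (by fun_prop) fun z hz => ?_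
          rw [← ENNReal.ofReal_mul (by positivity)]
          refine ENNReal.ofReal_le_ofReal ?_
          have hz1 : 1 ≤ ‖z‖ := by simpa using hz
          rw [Real.rpow_neg (by positivity), Real.rpow_neg (by positivity), ← div_eq_mul_inv,
            ← Real.inv_rpow (by positivity), ← Real.div_rpow (by positivity) (by positivity)]
          refine Real.rpow_le_rpow (by positivity) ?_ ha0.le
          rw [inv_eq_one_div, div_le_div_iff₀ (by positivity) (by positivity)]
          linarith
      _ ≤ ∫⁻ z : EuclideanSpace ℝ (Fin N),
          ENNReal.ofReal (2 ^ a) * ENNReal.ofReal ((1 + ‖z‖) ^ (-a)) := setLIntegral_le_lintegral _ _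
      _ = ENNReal.ofReal (2 ^ a) * ∫⁻ z : EuclideanSpace ℝ (Fin N),
          ENNReal.ofReal ((1 + ‖z‖) ^ (-a)) := lintegral_const_mul' _ _ ENNReal.ofReal_ne_top
      _ < ∞ := ENNReal.mul_lt_top ENNReal.ofReal_lt_top h
  refine ⟨I.toReal + 1, by positivity, fun x R hR => ?_⟩
  have hset : (Metric.ball x R)ᶜ =
      {y | R⁻¹ • (y - x) ∈ (Metric.ball (0 : EuclideanSpace ℝ (Fin N)) 1)ᶜ} := by
    ext y
    simp only [Metric.mem_ball, dist_eq_norm, mem_ofPred_eq, sub_zero, norm_smul, norm_inv,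
      Real.norm_of_nonneg hR.le, mem_compl_iff]
    rw [inv_mul_lt_one₀ hR]
  rw [hset, setLIntegral_norm_rpow_scale _ measurableSet_ball.compl x hR, ← sub_eq_add_neg,
    mul_comm, ENNReal.ofReal_mul (by positivity)]
  gcongr
  refine (ENNReal.ofReal_toReal hI.ne).symm.le.trans (ENNReal.ofReal_le_ofReal (by linarith))

lemma volume_ball_eq (x : EuclideanSpace ℝ (Fin N)) {R : ℝ} (hR : 0 < R) :
    volume (Metric.ball x R) = ENNReal.ofReal (R ^ N) *
      volume (Metric.ball (0 : EuclideanSpace ℝ (Fin N)) 1) := by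
  have := Measure.addHaar_ball_of_pos (volume : Measure (EuclideanSpace ℝ (Fin N))) x hR
  rwa [finrank_euclideanSpace_fin] at this

end PowerIntegrals

/-- The Hölder inequality on a set of finite measure, for a power `κ ≤ 1`. -/
lemma setLIntegral_rpow_le {α : Type*} [MeasurableSpace α] {μ : Measure α} (A : Set α)
    {f : α → ℝ≥0∞} (hf : Measurable f) {κ : ℝ} (h0 : 0 ≤ κ) (h1 : κ ≤ 1) :
    ∫⁻ x in A, f x ^ κ ∂μ ≤ (∫⁻ x in A, f x ∂μ) ^ κ * μ A ^ (1 - κ) := by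
  have := ENNReal.lintegral_mul_norm_pow_le (μ := μ.restrict A) hf.aemeasurable
    (aemeasurable_const (b := (1 : ℝ≥0∞))) h0 (sub_nonneg.2 h1) (by ring)
  simpa using this

/-- The cutoff function equal to `1` on `B_ρ(x₀)`, to `0` outside `B_{2ρ}(x₀)`, and affine in the
radius in between. -/
noncomputable def cutoff {E : Type*} [NormedAddCommGroup E] (x₀ : E) (ρ : ℝ) (x : E) : ℝ :=
  max 0 (min 1 (2 - ‖x - x₀‖ / ρ))

section Cutoff

variable {E : Type*} [NormedAddCommGroup E] {x₀ : E} {ρ : ℝ}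

lemma cutoff_nonneg (x : E) : 0 ≤ cutoff x₀ ρ x := le_max_left _ _

lemma cutoff_le_one (x : E) : cutoff x₀ ρ x ≤ 1 := max_le zero_le_one (min_le_left _ _)

lemma cutoff_eq_one (hρ : 0 < ρ) {x : E} (hx : x ∈ Metric.ball x₀ ρ) : cutoff x₀ ρ x = 1 := by
  rw [Metric.mem_ball, dist_eq_norm] at hx
  have : ‖x - x₀‖ / ρ ≤ 1 := (div_le_one hρ).2 hx.le
  unfold cutoff
  rw [min_eq_left (by linarith), max_eq_right zero_le_one]

lemma cutoff_eq_zero (hρ : 0 < ρ) {x : E} (hx : x ∉ Metric.ball x₀ (2 * ρ)) :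
    cutoff x₀ ρ x = 0 := by
  rw [Metric.mem_ball, dist_eq_norm, not_lt] at hx
  have : 2 ≤ ‖x - x₀‖ / ρ := (le_div_iff₀ hρ).2 hx
  exact max_eq_left ((min_le_right _ _).trans (by linarith))

lemma continuous_cutoff : Continuous (cutoff x₀ ρ) := by
  unfold cutoff
  fun_prop

lemma abs_cutoff_sub_le (hρ : 0 < ρ) (x y : E) :
    |cutoff x₀ ρ x - cutoff x₀ ρ y| ≤ ‖x - y‖ / ρ := by
  unfold cutoff
  refine (abs_max_sub_max_le_max _ _ _ _).trans ?_
  rw [sub_self, abs_zero, max_eq_right (abs_nonneg _)]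
  rw [min_comm 1, min_comm 1]
  refine (abs_min_sub_min_le_max _ _ _ _).trans ?_
  rw [sub_self, abs_zero, max_eq_left (abs_nonneg _)]
  have h : 2 - ‖x - x₀‖ / ρ - (2 - ‖y - x₀‖ / ρ) = (‖y - x₀‖ - ‖x - x₀‖) / ρ := by ring
  rw [h, abs_div, abs_of_pos hρ]
  gcongr
  rw [abs_sub_comm]
  refine (abs_norm_sub_norm_le _ _).trans ?_
  simp

end Cutoff

/-! ### The energy inequality at a fixed time -/

/-- The truncated power `(a + ε)^{r-1} ζ^p` used as a test function. -/
noncomputable def testFun {E : Type*} [NormedAddCommGroup E] (p r ε : ℝ) (x₀ : E) (ρ : ℝ)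
    (u : E → ℝ) (x : E) : ℝ :=
  (u x + ε) ^ (r - 1) * cutoff x₀ ρ x ^ p

section FixedTime

variable {N : ℕ} {p s C₂ r : ℝ}

lemma testFun_eq_zero (hp : 1 < p) {ε ρ : ℝ} (hρ : 0 < ρ) {x₀ x : EuclideanSpace ℝ (Fin N)}
    (u : EuclideanSpace ℝ (Fin N) → ℝ) (hx : x ∉ Metric.ball x₀ (2 * ρ)) :
    testFun p r ε x₀ ρ u x = 0 := by
  rw [testFun, cutoff_eq_zero hρ hx, Real.zero_rpow (by linarith), mul_zero]

lemma testFun_nonneg {ε ρ : ℝ} {x₀ x : EuclideanSpace ℝ (Fin N)}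
    {u : EuclideanSpace ℝ (Fin N) → ℝ} (hx : 0 ≤ u x + ε) :
    0 ≤ testFun p r ε x₀ ρ u x :=
  mul_nonneg (Real.rpow_nonneg hx _) (Real.rpow_nonneg (cutoff_nonneg _) _)

lemma testFun_le (hp : 1 < p) {ε ρ : ℝ} {x₀ x : EuclideanSpace ℝ (Fin N)}
    {u : EuclideanSpace ℝ (Fin N) → ℝ} (hx : 0 ≤ u x + ε) :
    testFun p r ε x₀ ρ u x ≤ (u x + ε) ^ (r - 1) :=
  mul_le_of_le_one_right (Real.rpow_nonneg hx _)
    (Real.rpow_le_one (cutoff_nonneg _) (cutoff_le_one _) (by linarith))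

/-- Adding `ε` to both values leaves the flux unchanged and makes its arguments positive, so that
`flux_mul_ge` applies. The Lipschitz bound for the cutoff contributes `(‖x - y‖/ρ)^p` and thereby
weakens the singularity of the kernel from `-(N + ps)` to `p - ps - N`, which is locally integrable
when `s < 1`. -/
lemma near_pointwise (hp : 1 < p) (hr : 1 < r) (hC : 0 < C₂)
    {x₀ : EuclideanSpace ℝ (Fin N)} {ρ ε k : ℝ} (hρ : 0 < ρ) (hε : 0 < ε)
    {u : EuclideanSpace ℝ (Fin N) → ℝ} {x y : EuclideanSpace ℝ (Fin N)}
    (hx : 0 ≤ u x) (hy : 0 ≤ u y) (hk0 : 0 ≤ k) (hk : k ≤ C₂ / ‖x - y‖ ^ ((N : ℝ) + p * s)) :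
    -(flux p (u x) (u y) * k * (testFun p r ε x₀ ρ u x - testFun p r ε x₀ ρ u y)) ≤
      nearConst p r * C₂ * ρ ^ (-p) *
        (((u x + ε) ^ (p + r - 2) + (u y + ε) ^ (p + r - 2)) * ‖x - y‖ ^ (p - p * s - N)) := by
  have hc := nearConst_pos hp hr
  rcases eq_or_ne x y with rfl | hxy
  · rw [sub_self, mul_zero, neg_zero]
    positivity
  have hd : 0 < ‖x - y‖ := norm_pos_iff.2 (sub_ne_zero.2 hxy)
  have h1 := flux_mul_ge hp hr (a := u x + ε) (b := u y + ε) (by linarith) (by linarith)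
    (cutoff_nonneg (x₀ := x₀) (ρ := ρ) x) (cutoff_nonneg (x₀ := x₀) (ρ := ρ) y)
  have h2 : flux p (u x + ε) (u y + ε) = flux p (u x) (u y) := by
    unfold flux
    rw [add_sub_add_right_eq_sub]
  rw [h2] at h1
  set G := flux p (u x) (u y) * (testFun p r ε x₀ ρ u x - testFun p r ε x₀ ρ u y) with hG
  set V := (u x + ε) ^ (p + r - 2) + (u y + ε) ^ (p + r - 2)
  have hV : 0 ≤ V := by positivity
  have h3 : -G ≤ nearConst p r * V * (‖x - y‖ / ρ) ^ p := by
    have h4 : |cutoff x₀ ρ x - cutoff x₀ ρ y| ^ p ≤ (‖x - y‖ / ρ) ^ p :=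
      Real.rpow_le_rpow (abs_nonneg _) (abs_cutoff_sub_le hρ x y) (by linarith)
    have h5 := mul_le_mul_of_nonneg_left h4 (by positivity : 0 ≤ nearConst p r * V)
    unfold testFun at hG
    linarith
  calc -(flux p (u x) (u y) * k * (testFun p r ε x₀ ρ u x - testFun p r ε x₀ ρ u y))
      = -G * k := by rw [hG]; ring
    _ ≤ nearConst p r * V * (‖x - y‖ / ρ) ^ p * k := by gcongr
    _ ≤ nearConst p r * V * (‖x - y‖ / ρ) ^ p * (C₂ / ‖x - y‖ ^ ((N : ℝ) + p * s)) := by gcongr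
    _ = nearConst p r * C₂ * ρ ^ (-p) * (V * (‖x - y‖ ^ p / ‖x - y‖ ^ ((N : ℝ) + p * s))) := by
      rw [Real.div_rpow hd.le hρ.le, Real.rpow_neg hρ.le]
      field_simp
    _ = _ := by
      rw [← Real.rpow_sub hd]
      congr 3
      ring

/-- The gap of width `ρ` between the two balls gives `‖y - x₀‖ ≤ ‖x - y‖ + 2ρ ≤ 3‖x - y‖`. This is
why the splitting is made at radius `3ρ` while the cutoff lives in radius `2ρ`. -/
lemma norm_sub_le_three {x₀ x y : EuclideanSpace ℝ (Fin N)} {ρ : ℝ}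
    (hx : x ∈ Metric.ball x₀ (2 * ρ)) (hy : y ∉ Metric.ball x₀ (3 * ρ)) :
    ρ ≤ ‖x - y‖ ∧ ‖y - x₀‖ ≤ 3 * ‖x - y‖ := by
  rw [Metric.mem_ball, dist_eq_norm] at *
  have : ‖y - x₀‖ ≤ ‖x - y‖ + ‖x - x₀‖ := by
    rw [← norm_sub_rev y x]
    exact norm_sub_le_norm_sub_add_norm_sub _ _ _
  constructor <;> linarith

/-- As `u x ≥ 0`, the flux is at least `-u_+(y)^{p-1}`, so negative values of `u` outside the ball
only help. The factor `3^{N+ps}` is the price for replacing `‖x - y‖` by `‖y - x₀‖`, after which the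
variables `x` and `y` separate. -/
lemma far_pointwise (hp : 1 < p) (hs : 0 < s) (hC : 0 < C₂)
    {x₀ : EuclideanSpace ℝ (Fin N)} {ρ ε k : ℝ} (hρ : 0 < ρ) (hε : 0 < ε)
    {u : EuclideanSpace ℝ (Fin N) → ℝ} {x y : EuclideanSpace ℝ (Fin N)}
    (hx : x ∈ Metric.ball x₀ (2 * ρ)) (hy : y ∉ Metric.ball x₀ (3 * ρ))
    (hux : 0 ≤ u x) (hk0 : 0 ≤ k) (hk : k ≤ C₂ / ‖x - y‖ ^ ((N : ℝ) + p * s)) :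
    -(flux p (u x) (u y) * k * testFun p r ε x₀ ρ u x) ≤
      (u x + ε) ^ (r - 1) * (C₂ * 3 ^ ((N : ℝ) + p * s) *
        (max (u y) 0 ^ (p - 1) * ‖y - x₀‖ ^ (-((N : ℝ) + p * s)))) := by
  obtain ⟨h1, h2⟩ := norm_sub_le_three hx hy
  have hy0 : 0 < ‖y - x₀‖ := by
    rw [Metric.mem_ball, dist_eq_norm] at hy
    linarith
  have hD : 0 < (N : ℝ) + p * s := by positivity
  have hk' : k ≤ C₂ * 3 ^ ((N : ℝ) + p * s) * ‖y - x₀‖ ^ (-((N : ℝ) + p * s)) := by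
    refine hk.trans ?_
    rw [Real.rpow_neg hy0.le, ← div_eq_mul_inv, mul_div_assoc, ← Real.div_rpow (by norm_num) hy0.le,
      div_eq_mul_inv, ← Real.inv_rpow (norm_nonneg _)]
    refine mul_le_mul_of_nonneg_left (Real.rpow_le_rpow (by positivity) ?_ hD.le) hC.le
    rw [inv_eq_one_div, div_le_div_iff₀ (by linarith) hy0]
    linarith
  have hf := flux_ge_neg (b := u y) hp hux
  have hg0 : 0 ≤ testFun p r ε x₀ ρ u x := testFun_nonneg (by linarith)
  have hg1 : testFun p r ε x₀ ρ u x ≤ (u x + ε) ^ (r - 1) := testFun_le hp (by linarith)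
  have hm : 0 ≤ max (u y) 0 ^ (p - 1) := by positivity
  calc -(flux p (u x) (u y) * k * testFun p r ε x₀ ρ u x)
      = -flux p (u x) (u y) * (k * testFun p r ε x₀ ρ u x) := by ring
    _ ≤ max (u y) 0 ^ (p - 1) * (k * testFun p r ε x₀ ρ u x) :=
      mul_le_mul_of_nonneg_right (by linarith) (by positivity)
    _ ≤ max (u y) 0 ^ (p - 1) * ((C₂ * 3 ^ ((N : ℝ) + p * s) *
          ‖y - x₀‖ ^ (-((N : ℝ) + p * s))) * (u x + ε) ^ (r - 1)) := by
      gcongr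
    _ = _ := by ring

lemma add_rpow_le_two_rpow_mul {a b : ℝ} (ha : 0 ≤ a) (hb : 0 ≤ b) (hr : 0 < r) :
    (a + b) ^ r ≤ 2 ^ r * (a ^ r + b ^ r) := by
  rcases le_total a b with h | h
  · calc (a + b) ^ r ≤ (2 * b) ^ r := Real.rpow_le_rpow (by linarith) (by linarith) hr.le
      _ = 2 ^ r * b ^ r := Real.mul_rpow (by norm_num) hb
      _ ≤ _ := by gcongr; linarith [Real.rpow_nonneg ha r]
  · calc (a + b) ^ r ≤ (2 * a) ^ r := Real.rpow_le_rpow (by linarith) (by linarith) hr.le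
      _ = 2 ^ r * a ^ r := Real.mul_rpow (by norm_num) ha
      _ ≤ _ := by gcongr; linarith [Real.rpow_nonneg hb r]

/-- The measure of the unit ball. -/
noncomputable def unitVol (N : ℕ) : ℝ :=
  (volume (Metric.ball (0 : EuclideanSpace ℝ (Fin N)) 1)).toReal

lemma unitVol_nonneg : 0 ≤ unitVol N := ENNReal.toReal_nonneg

lemma volume_ball_mul (x : EuclideanSpace ℝ (Fin N)) {c R : ℝ} (hc : 0 < c) (hR : 0 < R) :
    volume (Metric.ball x (c * R)) = ENNReal.ofReal (c ^ N * unitVol N * R ^ N) := by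
  rw [volume_ball_eq x (mul_pos hc hR), unitVol,
    ← ENNReal.ofReal_toReal (measure_ball_lt_top (μ := volume)
      (x := (0 : EuclideanSpace ℝ (Fin N))) (r := 1)).ne,
    ← ENNReal.ofReal_mul (by positivity), ENNReal.toReal_ofReal ENNReal.toReal_nonneg]
  congr 1
  ring

/-- Over a ball of radius comparable to `ρ` the shift contributes a multiple of `ε^r ρ^N`, which the
condition `ε^r ρ^N ≤ S` lets `S` swallow. -/
lemma lintegral_add_rpow_le (hr : 1 < r) {x₀ : EuclideanSpace ℝ (Fin N)} {ρ ε S : ℝ} (hρ : 0 < ρ)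
    (hε : 0 < ε) {u : EuclideanSpace ℝ (Fin N) → ℝ}
    (hu0 : ∀ x ∈ Metric.ball x₀ (3 * ρ), 0 ≤ u x)
    (hS : ∫⁻ x, ENNReal.ofReal (max (u x) 0 ^ r) ≤ ENNReal.ofReal S) (hS' : ε ^ r * ρ ^ N ≤ S) :
    ∫⁻ x in Metric.ball x₀ (3 * ρ), ENNReal.ofReal ((u x + ε) ^ r) ≤
      ENNReal.ofReal (2 ^ r * (1 + 3 ^ N * unitVol N) * S) := by
  have hω := unitVol_nonneg (N := N)
  have hS0 : 0 < S := lt_of_lt_of_le (by positivity) hS'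
  calc ∫⁻ x in Metric.ball x₀ (3 * ρ), ENNReal.ofReal ((u x + ε) ^ r)
      ≤ ∫⁻ x in Metric.ball x₀ (3 * ρ), ENNReal.ofReal (2 ^ r) *
          (ENNReal.ofReal (max (u x) 0 ^ r) + ENNReal.ofReal (ε ^ r)) := by
        refine setLIntegral_mono' measurableSet_ball fun x hx => ?_
        rw [← ENNReal.ofReal_add (by positivity) (by positivity),
          ← ENNReal.ofReal_mul (by positivity), max_eq_left (hu0 x hx)]
        exact ENNReal.ofReal_le_ofReal (add_rpow_le_two_rpow_mul (hu0 x hx) hε.le (by linarith))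
    _ = ENNReal.ofReal (2 ^ r) * ((∫⁻ x in Metric.ball x₀ (3 * ρ),
          ENNReal.ofReal (max (u x) 0 ^ r)) + ENNReal.ofReal (ε ^ r) *
            volume (Metric.ball x₀ (3 * ρ))) := by
        rw [lintegral_const_mul' _ _ ENNReal.ofReal_ne_top,
          lintegral_add_right _ measurable_const, setLIntegral_const]
    _ ≤ ENNReal.ofReal (2 ^ r) * (ENNReal.ofReal S + ENNReal.ofReal (3 ^ N * unitVol N * S)) := by
        gcongr
        · exact (setLIntegral_le_lintegral _ _).trans hS
        · rw [volume_ball_mul x₀ (by norm_num) hρ, ← ENNReal.ofReal_mul (by positivity)]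
          refine ENNReal.ofReal_le_ofReal ?_
          calc ε ^ r * (3 ^ N * unitVol N * ρ ^ N) = 3 ^ N * unitVol N * (ε ^ r * ρ ^ N) := by ring
            _ ≤ _ := by gcongr
    _ = _ := by
        rw [← ENNReal.ofReal_add (by positivity) (by positivity),
          ← ENNReal.ofReal_mul (by positivity)]
        congr 1
        ring

/-- Powers `κ ≤ r` of `u + ε` on the ball of radius `3ρ`. -/
lemma lintegral_add_rpow_le_of_le (hr : 1 < r) {x₀ : EuclideanSpace ℝ (Fin N)} {ρ ε S κ : ℝ}
    (hρ : 0 < ρ) (hε : 0 < ε) {u : EuclideanSpace ℝ (Fin N) → ℝ} (hu : Measurable u)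
    (hu0 : ∀ x ∈ Metric.ball x₀ (3 * ρ), 0 ≤ u x)
    (hS : ∫⁻ x, ENNReal.ofReal (max (u x) 0 ^ r) ≤ ENNReal.ofReal S) (hS' : ε ^ r * ρ ^ N ≤ S)
    (hκ : 0 ≤ κ) (hκr : κ ≤ r) :
    ∫⁻ x in Metric.ball x₀ (3 * ρ), ENNReal.ofReal ((u x + ε) ^ κ) ≤
      ENNReal.ofReal ((2 ^ r * (1 + 3 ^ N * unitVol N) * S) ^ (κ / r) *
        (3 ^ N * unitVol N * ρ ^ N) ^ (1 - κ / r)) := by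
  have hω := unitVol_nonneg (N := N)
  have hr0 : 0 < r := by linarith
  have hS0 : 0 < S := lt_of_lt_of_le (by positivity) hS'
  have h1 : κ / r ≤ 1 := (div_le_one hr0).2 hκr
  calc ∫⁻ x in Metric.ball x₀ (3 * ρ), ENNReal.ofReal ((u x + ε) ^ κ)
      = ∫⁻ x in Metric.ball x₀ (3 * ρ), ENNReal.ofReal ((u x + ε) ^ r) ^ (κ / r) := by
        refine setLIntegral_congr_fun measurableSet_ball fun x hx => ?_
        have h : 0 ≤ u x + ε := by linarith [hu0 x hx]
        rw [ENNReal.ofReal_rpow_of_nonneg (by positivity) (by positivity), ← Real.rpow_mul h,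
          mul_div_cancel₀ _ hr0.ne']
    _ ≤ (∫⁻ x in Metric.ball x₀ (3 * ρ), ENNReal.ofReal ((u x + ε) ^ r)) ^ (κ / r) *
          volume (Metric.ball x₀ (3 * ρ)) ^ (1 - κ / r) :=
        setLIntegral_rpow_le _ (by fun_prop) (by positivity) h1
    _ ≤ ENNReal.ofReal (2 ^ r * (1 + 3 ^ N * unitVol N) * S) ^ (κ / r) *
          ENNReal.ofReal (3 ^ N * unitVol N * ρ ^ N) ^ (1 - κ / r) := by
        gcongr
        · exact lintegral_add_rpow_le hr hρ hε hu0 hS hS'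
        · rw [volume_ball_mul x₀ (by norm_num) hρ]
    _ = _ := by
        rw [ENNReal.ofReal_rpow_of_nonneg (by positivity) (by positivity),
          ENNReal.ofReal_rpow_of_nonneg (by positivity) (by linarith),
          ← ENNReal.ofReal_mul (by positivity)]

end FixedTime

/-! ### Local and nonlocal parts of the energy, integrated by Hölder's inequality. -/

section FixedTime

variable {N : ℕ} {p s C₂ r : ℝ}

/-- By Tonelli it suffices to integrate the weight in one variable, uniformly in the other; for `x`
in the ball, `B_{3ρ}(x₀)` lies in `B_{6ρ}(x)`, whence the `6`. The two summands are exchanged by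
symmetry, whence the `2`. -/
lemma lintegral_near_le {x₀ : EuclideanSpace ℝ (Fin N)} {ρ β c : ℝ} (hρ : 0 < ρ)
    (hc : 0 < c) (h : ∀ (x : EuclideanSpace ℝ (Fin N)) (R : ℝ), 0 < R →
      ∫⁻ y in Metric.ball x R, ENNReal.ofReal (‖y - x‖ ^ (β - N)) ≤ ENNReal.ofReal (c * R ^ β))
    {V : EuclideanSpace ℝ (Fin N) → ℝ≥0∞} (hV : Measurable V) :
    ∫⁻ z in Metric.ball x₀ (3 * ρ) ×ˢ Metric.ball x₀ (3 * ρ),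
      (V z.1 + V z.2) * ENNReal.ofReal (‖z.1 - z.2‖ ^ (β - N)) ≤
      ENNReal.ofReal (2 * c * 6 ^ β * ρ ^ β) * ∫⁻ x in Metric.ball x₀ (3 * ρ), V x := by
  set B := Metric.ball x₀ (3 * ρ)
  have hker : ∀ x ∈ B, ∫⁻ y in B, ENNReal.ofReal (‖x - y‖ ^ (β - N)) ≤
      ENNReal.ofReal (c * 6 ^ β * ρ ^ β) := by
    intro x hx
    have hsub : B ⊆ Metric.ball x (6 * ρ) := by
      intro y hy
      rw [Metric.mem_ball] at *
      have := dist_triangle_right y x x₀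
      linarith
    refine (lintegral_mono_set hsub).trans ?_
    simp_rw [norm_sub_rev x]
    refine (h x (6 * ρ) (by positivity)).trans_eq ?_
    rw [Real.mul_rpow (by norm_num) hρ.le, mul_assoc]
  have hone : ∫⁻ x in B, ∫⁻ y in B, V x * ENNReal.ofReal (‖x - y‖ ^ (β - N)) ≤
      ENNReal.ofReal (c * 6 ^ β * ρ ^ β) * ∫⁻ x in B, V x := by
    rw [← lintegral_const_mul' _ _ ENNReal.ofReal_ne_top]
    refine setLIntegral_mono' measurableSet_ball fun x hx => ?_
    rw [lintegral_const_mul _ (by fun_prop), mul_comm]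
    gcongr
    exact hker x hx
  have hm1 : Measurable fun z : EuclideanSpace ℝ (Fin N) × EuclideanSpace ℝ (Fin N) =>
      V z.1 * ENNReal.ofReal (‖z.1 - z.2‖ ^ (β - N)) := by fun_prop
  have hm2 : Measurable fun z : EuclideanSpace ℝ (Fin N) × EuclideanSpace ℝ (Fin N) =>
      V z.2 * ENNReal.ofReal (‖z.1 - z.2‖ ^ (β - N)) := by fun_prop
  simp_rw [add_mul]
  rw [lintegral_add_left hm1, Measure.volume_eq_prod, ← Measure.prod_restrict,
    lintegral_prod _ hm1.aemeasurable, lintegral_prod_symm _ hm2.aemeasurable]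
  have h2 : ENNReal.ofReal (2 * c * 6 ^ β * ρ ^ β) =
      ENNReal.ofReal (c * 6 ^ β * ρ ^ β) + ENNReal.ofReal (c * 6 ^ β * ρ ^ β) := by
    rw [← ENNReal.ofReal_add (by positivity) (by positivity)]
    congr 1
    ring
  rw [h2, add_mul]
  refine add_le_add hone ?_
  simp_rw [fun x y : EuclideanSpace ℝ (Fin N) => norm_sub_rev x y] at hone ⊢
  exact hone

/-- Hölder's inequality with exponents `r/(p-1)` and `r/(r-p+1)`: the tail, of order `p - 1` in `u`,
is bounded by the total `r`-mass, the weight supplying the power of `ρ`. -/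
lemma lintegral_far_le (hp : 1 < p) (hp2 : p < 2) (hr : 1 < r) {D c : ℝ}
    (hc : 0 < c) {x₀ : EuclideanSpace ℝ (Fin N)} {ρ S : ℝ} (hρ : 0 < ρ) (hS0 : 0 ≤ S)
    (h : ∫⁻ y in (Metric.ball x₀ (3 * ρ))ᶜ, ENNReal.ofReal (‖y - x₀‖ ^ (-(D * (r / (r - p + 1)))))
      ≤ ENNReal.ofReal (c * (3 * ρ) ^ ((N : ℝ) - D * (r / (r - p + 1)))))
    {u : EuclideanSpace ℝ (Fin N) → ℝ} (hu : Measurable u)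
    (hS : ∫⁻ x, ENNReal.ofReal (max (u x) 0 ^ r) ≤ ENNReal.ofReal S) :
    ∫⁻ y in (Metric.ball x₀ (3 * ρ))ᶜ,
      ENNReal.ofReal (max (u y) 0 ^ (p - 1) * ‖y - x₀‖ ^ (-D)) ≤
      ENNReal.ofReal (S ^ ((p - 1) / r) *
        (c * (3 * ρ) ^ ((N : ℝ) - D * (r / (r - p + 1)))) ^ ((r - p + 1) / r)) := by
  have hr0 : 0 < r := by linarith
  have hq : 0 < r - p + 1 := by linarith
  have hp1 : 0 < p - 1 := by linarith
  have e1 : 0 ≤ (p - 1) / r := by positivity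
  have e2 : 0 ≤ (r - p + 1) / r := by positivity
  calc _ = ∫⁻ y in (Metric.ball x₀ (3 * ρ))ᶜ, ENNReal.ofReal (max (u y) 0 ^ r) ^ ((p - 1) / r) *
          ENNReal.ofReal (‖y - x₀‖ ^ (-(D * (r / (r - p + 1))))) ^ ((r - p + 1) / r) := by
        refine lintegral_congr fun y => ?_
        rw [ENNReal.ofReal_rpow_of_nonneg (by positivity) e1,
          ENNReal.ofReal_rpow_of_nonneg (by positivity) e2, ← Real.rpow_mul (by positivity),
          ← Real.rpow_mul (by positivity), ← ENNReal.ofReal_mul (by positivity)]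
        congr 3
        · field_simp
        · field_simp
    _ ≤ (∫⁻ y in (Metric.ball x₀ (3 * ρ))ᶜ, ENNReal.ofReal (max (u y) 0 ^ r)) ^ ((p - 1) / r) *
          (∫⁻ y in (Metric.ball x₀ (3 * ρ))ᶜ,
            ENNReal.ofReal (‖y - x₀‖ ^ (-(D * (r / (r - p + 1)))))) ^ ((r - p + 1) / r) :=
        ENNReal.lintegral_mul_norm_pow_le (by fun_prop) (by fun_prop) e1 e2 (by field_simp; ring)
    _ ≤ ENNReal.ofReal S ^ ((p - 1) / r) *
          ENNReal.ofReal (c * (3 * ρ) ^ ((N : ℝ) - D * (r / (r - p + 1)))) ^ ((r - p + 1) / r) := by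
        gcongr
        exact (setLIntegral_le_lintegral _ _).trans hS
    _ = _ := by
        rw [ENNReal.ofReal_rpow_of_nonneg hS0 e1,
          ENNReal.ofReal_rpow_of_nonneg (by positivity) e2, ← ENNReal.ofReal_mul (by positivity)]

/-- The negative part of the energy density, split into its local and nonlocal parts. -/
lemma neg_energy_le (hp : 1 < p) (hs : 0 < s) (hr : 1 < r) (hC : 0 < C₂)
    {x₀ : EuclideanSpace ℝ (Fin N)} {ρ ε : ℝ} (hρ : 0 < ρ) (hε : 0 < ε)
    {u : EuclideanSpace ℝ (Fin N) → ℝ} (hu0 : ∀ x ∈ Metric.ball x₀ (3 * ρ), 0 ≤ u x)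
    {k : EuclideanSpace ℝ (Fin N) → EuclideanSpace ℝ (Fin N) → ℝ} (hk0 : ∀ x y, 0 ≤ k x y)
    (hk : ∀ x y, k x y ≤ C₂ / ‖x - y‖ ^ ((N : ℝ) + p * s)) (x y : EuclideanSpace ℝ (Fin N)) :
    ENNReal.ofReal (-(flux p (u x) (u y) * k x y *
        (testFun p r ε x₀ ρ u x - testFun p r ε x₀ ρ u y))) ≤
      (Metric.ball x₀ (3 * ρ) ×ˢ Metric.ball x₀ (3 * ρ)).indicator (fun z =>
        ENNReal.ofReal (nearConst p r * C₂ * ρ ^ (-p)) *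
          ((ENNReal.ofReal ((u z.1 + ε) ^ (p + r - 2)) +
            ENNReal.ofReal ((u z.2 + ε) ^ (p + r - 2))) *
              ENNReal.ofReal (‖z.1 - z.2‖ ^ (p - p * s - N)))) (x, y) +
      ((Metric.ball x₀ (3 * ρ)).indicator (fun x => ENNReal.ofReal ((u x + ε) ^ (r - 1))) x *
        (Metric.ball x₀ (3 * ρ))ᶜ.indicator (fun y => ENNReal.ofReal (C₂ * 3 ^ ((N : ℝ) + p * s)) *
          ENNReal.ofReal (max (u y) 0 ^ (p - 1) * ‖y - x₀‖ ^ (-((N : ℝ) + p * s)))) y +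
      (Metric.ball x₀ (3 * ρ))ᶜ.indicator (fun y => ENNReal.ofReal (C₂ * 3 ^ ((N : ℝ) + p * s)) *
          ENNReal.ofReal (max (u y) 0 ^ (p - 1) * ‖y - x₀‖ ^ (-((N : ℝ) + p * s)))) x *
        (Metric.ball x₀ (3 * ρ)).indicator (fun x => ENNReal.ofReal ((u x + ε) ^ (r - 1))) y) := by
  have h23 : Metric.ball x₀ (2 * ρ) ⊆ Metric.ball x₀ (3 * ρ) :=
    Metric.ball_subset_ball (by linarith)
  have hD : 0 ≤ (N : ℝ) + p * s := by positivity
  have hc := nearConst_pos hp hr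
  by_cases hx : x ∈ Metric.ball x₀ (3 * ρ) <;> by_cases hy : y ∈ Metric.ball x₀ (3 * ρ)
  · refine le_add_right ?_
    rw [indicator_of_mem (mk_mem_prod hx hy)]
    have hux := hu0 x hx
    have huy := hu0 y hy
    simp only
    rw [← ENNReal.ofReal_add (by positivity) (by positivity), ← ENNReal.ofReal_mul (by positivity),
      ← ENNReal.ofReal_mul (by positivity)]
    exact ENNReal.ofReal_le_ofReal
      (near_pointwise hp hr hC hρ hε (hu0 x hx) (hu0 y hy) (hk0 x y) (hk x y))
  · refine le_add_left (le_add_right ?_)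
    rw [testFun_eq_zero hp hρ u (fun h => hy (h23 h)), sub_zero, indicator_of_mem hx,
      indicator_of_mem (show y ∈ (Metric.ball x₀ (3 * ρ))ᶜ from hy)]
    -- In the annulus between radii `2ρ` and `3ρ` the test function vanishes, so only `x` in the
    -- smaller ball contributes and the gap estimate is available.
    by_cases hx2 : x ∈ Metric.ball x₀ (2 * ρ)
    · have hux := hu0 x hx
      rw [← ENNReal.ofReal_mul (by positivity), ← ENNReal.ofReal_mul (by positivity)]
      exact ENNReal.ofReal_le_ofReal
        (far_pointwise hp hs hC hρ hε hx2 hy (hu0 x hx) (hk0 x y) (hk x y))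
    · rw [testFun_eq_zero hp hρ u hx2]
      simp
  · refine le_add_left (le_add_left ?_)
    rw [testFun_eq_zero hp hρ u (fun h => hx (h23 h)), zero_sub, indicator_of_mem hy,
      indicator_of_mem (show x ∈ (Metric.ball x₀ (3 * ρ))ᶜ from hx), mul_comm (ENNReal.ofReal _ * _)]
    by_cases hy2 : y ∈ Metric.ball x₀ (2 * ρ)
    · have huy := hu0 y hy
      rw [← ENNReal.ofReal_mul (by positivity), ← ENNReal.ofReal_mul (by positivity), flux_symm]
      refine ENNReal.ofReal_le_ofReal ?_
      have := far_pointwise (r := r) hp hs hC hρ hε hy2 hx (hu0 y hy) (hk0 x y)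
        (by rw [norm_sub_rev]; exact hk x y)
      refine le_trans (le_of_eq ?_) this
      ring
    · rw [testFun_eq_zero hp hρ u hy2]
      simp
  · rw [testFun_eq_zero hp hρ u (fun h => hx (h23 h)), testFun_eq_zero hp hρ u (fun h => hy (h23 h))]
    simp

/-- The negative part of the energy tested with `(u + ε)^{r-1} ζ^p`, at a fixed time. -/
lemma exists_lintegral_neg_energy_le (hN : 1 ≤ N) (hp : 1 < p) (hp2 : p < 2) (hs : 0 < s)
    (hs1 : s < 1) (hr : 1 < r) (hC : 0 < C₂) :
    ∃ A : ℝ, 0 < A ∧ ∀ (x₀ : EuclideanSpace ℝ (Fin N)) (ρ ε S : ℝ), 0 < ρ → 0 < ε →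
      ∀ u : EuclideanSpace ℝ (Fin N) → ℝ, Measurable u →
      (∀ x ∈ Metric.ball x₀ (3 * ρ), 0 ≤ u x) →
      ∫⁻ x, ENNReal.ofReal (max (u x) 0 ^ r) ≤ ENNReal.ofReal S → ε ^ r * ρ ^ N ≤ S →
      ∀ k : EuclideanSpace ℝ (Fin N) → EuclideanSpace ℝ (Fin N) → ℝ, (∀ x y, 0 ≤ k x y) →
      (∀ x y, k x y ≤ C₂ / ‖x - y‖ ^ ((N : ℝ) + p * s)) →
      ∫⁻ z : EuclideanSpace ℝ (Fin N) × EuclideanSpace ℝ (Fin N),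
        ENNReal.ofReal (-(flux p (u z.1) (u z.2) * k z.1 z.2 *
          (testFun p r ε x₀ ρ u z.1 - testFun p r ε x₀ ρ u z.2))) ≤
        ENNReal.ofReal (A * S ^ (1 - (2 - p) / r) * ρ ^ (-lam N p s r / r)) := by
  have hβ : 0 < p - p * s := by nlinarith
  have hr0 : 0 < r := by linarith
  have hq : 0 < r - p + 1 := by linarith
  have hps : 0 < p * s := by positivity
  have hκ : 1 < r / (r - p + 1) := by rw [one_lt_div hq]; linarith
  have hN0 : (0 : ℝ) ≤ N := Nat.cast_nonneg N
  obtain ⟨c₁, hc₁, h₁⟩ := exists_lintegral_ball_rpow_le hN hβ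
  -- The Hölder conjugate factor `r/(r-p+1)` exceeds `1` because `p > 1`, so the weight decays
  -- faster than `‖y‖^{-N}` and is integrable at infinity.
  obtain ⟨c₂, hc₂, h₂⟩ := exists_lintegral_compl_ball_rpow_le (N := N)
    (a := ((N : ℝ) + p * s) * (r / (r - p + 1))) (by nlinarith)
  have hω := unitVol_nonneg (N := N)
  have hcn := nearConst_pos hp hr
  set cv := 2 ^ r * (1 + 3 ^ N * unitVol N) with hcv
  have hcv0 : 0 < cv := by positivity
  set A₁ := nearConst p r * C₂ * (2 * c₁ * 6 ^ (p - p * s)) *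
    (cv ^ ((p + r - 2) / r) * (3 ^ N * unitVol N) ^ (1 - (p + r - 2) / r)) with hA₁
  set A₂ := cv ^ ((r - 1) / r) * (3 ^ N * unitVol N) ^ (1 - (r - 1) / r) *
    (C₂ * 3 ^ ((N : ℝ) + p * s)) *
      (c₂ * 3 ^ ((N : ℝ) - ((N : ℝ) + p * s) * (r / (r - p + 1)))) ^ ((r - p + 1) / r) with hA₂
  have hA₁0 : 0 ≤ A₁ := by positivity
  have hA₂0 : 0 ≤ A₂ := by positivity
  -- `A₁` is the local contribution; `A₂` is counted twice since either variable may be the distant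
  -- one; the `1` secures positivity.
  refine ⟨A₁ + 2 * A₂ + 1, by positivity, ?_⟩
  intro x₀ ρ ε S hρ hε u hu hu0 hS hS' k hk0 hk
  have hS0 : 0 < S := lt_of_lt_of_le (by positivity) hS'
  set B := Metric.ball x₀ (3 * ρ)
  set P := S ^ (1 - (2 - p) / r) * ρ ^ (-lam N p s r / r) with hP
  have hP0 : 0 ≤ P := by positivity
  set V₁ : EuclideanSpace ℝ (Fin N) → ℝ≥0∞ := fun x => ENNReal.ofReal ((u x + ε) ^ (p + r - 2))
  set V₂ : EuclideanSpace ℝ (Fin N) → ℝ≥0∞ :=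
    B.indicator fun x => ENNReal.ofReal ((u x + ε) ^ (r - 1))
  set V₃ : EuclideanSpace ℝ (Fin N) → ℝ≥0∞ :=
    Bᶜ.indicator fun y => ENNReal.ofReal (C₂ * 3 ^ ((N : ℝ) + p * s)) *
      ENNReal.ofReal (max (u y) 0 ^ (p - 1) * ‖y - x₀‖ ^ (-((N : ℝ) + p * s)))
  have hB : MeasurableSet B := measurableSet_ball
  have hV₁ : Measurable V₁ := by fun_prop
  have hV₂ : Measurable V₂ := Measurable.indicator (by fun_prop) hB
  have hV₃ : Measurable V₃ := Measurable.indicator (by fun_prop) hB.compl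
  have hnear : ∫⁻ z, (B ×ˢ B).indicator (fun z => ENNReal.ofReal (nearConst p r * C₂ * ρ ^ (-p)) *
      ((V₁ z.1 + V₁ z.2) * ENNReal.ofReal (‖z.1 - z.2‖ ^ (p - p * s - N)))) z ≤
      ENNReal.ofReal (A₁ * P) := by
    rw [lintegral_indicator (hB.prod hB), lintegral_const_mul' _ _ ENNReal.ofReal_ne_top]
    calc _ ≤ ENNReal.ofReal (nearConst p r * C₂ * ρ ^ (-p)) *
          (ENNReal.ofReal (2 * c₁ * 6 ^ (p - p * s) * ρ ^ (p - p * s)) *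
            ENNReal.ofReal ((cv * S) ^ ((p + r - 2) / r) *
              (3 ^ N * unitVol N * ρ ^ N) ^ (1 - (p + r - 2) / r))) := by
          gcongr
          refine (lintegral_near_le hρ hc₁ h₁ hV₁).trans ?_
          gcongr
          exact lintegral_add_rpow_le_of_le hr hρ hε hu hu0 hS hS' (by linarith) (by linarith)
      _ = _ := by
          rw [← ENNReal.ofReal_mul (by positivity), ← ENNReal.ofReal_mul (by positivity)]
          congr 1
          rw [Real.mul_rpow hcv0.le hS0.le,
      Real.mul_rpow (x := 3 ^ N * unitVol N) (by positivity) (by positivity),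
            hA₁, hP]
          -- The local part is homogeneous of degree `p + r - 2` in `u`, so it carries `S` to the
          -- power `(p + r - 2)/r = 1 - (2-p)/r`.
          have e1 : S ^ ((p + r - 2) / r) = S ^ (1 - (2 - p) / r) := by
            congr 1
            field_simp
            ring
          have e2 : ρ ^ (-lam N p s r / r) =
              ρ ^ (-p) * ρ ^ (p - p * s) * (ρ ^ N) ^ (1 - (p + r - 2) / r) := by
            rw [← Real.rpow_natCast ρ N, ← Real.rpow_mul hρ.le, ← Real.rpow_add hρ,
              ← Real.rpow_add hρ]
            congr 1
            unfold lam
            field_simp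
            ring
          rw [e1, e2]
          ring
  have hV₂i : ∫⁻ x, V₂ x ≤ ENNReal.ofReal ((cv * S) ^ ((r - 1) / r) *
      (3 ^ N * unitVol N * ρ ^ N) ^ (1 - (r - 1) / r)) := by
    rw [lintegral_indicator hB]
    exact lintegral_add_rpow_le_of_le hr hρ hε hu hu0 hS hS' (by linarith) (by linarith)
  have hV₃i : ∫⁻ x, V₃ x ≤ ENNReal.ofReal (C₂ * 3 ^ ((N : ℝ) + p * s)) *
      ENNReal.ofReal (S ^ ((p - 1) / r) *
        (c₂ * (3 * ρ) ^ ((N : ℝ) - ((N : ℝ) + p * s) * (r / (r - p + 1)))) ^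
          ((r - p + 1) / r)) := by
    rw [lintegral_indicator hB.compl, lintegral_const_mul' _ _ ENNReal.ofReal_ne_top]
    gcongr
    exact lintegral_far_le hp hp2 hr hc₂ hρ hS0.le (h₂ x₀ (3 * ρ) (by positivity)) hu hS
  have hfar : (∫⁻ x, V₂ x) * ∫⁻ y, V₃ y ≤ ENNReal.ofReal (A₂ * P) := by
    refine (mul_le_mul' hV₂i hV₃i).trans_eq ?_
    rw [← ENNReal.ofReal_mul (by positivity), ← ENNReal.ofReal_mul (by positivity)]
    congr 1
    rw [Real.mul_rpow hcv0.le hS0.le,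
      Real.mul_rpow (x := 3 ^ N * unitVol N) (by positivity) (by positivity),
      Real.mul_rpow (by norm_num : (0 : ℝ) ≤ 3) hρ.le, ← mul_assoc c₂,
      Real.mul_rpow (by positivity : 0 ≤ c₂ * _) (by positivity), hA₂, hP]
    -- The nonlocal part splits the same degree as `(r - 1) + (p - 1)`, the first from the test
    -- function and the second from the tail; so both parts scale alike, in `S` and in `ρ`.
    have e1 : S ^ (1 - (2 - p) / r) = S ^ ((r - 1) / r) * S ^ ((p - 1) / r) := by
      rw [← Real.rpow_add hS0]
      congr 1
      field_simp
      ring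
    have e2 : ρ ^ (-lam N p s r / r) = (ρ ^ N) ^ (1 - (r - 1) / r) *
        (ρ ^ ((N : ℝ) - ((N : ℝ) + p * s) * (r / (r - p + 1)))) ^ ((r - p + 1) / r) := by
      rw [← Real.rpow_natCast ρ N, ← Real.rpow_mul hρ.le, ← Real.rpow_mul hρ.le,
        ← Real.rpow_add hρ]
      congr 1
      unfold lam
      field_simp
      ring
    rw [e1, e2]
    ring
  have hm23 : Measurable fun z : EuclideanSpace ℝ (Fin N) × EuclideanSpace ℝ (Fin N) =>
      V₂ z.1 * V₃ z.2 := by fun_prop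
  have hm32 : Measurable fun z : EuclideanSpace ℝ (Fin N) × EuclideanSpace ℝ (Fin N) =>
      V₃ z.1 * V₂ z.2 := by fun_prop
  calc _ ≤ ∫⁻ z : EuclideanSpace ℝ (Fin N) × EuclideanSpace ℝ (Fin N),
        ((B ×ˢ B).indicator (fun z => ENNReal.ofReal (nearConst p r * C₂ * ρ ^ (-p)) *
          ((V₁ z.1 + V₁ z.2) * ENNReal.ofReal (‖z.1 - z.2‖ ^ (p - p * s - N)))) z +
          (V₂ z.1 * V₃ z.2 + V₃ z.1 * V₂ z.2)) :=
        lintegral_mono fun z => neg_energy_le hp hs hr hC hρ hε hu0 hk0 hk z.1 z.2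
    _ = (∫⁻ z, (B ×ˢ B).indicator (fun z => ENNReal.ofReal (nearConst p r * C₂ * ρ ^ (-p)) *
          ((V₁ z.1 + V₁ z.2) * ENNReal.ofReal (‖z.1 - z.2‖ ^ (p - p * s - N)))) z) +
          ((∫⁻ x, V₂ x) * (∫⁻ y, V₃ y) + (∫⁻ x, V₃ x) * ∫⁻ y, V₂ y) := by
        rw [lintegral_add_right _ (hm23.fun_add hm32), lintegral_add_right _ hm32,
          Measure.volume_eq_prod, lintegral_prod_mul hV₂.aemeasurable hV₃.aemeasurable,
          lintegral_prod_mul hV₃.aemeasurable hV₂.aemeasurable]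
    _ ≤ ENNReal.ofReal (A₁ * P) + (ENNReal.ofReal (A₂ * P) + ENNReal.ofReal (A₂ * P)) := by
        gcongr
        rw [mul_comm]
        exact hfar
    _ ≤ _ := by
        rw [← ENNReal.ofReal_add (by positivity) (by positivity),
          ← ENNReal.ofReal_add (by positivity) (by positivity)]
        refine ENNReal.ofReal_le_ofReal ?_
        rw [mul_assoc]
        linarith

end FixedTime

/-! ### Continuity of translations in time -/

/-- Strong continuity of translations in `L^q` for finite `q`, seen as continuity of composition
with a continuous family of measure preserving maps of space-time. -/
lemma tendsto_eLpNorm_time_translate {X : Type*} [NormedAddCommGroup X] [ProperSpace X]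
    [MeasureSpace X] [BorelSpace X] [SecondCountableTopology X]
    [SigmaFinite (volume : Measure X)] [IsLocallyFiniteMeasure (volume : Measure X)]
    {f : X × ℝ → ℝ} {q : ℝ≥0∞} (hq : 1 ≤ q) (hq' : q ≠ ∞) (hf : MemLp f q) :
    Tendsto (fun k : ℝ => eLpNorm (fun z => f (z.1, z.2 + k) - f z) q volume) (𝓝 0) (𝓝 0) := by
  have : Fact (1 ≤ q) := ⟨hq⟩
  -- The family of time translations; currying a jointly continuous map makes it continuous in the
  -- shift for the compact-open topology.
  let g : C(ℝ, C(X × ℝ, X × ℝ)) :=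
    (ContinuousMap.mk (fun a : ℝ × (X × ℝ) => (a.2.1, a.2.2 + a.1)) (by fun_prop)).curry
  have hg : ∀ k, MeasurePreserving (g k) (volume : Measure (X × ℝ)) volume := fun k =>
    (MeasurePreserving.id volume).prod (measurePreserving_add_right volume k)
  have h := (tendsto_const_nhds (x := hf.toLp f)).compMeasurePreservingLp
    (g.continuous.tendsto 0) hg (hg 0) hq'
  rw [Lp.tendsto_Lp_iff_tendsto_eLpNorm'] at h
  refine h.congr fun k => eLpNorm_congr_ae ?_
  have h1 := Lp.coeFn_compMeasurePreserving (hf.toLp f) (hg k)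
  have h2 := Lp.coeFn_compMeasurePreserving (hf.toLp f) (hg 0)
  have h3 := (hg k).quasiMeasurePreserving.ae_eq_comp hf.coeFn_toLp
  have h4 := (hg 0).quasiMeasurePreserving.ae_eq_comp hf.coeFn_toLp
  filter_upwards [h1, h2, h3, h4] with z e1 e2 e3 e4
  simp only [Pi.sub_apply, e1, e2, e3, e4]
  simp [g]

lemma eLpNorm_time_translate {X : Type*} [MeasureSpace X] [SigmaFinite (volume : Measure X)]
    {f : X × ℝ → ℝ} {q : ℝ≥0∞} (hf : AEStronglyMeasurable f) (κ : ℝ) :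
    eLpNorm (fun z : X × ℝ => f (z.1, z.2 + κ)) q volume = eLpNorm f q volume :=
  eLpNorm_comp_measurePreserving (g := f) hf
    ((MeasurePreserving.id volume).prod (measurePreserving_add_right volume κ))

/-! ### Bounds for the energy form -/

/-- A measurable function `w` and a measurable kernel `k` with the regularity of a locally bounded
local weak solution that is nonnegative in `B_{3ρ}(x₀)`, for times in `(a, b)`. -/
structure Regular {N : ℕ} (p s C₂ M : ℝ) (x₀ : EuclideanSpace ℝ (Fin N)) (ρ a b : ℝ)
    (w : EuclideanSpace ℝ (Fin N) → ℝ → ℝ)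
    (k : EuclideanSpace ℝ (Fin N) → EuclideanSpace ℝ (Fin N) → ℝ → ℝ) : Prop where
  measurable : Measurable (Function.uncurry w)
  measurable_kernel : Measurable
    fun z : (EuclideanSpace ℝ (Fin N) × EuclideanSpace ℝ (Fin N)) × ℝ => k z.1.1 z.1.2 z.2
  kernel_nonneg : ∀ x y τ, 0 ≤ k x y τ
  kernel_le : ∀ x y τ, k x y τ ≤ C₂ / ‖x - y‖ ^ ((N : ℝ) + p * s)
  mem_Icc : ∀ x ∈ Metric.ball x₀ (3 * ρ), ∀ τ, w x τ ∈ Icc 0 M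
  sobolev : ∫⁻ τ in Ioo a b, ∫⁻ z in Metric.ball x₀ (3 * ρ) ×ˢ Metric.ball x₀ (3 * ρ),
    ENNReal.ofReal (|w z.1 τ - w z.2 τ| ^ p / ‖z.1 - z.2‖ ^ ((N : ℝ) + p * s)) < ∞
  tail : ∃ A : ℝ≥0∞, A < ∞ ∧ ∀ᵐ τ ∂(volume.restrict (Ioo a b)),
    ∫⁻ x, ENNReal.ofReal (|w x τ| ^ (p - 1) / (1 + ‖x‖) ^ ((N : ℝ) + p * s)) ≤ A

/-- The flux density `|w(x) - w(y)|^{p-2} (w(x) - w(y)) k(x, y)`. -/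
noncomputable def fluxDensity {N : ℕ} (p : ℝ) (w : EuclideanSpace ℝ (Fin N) → ℝ → ℝ)
    (k : EuclideanSpace ℝ (Fin N) → EuclideanSpace ℝ (Fin N) → ℝ → ℝ)
    (z : EuclideanSpace ℝ (Fin N) × EuclideanSpace ℝ (Fin N)) (τ : ℝ) : ℝ :=
  flux p (w z.1 τ) (w z.2 τ) * k z.1 z.2 τ

/-- The weighted difference quotient on `B_{3ρ}(x₀)`, whose `L^p` norm is the Gagliardo
seminorm. -/
noncomputable def quot {N : ℕ} (p s : ℝ) (x₀ : EuclideanSpace ℝ (Fin N)) (ρ : ℝ)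
    (f : EuclideanSpace ℝ (Fin N) → ℝ → ℝ)
    (z : (EuclideanSpace ℝ (Fin N) × EuclideanSpace ℝ (Fin N)) × ℝ) : ℝ :=
  (Metric.ball x₀ (3 * ρ) ×ˢ Metric.ball x₀ (3 * ρ)).indicator
    (fun y => (f y.1 z.2 - f y.2 z.2) / ‖y.1 - y.2‖ ^ (((N : ℝ) + p * s) / p)) z.1

section EnergyForm

variable {N : ℕ} {p s C₂ M ρ a b : ℝ} {x₀ : EuclideanSpace ℝ (Fin N)}
  {w : EuclideanSpace ℝ (Fin N) → ℝ → ℝ}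
  {k : EuclideanSpace ℝ (Fin N) → EuclideanSpace ℝ (Fin N) → ℝ → ℝ}

lemma measurable_fst_snd {f : EuclideanSpace ℝ (Fin N) → ℝ → ℝ}
    (hf : Measurable (Function.uncurry f)) :
    Measurable fun z : (EuclideanSpace ℝ (Fin N) × EuclideanSpace ℝ (Fin N)) × ℝ =>
      f z.1.1 z.2 :=
  hf.comp (by fun_prop : Measurable fun z :
    (EuclideanSpace ℝ (Fin N) × EuclideanSpace ℝ (Fin N)) × ℝ => (z.1.1, z.2))

lemma measurable_snd_snd {f : EuclideanSpace ℝ (Fin N) → ℝ → ℝ}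
    (hf : Measurable (Function.uncurry f)) :
    Measurable fun z : (EuclideanSpace ℝ (Fin N) × EuclideanSpace ℝ (Fin N)) × ℝ =>
      f z.1.2 z.2 :=
  hf.comp (by fun_prop : Measurable fun z :
    (EuclideanSpace ℝ (Fin N) × EuclideanSpace ℝ (Fin N)) × ℝ => (z.1.2, z.2))

lemma Regular.measurable_fluxDensity (h : Regular p s C₂ M x₀ ρ a b w k) :
    Measurable fun z : (EuclideanSpace ℝ (Fin N) × EuclideanSpace ℝ (Fin N)) × ℝ =>
      fluxDensity p w k z.1 z.2 := by
  have h1 := measurable_fst_snd h.measurable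
  have h2 := measurable_snd_snd h.measurable
  have h3 := h.measurable_kernel
  unfold fluxDensity flux
  exact (((h1.sub h2).abs.pow_const _).mul (h1.sub h2)).mul h3

lemma measurable_quot {f : EuclideanSpace ℝ (Fin N) → ℝ → ℝ}
    (hf : Measurable (Function.uncurry f)) : Measurable (quot p s x₀ ρ f) := by
  have h1 := measurable_fst_snd hf
  have h2 := measurable_snd_snd hf
  have h3 : Measurable fun z : (EuclideanSpace ℝ (Fin N) × EuclideanSpace ℝ (Fin N)) × ℝ =>
      (f z.1.1 z.2 - f z.1.2 z.2) / ‖z.1.1 - z.1.2‖ ^ (((N : ℝ) + p * s) / p) := by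
    fun_prop
  have hB : MeasurableSet (Metric.ball x₀ (3 * ρ)) := measurableSet_ball
  have h4 := h3.indicator ((hB.prod hB).preimage (measurable_fst (β := ℝ)))
  exact h4

/-- The quotient is linear in `f` and its weight does not involve time, so the Gagliardo seminorm of
a time increment is an `L^p` translation increment of one fixed function. -/
lemma quot_sub_translate (f : EuclideanSpace ℝ (Fin N) → ℝ → ℝ) (σ κ : ℝ)
    (z : (EuclideanSpace ℝ (Fin N) × EuclideanSpace ℝ (Fin N)) × ℝ) :
    quot p s x₀ ρ (fun x τ => f x (τ + κ) - f x (τ + σ)) z =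
      quot p s x₀ ρ f (z.1, z.2 + κ) - quot p s x₀ ρ f (z.1, z.2 + σ) := by
  unfold quot
  by_cases hz : z.1 ∈ Metric.ball x₀ (3 * ρ) ×ˢ Metric.ball x₀ (3 * ρ)
  · simp only [indicator_of_mem hz]
    ring
  · simp only [indicator_of_notMem hz, sub_zero]

/-- The pointwise bound of the energy density, near the diagonal. -/
lemma enorm_energy_near_le (hp : 1 < p) (hC : 0 < C₂) {x y : EuclideanSpace ℝ (Fin N)}
    {a₁ a₂ f₁ f₂ κ : ℝ} (hk0 : 0 ≤ κ) (hk : κ ≤ C₂ / ‖x - y‖ ^ ((N : ℝ) + p * s)) :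
    ‖flux p a₁ a₂ * κ * (f₁ - f₂)‖ₑ ≤
      ENNReal.ofReal C₂ * (ENNReal.ofReal (|a₁ - a₂| ^ p / ‖x - y‖ ^ ((N : ℝ) + p * s)) ^ ((p - 1) / p) *
        ‖(f₁ - f₂) / ‖x - y‖ ^ (((N : ℝ) + p * s) / p)‖ₑ) := by
  have hp0 : 0 < p := by linarith
  have hp1 : 0 ≤ (p - 1) / p := div_nonneg (by linarith) hp0.le
  rw [ENNReal.ofReal_rpow_of_nonneg (by positivity) hp1, ← ofReal_norm,
    ← ofReal_norm, ← ENNReal.ofReal_mul (by positivity), ← ENNReal.ofReal_mul hC.le]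
  refine ENNReal.ofReal_le_ofReal ?_
  rw [norm_mul, norm_mul, Real.norm_eq_abs (flux _ _ _), abs_flux hp, Real.norm_of_nonneg hk0,
    norm_div, Real.norm_of_nonneg (by positivity : 0 ≤ ‖x - y‖ ^ (((N : ℝ) + p * s) / p))]
  calc |a₁ - a₂| ^ (p - 1) * κ * ‖f₁ - f₂‖
      ≤ |a₁ - a₂| ^ (p - 1) * (C₂ / ‖x - y‖ ^ ((N : ℝ) + p * s)) * ‖f₁ - f₂‖ := by gcongr
    _ = _ := by
      rw [Real.div_rpow (by positivity) (by positivity), ← Real.rpow_mul (abs_nonneg _),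
        mul_div_cancel₀ _ hp0.ne']
      -- The singular weight is divided between the two Hölder factors in the proportion `(p-1)/p`
      -- to `1/p`.
      have h1 : (‖x - y‖ ^ ((N : ℝ) + p * s)) =
          (‖x - y‖ ^ ((N : ℝ) + p * s)) ^ ((p - 1) / p) *
            ‖x - y‖ ^ (((N : ℝ) + p * s) / p) := by
        have h2 : ‖x - y‖ ^ (((N : ℝ) + p * s) / p) = (‖x - y‖ ^ ((N : ℝ) + p * s)) ^ (1 / p) := by
          rw [← Real.rpow_mul (norm_nonneg _), mul_one_div]
        have h3 : (p - 1) / p + 1 / p = 1 := by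
          field_simp
          ring
        rw [h2, ← Real.rpow_add_of_nonneg (by positivity) hp1 (by positivity), h3, Real.rpow_one]
      conv_lhs => rw [h1]
      rw [div_mul_eq_div_div]
      ring

/-- The decay of the kernel away from the diagonal. -/
lemma inv_norm_rpow_far_le (hp : 1 < p) (hs : 0 < s) (hρ : 0 < ρ)
    {x y : EuclideanSpace ℝ (Fin N)} (hx : x ∈ Metric.ball x₀ (2 * ρ))
    (hy : y ∉ Metric.ball x₀ (3 * ρ)) :
    (‖x - y‖ ^ ((N : ℝ) + p * s))⁻¹ ≤
      ((1 + ‖x₀‖) / ρ + 3) ^ ((N : ℝ) + p * s) * (1 + ‖y‖) ^ (-((N : ℝ) + p * s)) := by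
  obtain ⟨h1, h2⟩ := norm_sub_le_three hx hy
  have hd : 0 < ‖x - y‖ := hρ.trans_le h1
  have hD : 0 ≤ (N : ℝ) + p * s := by positivity
  -- From `1 + ‖y‖ ≤ (1 + ‖x₀‖) + 3‖x - y‖` and `‖x - y‖ ≥ ρ`.
  set L := (1 + ‖x₀‖) / ρ + 3 with hL
  have hL0 : 0 < L := by positivity
  have h3 : 1 + ‖y‖ ≤ L * ‖x - y‖ := by
    have h4 : ‖y‖ ≤ ‖y - x₀‖ + ‖x₀‖ := norm_le_norm_sub_add y x₀
    have h5 : 1 + ‖x₀‖ ≤ (1 + ‖x₀‖) / ρ * ‖x - y‖ := by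
      rw [div_mul_eq_mul_div, le_div_iff₀ hρ]
      gcongr
    rw [hL, add_mul]
    linarith
  rw [Real.rpow_neg (by positivity), ← div_eq_mul_inv, ← Real.div_rpow hL0.le (by positivity),
    ← Real.inv_rpow (norm_nonneg _)]
  refine Real.rpow_le_rpow (by positivity) ?_ hD
  rw [inv_eq_one_div, div_le_div_iff₀ hd (by positivity)]
  linarith

/-- The pointwise bound of the energy density, away from the diagonal. -/
lemma abs_flux_mul_kernel_far_le (hp : 1 < p) (hp2 : p < 2) (hs : 0 < s) (hC : 0 < C₂) (hρ : 0 < ρ)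
    {x y : EuclideanSpace ℝ (Fin N)} (hx : x ∈ Metric.ball x₀ (2 * ρ))
    (hy : y ∉ Metric.ball x₀ (3 * ρ)) {a₁ a₂ κ : ℝ} (ha : a₁ ∈ Icc 0 M) (hk0 : 0 ≤ κ)
    (hk : κ ≤ C₂ / ‖x - y‖ ^ ((N : ℝ) + p * s)) :
    |flux p a₁ a₂ * κ| ≤ (C₂ * ((1 + ‖x₀‖) / ρ + 3) ^ ((N : ℝ) + p * s)) *
      (M ^ (p - 1) * (1 + ‖y‖) ^ (-((N : ℝ) + p * s)) +
        |a₂| ^ (p - 1) / (1 + ‖y‖) ^ ((N : ℝ) + p * s)) := by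
  set L := (1 + ‖x₀‖) / ρ + 3 with hL
  have hL0 : 0 < L := by positivity
  have h6 : κ ≤ C₂ * (L ^ ((N : ℝ) + p * s) * (1 + ‖y‖) ^ (-((N : ℝ) + p * s))) := by
    refine hk.trans ?_
    rw [div_eq_mul_inv]
    exact mul_le_mul_of_nonneg_left (inv_norm_rpow_far_le hp hs hρ hx hy) hC.le
  have h7 : |flux p a₁ a₂| ≤ M ^ (p - 1) + |a₂| ^ (p - 1) := by
    refine (abs_flux_le hp hp2 _ _).trans ?_
    rw [abs_of_nonneg ha.1]
    gcongr
    · exact ha.1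
    · exact ha.2
  have hM : 0 ≤ M := ha.1.trans ha.2
  rw [abs_mul, abs_of_nonneg hk0]
  calc |flux p a₁ a₂| * κ ≤ (M ^ (p - 1) + |a₂| ^ (p - 1)) *
        (C₂ * (L ^ ((N : ℝ) + p * s) * (1 + ‖y‖) ^ (-((N : ℝ) + p * s)))) := by gcongr
    _ = _ := by
      rw [Real.rpow_neg (by positivity)]
      ring

/-- The energy form is bounded on functions supported in `B_{2ρ}(x₀)`. -/
lemma Regular.exists_energy_bound (hp : 1 < p) (hp2 : p < 2) (hs : 0 < s) (hC : 0 < C₂)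
    (hρ : 0 < ρ) (h : Regular p s C₂ M x₀ ρ a b w k) :
    ∃ C : ℝ≥0∞, C < ∞ ∧ ∀ f : EuclideanSpace ℝ (Fin N) → ℝ → ℝ, Measurable (Function.uncurry f) →
      (∀ x ∉ Metric.ball x₀ (2 * ρ), ∀ τ, f x τ = 0) →
      ∫⁻ τ in Ioo a b, ∫⁻ z, ‖fluxDensity p w k z τ * (f z.1 τ - f z.2 τ)‖ₑ ≤
        C * (eLpNorm (quot p s x₀ ρ f) (ENNReal.ofReal p) volume +
          eLpNorm (Function.uncurry f) 1 volume) := by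
  have hp0 : 0 < p := by linarith
  have hD : (N : ℝ) < (N : ℝ) + p * s := by
    have : 0 < p * s := by positivity
    linarith
  have h23 : Metric.ball x₀ (2 * ρ) ⊆ Metric.ball x₀ (3 * ρ) :=
    Metric.ball_subset_ball (by linarith)
  set B := Metric.ball x₀ (3 * ρ) with hBdef
  have hB : MeasurableSet B := measurableSet_ball
  -- The Gagliardo density of `w`, integrable over `(a, b)`; near the diagonal it is paired with the
  -- quotient of `f`.
  set α : (EuclideanSpace ℝ (Fin N) × EuclideanSpace ℝ (Fin N)) × ℝ → ℝ≥0∞ := fun v =>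
    (B ×ˢ B).indicator (fun z =>
      ENNReal.ofReal (|w z.1 v.2 - w z.2 v.2| ^ p / ‖z.1 - z.2‖ ^ ((N : ℝ) + p * s))) v.1 with hα
  have hαm : Measurable α := by
    have h1 := measurable_fst_snd h.measurable
    have h2 := measurable_snd_snd h.measurable
    have h3 : Measurable fun v : (EuclideanSpace ℝ (Fin N) × EuclideanSpace ℝ (Fin N)) × ℝ =>
        ENNReal.ofReal (|w v.1.1 v.2 - w v.1.2 v.2| ^ p /
          ‖v.1.1 - v.1.2‖ ^ ((N : ℝ) + p * s)) :=
      (((h1.sub h2).abs.pow_const _).div (by fun_prop)).ennreal_ofReal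
    exact h3.indicator ((hB.prod hB).preimage (measurable_fst (β := ℝ)))
  set A' := C₂ * ((1 + ‖x₀‖) / ρ + 3) ^ ((N : ℝ) + p * s) with hA'
  have hA'0 : 0 ≤ A' := by positivity
  -- A bound for the flux density between a point of `B_{2ρ}` and a distant `y`. Its integral in `y`
  -- is bounded for almost every time: the `M` term by decay of the weight, the other by the tail
  -- condition.
  set β : EuclideanSpace ℝ (Fin N) → ℝ → ℝ≥0∞ := fun y τ =>
    ENNReal.ofReal A' * (ENNReal.ofReal (M ^ (p - 1)) *
      ENNReal.ofReal ((1 + ‖y‖) ^ (-((N : ℝ) + p * s))) +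
      ENNReal.ofReal (|w y τ| ^ (p - 1) / (1 + ‖y‖) ^ ((N : ℝ) + p * s))) with hβ
  obtain ⟨A, hA, htail⟩ := h.tail
  set J := ∫⁻ y : EuclideanSpace ℝ (Fin N), ENNReal.ofReal ((1 + ‖y‖) ^ (-((N : ℝ) + p * s)))
  have hJ : J < ∞ := finite_integral_one_add_norm (by rw [finrank_euclideanSpace_fin]; exact hD)
  set Cb := ENNReal.ofReal A' * (ENNReal.ofReal (M ^ (p - 1)) * J + A) with hCb
  have hCb_lt : Cb < ∞ := ENNReal.mul_lt_top ENNReal.ofReal_lt_top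
    (ENNReal.add_lt_top.2 ⟨ENNReal.mul_lt_top ENNReal.ofReal_lt_top hJ, hA⟩)
  have hβm : ∀ τ, Measurable fun y => β y τ := by
    intro τ
    have h1 : Measurable fun y => w y τ := h.measurable.of_uncurry_right
    exact (((by fun_prop : Measurable fun y : EuclideanSpace ℝ (Fin N) =>
      ENNReal.ofReal (M ^ (p - 1)) * ENNReal.ofReal ((1 + ‖y‖) ^ (-((N : ℝ) + p * s)))).add
      ((h1.abs.pow_const _).div (by fun_prop)).ennreal_ofReal)).const_mul _
  have hβi : ∀ᵐ τ ∂(volume.restrict (Ioo a b)), ∫⁻ y, β y τ ≤ Cb := by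
    filter_upwards [htail] with τ hτ
    rw [lintegral_const_mul' _ _ ENNReal.ofReal_ne_top, lintegral_add_left (by fun_prop),
      lintegral_const_mul' _ _ ENNReal.ofReal_ne_top, hCb]
    gcongr
  have hαi : ∫⁻ v, α v ∂(volume.prod (volume.restrict (Ioo a b))) < ∞ := by
    rw [lintegral_prod_symm _ hαm.aemeasurable]
    refine lt_of_eq_of_lt (lintegral_congr fun τ => ?_) h.sobolev
    exact lintegral_indicator (hB.prod hB) _
  -- The constant from Hölder's inequality with exponents `p/(p-1)` and `p` near the diagonal.
  set Ca := ENNReal.ofReal C₂ *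
    (∫⁻ v, α v ∂(volume.prod (volume.restrict (Ioo a b)))) ^ ((p - 1) / p) with hCa
  have hp1 : 0 ≤ (p - 1) / p := div_nonneg (by linarith) hp0.le
  refine ⟨Ca + 2 * Cb, ENNReal.add_lt_top.2 ⟨ENNReal.mul_lt_top ENNReal.ofReal_lt_top
    (ENNReal.rpow_lt_top_of_nonneg hp1 hαi.ne), ENNReal.mul_lt_top (by simp) hCb_lt⟩, ?_⟩
  intro f hf hf0
  have hfm : ∀ τ, Measurable fun x => f x τ := fun τ => hf.of_uncurry_right
  have hQ := measurable_quot (p := p) (s := s) (x₀ := x₀) (ρ := ρ) hf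
  have hpt : ∀ z τ, ‖fluxDensity p w k z τ * (f z.1 τ - f z.2 τ)‖ₑ ≤
      ENNReal.ofReal C₂ * (α (z, τ) ^ ((p - 1) / p) * ‖quot p s x₀ ρ f (z, τ)‖ₑ) +
        (‖f z.1 τ‖ₑ * β z.2 τ + β z.1 τ * ‖f z.2 τ‖ₑ) := by
    rintro ⟨x, y⟩ τ
    have hfar : ∀ x ∈ B, ∀ y ∉ B, ∀ κ : ℝ, 0 ≤ κ → κ ≤ C₂ / ‖x - y‖ ^ ((N : ℝ) + p * s) →
        ‖flux p (w x τ) (w y τ) * κ * f x τ‖ₑ ≤ ‖f x τ‖ₑ * β y τ := by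
      intro x hx y hy κ hκ0 hκ
      by_cases hx2 : x ∈ Metric.ball x₀ (2 * ρ)
      · have hM : 0 ≤ M := (h.mem_Icc x hx τ).1.trans (h.mem_Icc x hx τ).2
        rw [enorm_mul, mul_comm, hβ]
        gcongr
        simp only
        rw [← ENNReal.ofReal_mul (by positivity), ← ENNReal.ofReal_add (by positivity)
          (by positivity), ← ENNReal.ofReal_mul (by positivity), ← ofReal_norm]
        exact ENNReal.ofReal_le_ofReal (abs_flux_mul_kernel_far_le hp hp2 hs hC hρ hx2 hy
          (h.mem_Icc x hx τ) hκ0 hκ)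
      · rw [hf0 x hx2]
        simp
    by_cases hx : x ∈ B <;> by_cases hy : y ∈ B
    · refine le_add_right ?_
      have hxy : (x, y) ∈ B ×ˢ B := ⟨hx, hy⟩
      simp only [hα, quot, ← hBdef, indicator_of_mem hxy]
      exact enorm_energy_near_le hp hC (h.kernel_nonneg x y τ) (h.kernel_le x y τ)
    · refine le_add_left (le_add_right ?_)
      simp only [fluxDensity, hf0 y (fun h' => hy (h23 h')), sub_zero]
      exact hfar x hx y hy _ (h.kernel_nonneg x y τ) (h.kernel_le x y τ)
    · refine le_add_left (le_add_left ?_)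
      simp only [fluxDensity, hf0 x (fun h' => hx (h23 h')), zero_sub]
      rw [flux_symm, mul_neg, neg_mul, neg_mul, neg_neg, mul_comm (β x τ)]
      refine hfar y hy x hx _ (h.kernel_nonneg x y τ) ?_
      rw [norm_sub_rev]
      exact h.kernel_le x y τ
    · simp only [hf0 x (fun h' => hx (h23 h')), hf0 y (fun h' => hy (h23 h')), sub_zero, mul_zero,
        enorm_zero, zero_le]
  have hnear : ∫⁻ τ in Ioo a b, ∫⁻ z, α (z, τ) ^ ((p - 1) / p) * ‖quot p s x₀ ρ f (z, τ)‖ₑ ≤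
      (∫⁻ v, α v ∂(volume.prod (volume.restrict (Ioo a b)))) ^ ((p - 1) / p) *
        eLpNorm (quot p s x₀ ρ f) (ENNReal.ofReal p) volume := by
    rw [← lintegral_prod_symm (μ := volume) (ν := volume.restrict (Ioo a b))
      (fun v => α v ^ ((p - 1) / p) * ‖quot p s x₀ ρ f v‖ₑ)
      ((hαm.pow_const _).mul hQ.enorm).aemeasurable]
    have h1 := ENNReal.lintegral_mul_norm_pow_le (μ := volume.prod (volume.restrict (Ioo a b)))
      hαm.aemeasurable (hQ.enorm.pow_const p).aemeasurable hp1 (by positivity : 0 ≤ 1 / p)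
      (by field_simp; ring)
    simp only [← ENNReal.rpow_mul, mul_one_div_cancel hp0.ne', ENNReal.rpow_one] at h1
    refine h1.trans ?_
    rw [eLpNorm_eq_lintegral_rpow_enorm_toReal (by simpa using hp0) ENNReal.ofReal_ne_top,
      ENNReal.toReal_ofReal hp0.le]
    gcongr
    rw [Measure.volume_eq_prod]
    exact Measure.prod_mono le_rfl Measure.restrict_le_self
  have hL1 : ∫⁻ τ in Ioo a b, ∫⁻ x, ‖f x τ‖ₑ ≤ eLpNorm (Function.uncurry f) 1 volume := by
    rw [eLpNorm_one_eq_lintegral_enorm, Measure.volume_eq_prod,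
      lintegral_prod_symm _ hf.enorm.aemeasurable]
    exact setLIntegral_le_lintegral _ _
  have hfar : ∫⁻ τ in Ioo a b, ∫⁻ z : EuclideanSpace ℝ (Fin N) × EuclideanSpace ℝ (Fin N),
      (‖f z.1 τ‖ₑ * β z.2 τ + β z.1 τ * ‖f z.2 τ‖ₑ) ≤
        2 * Cb * eLpNorm (Function.uncurry f) 1 volume := by
    calc _ ≤ ∫⁻ τ in Ioo a b, 2 * Cb * ∫⁻ x, ‖f x τ‖ₑ := by
          refine lintegral_mono_ae ?_
          filter_upwards [hβi] with τ hτ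
          have m1 : Measurable fun z : EuclideanSpace ℝ (Fin N) × EuclideanSpace ℝ (Fin N) =>
              ‖f z.1 τ‖ₑ * β z.2 τ :=
            ((hfm τ).enorm.comp measurable_fst).mul ((hβm τ).comp measurable_snd)
          rw [lintegral_add_left m1, Measure.volume_eq_prod,
            lintegral_prod_mul (f := fun x => ‖f x τ‖ₑ) (g := fun y => β y τ)
              (hfm τ).enorm.aemeasurable (hβm τ).aemeasurable,
            lintegral_prod_mul (f := fun x => β x τ) (g := fun y => ‖f y τ‖ₑ)
              (hβm τ).aemeasurable (hfm τ).enorm.aemeasurable,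
            mul_comm (∫⁻ x, ‖f x τ‖ₑ), ← two_mul, mul_assoc]
          gcongr
      _ = 2 * Cb * ∫⁻ τ in Ioo a b, ∫⁻ x, ‖f x τ‖ₑ :=
          lintegral_const_mul' _ _ (ENNReal.mul_lt_top (by simp) hCb_lt).ne
      _ ≤ _ := by gcongr
  calc _ ≤ ∫⁻ τ in Ioo a b, ∫⁻ z,
        (ENNReal.ofReal C₂ * (α (z, τ) ^ ((p - 1) / p) * ‖quot p s x₀ ρ f (z, τ)‖ₑ) +
          (‖f z.1 τ‖ₑ * β z.2 τ + β z.1 τ * ‖f z.2 τ‖ₑ)) :=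
        lintegral_mono fun τ => lintegral_mono fun z => hpt z τ
    _ = ENNReal.ofReal C₂ * (∫⁻ τ in Ioo a b, ∫⁻ z,
          α (z, τ) ^ ((p - 1) / p) * ‖quot p s x₀ ρ f (z, τ)‖ₑ) +
          ∫⁻ τ in Ioo a b, ∫⁻ z : EuclideanSpace ℝ (Fin N) × EuclideanSpace ℝ (Fin N),
            (‖f z.1 τ‖ₑ * β z.2 τ + β z.1 τ * ‖f z.2 τ‖ₑ) := by
        have m0 : Measurable fun v => α v ^ ((p - 1) / p) * ‖quot p s x₀ ρ f v‖ₑ :=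
          (hαm.pow_const _).mul hQ.enorm
        rw [← lintegral_const_mul' _ _ ENNReal.ofReal_ne_top, ← lintegral_add_left]
        · refine lintegral_congr fun τ => ?_
          rw [lintegral_add_left, lintegral_const_mul' _ _ ENNReal.ofReal_ne_top]
          exact (m0.comp measurable_prodMk_right).const_mul _
        · exact m0.lintegral_prod_left'.const_mul _
    _ ≤ Ca * eLpNorm (quot p s x₀ ρ f) (ENNReal.ofReal p) volume +
          2 * Cb * eLpNorm (Function.uncurry f) 1 volume := by
        rw [hCa, mul_assoc]
        gcongr
    _ ≤ _ := by
        rw [mul_add]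
        gcongr
        · exact le_self_add
        · exact le_add_self

end EnergyForm

/-! ### Regularity of the test function -/

/-- The test function `(w + ε)^{r-1} ζ^p`, cut off to times in `(a, b)`. -/
noncomputable def timeTest {N : ℕ} (p r ε : ℝ) (x₀ : EuclideanSpace ℝ (Fin N)) (ρ a b : ℝ)
    (w : EuclideanSpace ℝ (Fin N) → ℝ → ℝ) (x : EuclideanSpace ℝ (Fin N)) (τ : ℝ) : ℝ :=
  (Ioo a b).indicator (fun τ => testFun p r ε x₀ ρ (fun y => w y τ) x) τ

/-- The shift by `ε > 0` keeps the base away from `0`, so even an exponent below `1` has a bounded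
derivative on `[0, M]`. This is the reason for regularizing the test function: `r - 1` may be less
than `1`. -/
lemma exists_rpow_lipschitz {M ε : ℝ} (e : ℝ) (hε : 0 < ε) :
    ∃ L : ℝ, 0 ≤ L ∧ ∀ x ∈ Icc 0 M, ∀ y ∈ Icc 0 M, |(x + ε) ^ e - (y + ε) ^ e| ≤ L * |x - y| := by
  have hd : ∀ x ∈ Icc 0 M, HasDerivWithinAt (fun x : ℝ => (x + ε) ^ e) (e * (x + ε) ^ (e - 1))
      (Icc 0 M) x := by
    intro x hx
    have hx0 : x + ε ≠ 0 := by linarith [hx.1]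
    have := ((hasDerivAt_id x).add_const ε).rpow_const (p := e) (Or.inl hx0)
    simp only [id, one_mul] at this
    exact this.hasDerivWithinAt
  have hcont : ContinuousOn (fun x : ℝ => e * (x + ε) ^ (e - 1)) (Icc 0 M) := by
    refine continuousOn_const.mul (ContinuousOn.rpow_const (by fun_prop) fun x hx => Or.inl ?_)
    linarith [hx.1]
  obtain ⟨L, hL⟩ := isCompact_Icc.exists_bound_of_continuousOn hcont
  refine ⟨max L 0, le_max_right _ _, fun x hx y hy => ?_⟩
  exact (convex_Icc 0 M).norm_image_sub_le_of_norm_hasDerivWithin_le (f := fun x : ℝ => (x + ε) ^ e)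
    hd (fun x hx => (hL x hx).trans (le_max_left _ _)) hy hx

section TimeTest

variable {N : ℕ} {p s C₂ M ρ a b r ε : ℝ} {x₀ : EuclideanSpace ℝ (Fin N)}
  {w : EuclideanSpace ℝ (Fin N) → ℝ → ℝ}
  {k : EuclideanSpace ℝ (Fin N) → EuclideanSpace ℝ (Fin N) → ℝ → ℝ}

lemma measurable_cutoff : Measurable (cutoff x₀ ρ) := continuous_cutoff.measurable

lemma measurable_timeTest (hw : Measurable (Function.uncurry w)) :
    Measurable (Function.uncurry (timeTest p r ε x₀ ρ a b w)) := by
  have h1 : Measurable fun z : EuclideanSpace ℝ (Fin N) × ℝ =>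
      testFun p r ε x₀ ρ (fun y => w y z.2) z.1 :=
    ((hw.add_const ε).pow_const _).mul ((measurable_cutoff.comp measurable_fst).pow_const _)
  exact h1.indicator (measurableSet_Ioo.preimage measurable_snd)

lemma timeTest_eq_zero (hp : 1 < p) (hρ : 0 < ρ) {x : EuclideanSpace ℝ (Fin N)}
    (hx : x ∉ Metric.ball x₀ (2 * ρ)) (τ : ℝ) : timeTest p r ε x₀ ρ a b w x τ = 0 := by
  unfold timeTest
  rw [indicator_apply, testFun_eq_zero hp hρ _ hx, ite_self]

lemma abs_testFun_le (hp : 1 < p) (hr : 1 < r) (hε : 0 < ε) (hρ : 0 < ρ)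
    (hM : 0 ≤ M) {v : EuclideanSpace ℝ (Fin N) → ℝ}
    (hv : ∀ x ∈ Metric.ball x₀ (3 * ρ), v x ∈ Icc 0 M) (x : EuclideanSpace ℝ (Fin N)) :
    |testFun p r ε x₀ ρ v x| ≤ (M + ε) ^ (r - 1) := by
  by_cases hx : x ∈ Metric.ball x₀ (2 * ρ)
  · have h := hv x (Metric.ball_subset_ball (by linarith) hx)
    have h0 : 0 ≤ v x + ε := by linarith [h.1]
    rw [abs_of_nonneg (testFun_nonneg h0)]
    exact (testFun_le hp h0).trans (Real.rpow_le_rpow h0 (by linarith [h.2]) (by linarith))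
  · rw [testFun_eq_zero hp hρ _ hx, abs_zero]
    positivity

lemma abs_timeTest_le (hp : 1 < p) (hr : 1 < r) (hε : 0 < ε) (hρ : 0 < ρ)
    (hM : 0 ≤ M) (hw : ∀ x ∈ Metric.ball x₀ (3 * ρ), ∀ τ, w x τ ∈ Icc 0 M)
    (x : EuclideanSpace ℝ (Fin N)) (τ : ℝ) :
    |timeTest p r ε x₀ ρ a b w x τ| ≤ (M + ε) ^ (r - 1) := by
  unfold timeTest
  by_cases hτ : τ ∈ Ioo a b
  · rw [indicator_of_mem hτ]
    exact abs_testFun_le hp hr hε hρ hM (fun x hx => hw x hx τ) x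
  · rw [indicator_of_notMem hτ, abs_zero]
    positivity

/-- The difference of the test function is controlled by the differences of `v` and of the
points. -/
lemma exists_testFun_sub_le (hp : 1 < p) (hr : 1 < r) (hε : 0 < ε) (hρ : 0 < ρ) (hM : 0 ≤ M) :
    ∃ L : ℝ, 0 ≤ L ∧ ∀ v : EuclideanSpace ℝ (Fin N) → ℝ,
      (∀ x ∈ Metric.ball x₀ (3 * ρ), v x ∈ Icc 0 M) →
      ∀ x ∈ Metric.ball x₀ (3 * ρ), ∀ y ∈ Metric.ball x₀ (3 * ρ),
        |testFun p r ε x₀ ρ v x - testFun p r ε x₀ ρ v y| ≤ L * (|v x - v y| + ‖x - y‖) := by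
  obtain ⟨L, hL0, hL⟩ := exists_rpow_lipschitz (M := M) (r - 1) hε
  set G := (M + ε) ^ (r - 1)
  have hG : 0 ≤ G := by positivity
  refine ⟨max L (G * (p / ρ)), le_max_of_le_left hL0, fun v hv x hx y hy => ?_⟩
  have hζ : |cutoff x₀ ρ x ^ p - cutoff x₀ ρ y ^ p| ≤ p / ρ * ‖x - y‖ := by
    have aux : ∀ z z' : ℝ, 0 ≤ z' → z' ≤ z → z ≤ 1 → |z ^ p - z' ^ p| ≤ p * |z - z'| := by
      intro z z' h1 h2 h3
      rw [abs_of_nonneg (sub_nonneg.2 (Real.rpow_le_rpow h1 h2 (by linarith))),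
        abs_of_nonneg (by linarith)]
      refine (rpow_sub_rpow_le hp.le h1 h2).trans ?_
      have : z ^ (p - 1) ≤ 1 := Real.rpow_le_one (h1.trans h2) h3 (by linarith)
      have h4 : 0 ≤ z - z' := by linarith
      have := mul_le_mul_of_nonneg_left this (by positivity : 0 ≤ p * (z - z'))
      linarith
    have h1 : |cutoff x₀ ρ x ^ p - cutoff x₀ ρ y ^ p| ≤ p * |cutoff x₀ ρ x - cutoff x₀ ρ y| := by
      rcases le_total (cutoff x₀ ρ y) (cutoff x₀ ρ x) with h | h
      · exact aux _ _ (cutoff_nonneg _) h (cutoff_le_one _)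
      · rw [abs_sub_comm, abs_sub_comm (cutoff x₀ ρ x)]
        exact aux _ _ (cutoff_nonneg _) h (cutoff_le_one _)
    refine h1.trans ((mul_le_mul_of_nonneg_left (abs_cutoff_sub_le hρ x y)
      (by linarith)).trans_eq ?_)
    ring
  have hζ1 : cutoff x₀ ρ x ^ p ≤ 1 :=
    Real.rpow_le_one (cutoff_nonneg _) (cutoff_le_one _) (by linarith)
  have hζ0 : 0 ≤ cutoff x₀ ρ x ^ p := Real.rpow_nonneg (cutoff_nonneg _) _
  have hvy := hv y hy
  have hy0 : 0 ≤ v y + ε := by linarith [hvy.1]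
  have hyG : (v y + ε) ^ (r - 1) ≤ G :=
    Real.rpow_le_rpow hy0 (by linarith [hvy.2]) (by linarith)
  have hy1 : 0 ≤ (v y + ε) ^ (r - 1) := Real.rpow_nonneg hy0 _
  have hsplit : testFun p r ε x₀ ρ v x - testFun p r ε x₀ ρ v y =
      ((v x + ε) ^ (r - 1) - (v y + ε) ^ (r - 1)) * cutoff x₀ ρ x ^ p +
        (v y + ε) ^ (r - 1) * (cutoff x₀ ρ x ^ p - cutoff x₀ ρ y ^ p) := by
    unfold testFun
    ring
  rw [hsplit]
  refine (abs_add_le _ _).trans ?_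
  rw [abs_mul, abs_mul, abs_of_nonneg hζ0, abs_of_nonneg hy1, mul_add]
  refine add_le_add ?_ ?_
  · calc _ ≤ |(v x + ε) ^ (r - 1) - (v y + ε) ^ (r - 1)| :=
          mul_le_of_le_one_right (abs_nonneg _) hζ1
      _ ≤ L * |v x - v y| := hL _ (hv x hx) _ hvy
      _ ≤ _ := by gcongr; exact le_max_left _ _
  · calc _ ≤ G * (p / ρ * ‖x - y‖) := by gcongr
      _ = G * (p / ρ) * ‖x - y‖ := by ring
      _ ≤ _ := by gcongr; exact le_max_right _ _

/-- Local finiteness of the Gagliardo seminorm of the test function. -/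
lemma exists_testFun_seminorm_le (hN : 1 ≤ N) (hp : 1 < p) (hs1 : s < 1) (hr : 1 < r)
    (hε : 0 < ε) (hρ : 0 < ρ) (hM : 0 ≤ M) :
    ∃ L : ℝ≥0∞, L < ∞ ∧ ∀ v : EuclideanSpace ℝ (Fin N) → ℝ,
      Measurable v → (∀ x ∈ Metric.ball x₀ (3 * ρ), v x ∈ Icc 0 M) →
      ∫⁻ z in Metric.ball x₀ (3 * ρ) ×ˢ Metric.ball x₀ (3 * ρ),
        ENNReal.ofReal (|testFun p r ε x₀ ρ v z.1 - testFun p r ε x₀ ρ v z.2| ^ p /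
          ‖z.1 - z.2‖ ^ ((N : ℝ) + p * s)) ≤
      L * ((∫⁻ z in Metric.ball x₀ (3 * ρ) ×ˢ Metric.ball x₀ (3 * ρ),
        ENNReal.ofReal (|v z.1 - v z.2| ^ p / ‖z.1 - z.2‖ ^ ((N : ℝ) + p * s))) + 1) := by
  have hp0 : 0 < p := by linarith
  have hβ : 0 < p - p * s := by nlinarith
  obtain ⟨L, hL0, hL⟩ := exists_testFun_sub_le (x₀ := x₀) (ρ := ρ) hp hr hε hρ hM
  obtain ⟨c₁, hc₁, h₁⟩ := exists_lintegral_ball_rpow_le hN hβ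
  set B := Metric.ball x₀ (3 * ρ)
  have hB : MeasurableSet B := measurableSet_ball
  set J := ∫⁻ z in B ×ˢ B, ENNReal.ofReal (‖z.1 - z.2‖ ^ (p - p * s - N))
  have hJ : J < ∞ := by
    have h2 := lintegral_near_le (x₀ := x₀) hρ hc₁ h₁ (V := fun _ => 1) measurable_const
    refine lt_of_le_of_lt ?_ (h2.trans_lt ?_)
    · refine lintegral_mono fun z => ?_
      refine le_mul_of_one_le_left' ?_
      norm_num
    · rw [setLIntegral_one]
      exact ENNReal.mul_lt_top ENNReal.ofReal_lt_top measure_ball_lt_top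
  refine ⟨ENNReal.ofReal (L ^ p * 2 ^ p) * (J + 1), ENNReal.mul_lt_top ENNReal.ofReal_lt_top
    (ENNReal.add_lt_top.2 ⟨hJ, by simp⟩), fun v hvm hv => ?_⟩
  have hpt : ∀ z ∈ B ×ˢ B,
      ENNReal.ofReal (|testFun p r ε x₀ ρ v z.1 - testFun p r ε x₀ ρ v z.2| ^ p /
          ‖z.1 - z.2‖ ^ ((N : ℝ) + p * s)) ≤ ENNReal.ofReal (L ^ p * 2 ^ p) *
        (ENNReal.ofReal (|v z.1 - v z.2| ^ p / ‖z.1 - z.2‖ ^ ((N : ℝ) + p * s)) +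
          ENNReal.ofReal (‖z.1 - z.2‖ ^ (p - p * s - N))) := by
    rintro ⟨x, y⟩ ⟨hx, hy⟩
    rw [← ENNReal.ofReal_add (by positivity) (by positivity), ← ENNReal.ofReal_mul (by positivity)]
    refine ENNReal.ofReal_le_ofReal ?_
    simp only
    rcases eq_or_ne x y with rfl | hxy
    · rw [sub_self, abs_zero, Real.zero_rpow hp0.ne', zero_div]
      positivity
    have hd : 0 < ‖x - y‖ := norm_pos_iff.2 (sub_ne_zero.2 hxy)
    have h3 : |testFun p r ε x₀ ρ v x - testFun p r ε x₀ ρ v y| ^ p ≤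
        L ^ p * (2 ^ p * (|v x - v y| ^ p + ‖x - y‖ ^ p)) := by
      refine (Real.rpow_le_rpow (abs_nonneg _) (hL v hv x hx y hy) hp0.le).trans ?_
      rw [Real.mul_rpow hL0 (by positivity)]
      gcongr
      exact add_rpow_le_two_rpow_mul (abs_nonneg _) (norm_nonneg _) hp0
    have h4 : ‖x - y‖ ^ (p - p * s - N) = ‖x - y‖ ^ p / ‖x - y‖ ^ ((N : ℝ) + p * s) := by
      rw [← Real.rpow_sub hd]
      congr 1
      ring
    rw [h4, ← add_div, ← mul_div_assoc]
    gcongr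
    linarith
  refine (setLIntegral_mono' (hB.prod hB) hpt).trans ?_
  rw [lintegral_const_mul' _ _ ENNReal.ofReal_ne_top, lintegral_add_right _ (by fun_prop), mul_assoc]
  gcongr
  change _ + J ≤ _
  rw [mul_add, mul_one, add_mul, one_mul]
  calc _ ≤ _ + (J + 1) := add_le_add le_rfl le_self_add
    _ ≤ _ := by
      gcongr
      exact le_add_self

end TimeTest

/-! ### The test function in the energy space. -/

section TimeTest

variable {N : ℕ} {p s C₂ M ρ a b r ε : ℝ} {x₀ : EuclideanSpace ℝ (Fin N)}
  {w : EuclideanSpace ℝ (Fin N) → ℝ → ℝ}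
  {k : EuclideanSpace ℝ (Fin N) → EuclideanSpace ℝ (Fin N) → ℝ → ℝ}

lemma enorm_quot_rpow (hp : 1 < p) (f : EuclideanSpace ℝ (Fin N) → ℝ → ℝ)
    (z : EuclideanSpace ℝ (Fin N) × EuclideanSpace ℝ (Fin N)) (τ : ℝ) :
    ‖quot p s x₀ ρ f (z, τ)‖ₑ ^ p =
      (Metric.ball x₀ (3 * ρ) ×ˢ Metric.ball x₀ (3 * ρ)).indicator (fun z =>
        ENNReal.ofReal (|f z.1 τ - f z.2 τ| ^ p / ‖z.1 - z.2‖ ^ ((N : ℝ) + p * s))) z := by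
  have hp0 : 0 < p := by linarith
  unfold quot
  by_cases hz : z ∈ Metric.ball x₀ (3 * ρ) ×ˢ Metric.ball x₀ (3 * ρ)
  · rw [indicator_of_mem hz, indicator_of_mem hz, ← ofReal_norm,
      ENNReal.ofReal_rpow_of_nonneg (norm_nonneg _) hp0.le, norm_div,
      Real.div_rpow (norm_nonneg _) (norm_nonneg _), Real.norm_eq_abs,
      Real.norm_of_nonneg (by positivity : 0 ≤ ‖z.1 - z.2‖ ^ (((N : ℝ) + p * s) / p)),
      ← Real.rpow_mul (norm_nonneg _), div_mul_cancel₀ _ hp0.ne']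
  · rw [indicator_of_notMem hz, indicator_of_notMem hz, enorm_zero, ENNReal.zero_rpow_of_pos hp0]

/-- The Lipschitz bounds transfer the seminorm of `w` on `(a, b)` to the test function. Extending
the latter by zero in time makes its quotient an `L^p` function on all of space-time, to which
continuity of translations applies. -/
lemma Regular.memLp_quot_timeTest (hN : 1 ≤ N) (hp : 1 < p) (hs1 : s < 1) (hr : 1 < r)
    (hε : 0 < ε) (hρ : 0 < ρ) (hM : 0 ≤ M) (h : Regular p s C₂ M x₀ ρ a b w k) :
    MemLp (quot p s x₀ ρ (timeTest p r ε x₀ ρ a b w)) (ENNReal.ofReal p) volume := by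
  have hp0 : 0 < p := by linarith
  obtain ⟨L, hL, hL'⟩ := exists_testFun_seminorm_le (x₀ := x₀) (M := M) hN hp hs1 hr hε hρ hM
  have hB : MeasurableSet (Metric.ball x₀ (3 * ρ)) := measurableSet_ball
  have hm := measurable_quot (p := p) (s := s) (x₀ := x₀) (ρ := ρ)
    (measurable_timeTest (p := p) (r := r) (ε := ε) (x₀ := x₀) (ρ := ρ) (a := a) (b := b)
      h.measurable)
  refine ⟨hm.aestronglyMeasurable, ?_⟩
  rw [eLpNorm_lt_top_iff_lintegral_rpow_enorm_lt_top (by simpa using hp0) ENNReal.ofReal_ne_top,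
    ENNReal.toReal_ofReal hp0.le, Measure.volume_eq_prod,
    lintegral_prod_symm _ (hm.enorm.pow_const p).aemeasurable]
  simp only [enorm_quot_rpow hp, lintegral_indicator (hB.prod hB)]
  calc _ ≤ ∫⁻ τ, (Ioo a b).indicator (fun τ => L *
        ((∫⁻ z in Metric.ball x₀ (3 * ρ) ×ˢ Metric.ball x₀ (3 * ρ),
          ENNReal.ofReal (|w z.1 τ - w z.2 τ| ^ p / ‖z.1 - z.2‖ ^ ((N : ℝ) + p * s))) + 1)) τ := by
        refine lintegral_mono fun τ => ?_
        by_cases hτ : τ ∈ Ioo a b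
        · simp only [timeTest, indicator_of_mem hτ]
          exact hL' _ h.measurable.of_uncurry_right fun x hx => h.mem_Icc x hx τ
        · simp [timeTest, indicator_of_notMem hτ, Real.zero_rpow hp0.ne']
    _ = L * ((∫⁻ τ in Ioo a b, ∫⁻ z in Metric.ball x₀ (3 * ρ) ×ˢ Metric.ball x₀ (3 * ρ),
          ENNReal.ofReal (|w z.1 τ - w z.2 τ| ^ p / ‖z.1 - z.2‖ ^ ((N : ℝ) + p * s))) +
          volume (Ioo a b)) := by
        rw [lintegral_indicator measurableSet_Ioo, lintegral_const_mul' _ _ hL.ne,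
          lintegral_add_right _ measurable_const, setLIntegral_one]
    _ < ∞ := ENNReal.mul_lt_top hL (ENNReal.add_lt_top.2 ⟨h.sobolev, by simp⟩)

lemma Regular.memLp_timeTest (hp : 1 < p) (hr : 1 < r)
    (hε : 0 < ε) (hρ : 0 < ρ) (hM : 0 ≤ M) (h : Regular p s C₂ M x₀ ρ a b w k) :
    MemLp (Function.uncurry (timeTest p r ε x₀ ρ a b w)) 1 volume := by
  refine ⟨(measurable_timeTest h.measurable).aestronglyMeasurable, ?_⟩
  rw [eLpNorm_one_eq_lintegral_enorm]
  have hS : MeasurableSet (Metric.ball x₀ (2 * ρ) ×ˢ Ioo a b) :=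
    measurableSet_ball.prod measurableSet_Ioo
  calc _ ≤ ∫⁻ v : EuclideanSpace ℝ (Fin N) × ℝ, (Metric.ball x₀ (2 * ρ) ×ˢ Ioo a b).indicator
        (fun _ => ENNReal.ofReal ((M + ε) ^ (r - 1))) v := by
        refine lintegral_mono fun v => ?_
        by_cases hv : v ∈ Metric.ball x₀ (2 * ρ) ×ˢ Ioo a b
        · rw [indicator_of_mem hv, ← ofReal_norm]
          exact ENNReal.ofReal_le_ofReal (abs_timeTest_le hp hr hε hρ hM h.mem_Icc _ _)
        · rw [indicator_of_notMem hv]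
          have : timeTest p r ε x₀ ρ a b w v.1 v.2 = 0 := by
            by_cases hx : v.1 ∈ Metric.ball x₀ (2 * ρ)
            · exact indicator_of_notMem (fun hτ => hv ⟨hx, hτ⟩) _
            · exact timeTest_eq_zero hp hρ hx _
          simp [Function.uncurry, this]
    _ < ∞ := by
        rw [lintegral_indicator hS, setLIntegral_const]
        refine ENNReal.mul_lt_top ENNReal.ofReal_lt_top ?_
        rw [Measure.volume_eq_prod, Measure.prod_prod]
        exact ENNReal.mul_lt_top measure_ball_lt_top (by simp)

/-- A bounded function supported in `B_{2ρ}(x₀)` with finite Gagliardo seminorm in `B_{3ρ}(x₀)`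
belongs to `W^{s,p}(ℝ^N)`. -/
lemma sobolevEnergy_univ_lt_top (hp : 1 < p) (hs : 0 < s) (hρ : 0 < ρ) {G : ℝ}
    {f : EuclideanSpace ℝ (Fin N) → ℝ} (hG : ∀ x, |f x| ≤ G)
    (hf0 : ∀ x ∉ Metric.ball x₀ (2 * ρ), f x = 0)
    (hf : ∫⁻ z in Metric.ball x₀ (3 * ρ) ×ˢ Metric.ball x₀ (3 * ρ),
        ENNReal.ofReal (|f z.1 - f z.2| ^ p / ‖z.1 - z.2‖ ^ ((N : ℝ) + p * s)) < ∞) :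
    sobolevEnergy p s univ f < ∞ := by
  have hp0 : 0 < p := by linarith
  have hG0 : 0 ≤ G := (abs_nonneg _).trans (hG x₀)
  have h23 : Metric.ball x₀ (2 * ρ) ⊆ Metric.ball x₀ (3 * ρ) :=
    Metric.ball_subset_ball (by linarith)
  set B := Metric.ball x₀ (3 * ρ)
  set B' := Metric.ball x₀ (2 * ρ)
  have hB : MeasurableSet B := measurableSet_ball
  have hB' : MeasurableSet B' := measurableSet_ball
  have hD : (N : ℝ) < (N : ℝ) + p * s := by
    have : 0 < p * s := by positivity
    linarith
  set Lc := ((1 + ‖x₀‖) / ρ + 3) ^ ((N : ℝ) + p * s)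
  have hLc : 0 ≤ Lc := by positivity
  set φ : EuclideanSpace ℝ (Fin N) → ℝ≥0∞ := B'.indicator fun _ => ENNReal.ofReal (G ^ p)
  set ψ : EuclideanSpace ℝ (Fin N) → ℝ≥0∞ := fun y =>
    ENNReal.ofReal Lc * ENNReal.ofReal ((1 + ‖y‖) ^ (-((N : ℝ) + p * s)))
  have hφm : Measurable φ := measurable_const.indicator hB'
  have hψm : Measurable ψ := by fun_prop
  have hφ : ∫⁻ x, φ x < ∞ := by
    rw [lintegral_indicator hB', setLIntegral_const]
    exact ENNReal.mul_lt_top ENNReal.ofReal_lt_top measure_ball_lt_top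
  have hψ : ∫⁻ x, ψ x < ∞ := by
    rw [lintegral_const_mul' _ _ ENNReal.ofReal_ne_top]
    exact ENNReal.mul_lt_top ENNReal.ofReal_lt_top
      (finite_integral_one_add_norm (by rw [finrank_euclideanSpace_fin]; exact hD))
  unfold sobolevEnergy
  rw [setLIntegral_univ, univ_prod_univ, setLIntegral_univ]
  refine ENNReal.add_lt_top.2 ⟨lt_of_le_of_lt (lintegral_mono fun x => ?_) hφ, ?_⟩
  · by_cases hx : x ∈ B'
    · simp only [φ, indicator_of_mem hx]
      exact ENNReal.ofReal_le_ofReal (Real.rpow_le_rpow (abs_nonneg _) (hG x) hp0.le)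
    · simp [hf0 x hx, Real.zero_rpow hp0.ne']
  have hfar : ∀ x ∈ B, ∀ y ∉ B,
      ENNReal.ofReal (|f x| ^ p / ‖x - y‖ ^ ((N : ℝ) + p * s)) ≤ φ x * ψ y := by
    intro x _ y hy
    by_cases hx' : x ∈ B'
    · simp only [φ, ψ, indicator_of_mem hx']
      rw [← ENNReal.ofReal_mul hLc, ← ENNReal.ofReal_mul (by positivity), div_eq_mul_inv]
      refine ENNReal.ofReal_le_ofReal ?_
      exact mul_le_mul (Real.rpow_le_rpow (abs_nonneg _) (hG x) hp0.le)
        (inv_norm_rpow_far_le hp hs hρ hx' hy) (by positivity) (by positivity)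
    · simp [hf0 x hx', Real.zero_rpow hp0.ne']
  have hpt : ∀ z : EuclideanSpace ℝ (Fin N) × EuclideanSpace ℝ (Fin N),
      ENNReal.ofReal (|f z.1 - f z.2| ^ p / ‖z.1 - z.2‖ ^ ((N : ℝ) + p * s)) ≤
        (B ×ˢ B).indicator (fun z =>
          ENNReal.ofReal (|f z.1 - f z.2| ^ p / ‖z.1 - z.2‖ ^ ((N : ℝ) + p * s))) z +
          (φ z.1 * ψ z.2 + ψ z.1 * φ z.2) := by
    rintro ⟨x, y⟩
    by_cases hx : x ∈ B <;> by_cases hy : y ∈ B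
    · rw [indicator_of_mem (show (x, y) ∈ B ×ˢ B from ⟨hx, hy⟩)]
      exact le_self_add
    · refine le_add_left (le_add_right ?_)
      simp only [hf0 y fun h => hy (h23 h), sub_zero]
      exact hfar x hx y hy
    · refine le_add_left (le_add_left ?_)
      simp only [hf0 x fun h => hx (h23 h), zero_sub, abs_neg]
      rw [norm_sub_rev, mul_comm (ψ x)]
      exact hfar y hy x hx
    · simp [hf0 x fun h => hx (h23 h), hf0 y fun h => hy (h23 h), Real.zero_rpow hp0.ne']
  refine (lintegral_mono hpt).trans_lt ?_
  have m1 : Measurable fun z : EuclideanSpace ℝ (Fin N) × EuclideanSpace ℝ (Fin N) =>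
      φ z.1 * ψ z.2 := by fun_prop
  have m2 : Measurable fun z : EuclideanSpace ℝ (Fin N) × EuclideanSpace ℝ (Fin N) =>
      ψ z.1 * φ z.2 := by fun_prop
  rw [lintegral_add_right _ (m1.fun_add m2), lintegral_add_right _ m2,
    lintegral_indicator (hB.prod hB), Measure.volume_eq_prod,
    lintegral_prod_mul hφm.aemeasurable hψm.aemeasurable,
    lintegral_prod_mul hψm.aemeasurable hφm.aemeasurable]
  exact ENNReal.add_lt_top.2 ⟨hf, ENNReal.add_lt_top.2
    ⟨ENNReal.mul_lt_top hφ hψ, ENNReal.mul_lt_top hψ hφ⟩⟩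

/-- At almost every time the test function belongs to `W^{s,p}(ℝ^N)`. -/
lemma Regular.ae_sobolevEnergy_timeTest (hN : 1 ≤ N) (hp : 1 < p) (hs : 0 < s) (hs1 : s < 1)
    (hr : 1 < r) (hε : 0 < ε) (hρ : 0 < ρ) (hM : 0 ≤ M) (h : Regular p s C₂ M x₀ ρ a b w k) :
    ∀ᵐ τ, sobolevEnergy p s univ (fun x => timeTest p r ε x₀ ρ a b w x τ) < ∞ := by
  have hp0 : 0 < p := by linarith
  have hB : MeasurableSet (Metric.ball x₀ (3 * ρ)) := measurableSet_ball
  have hmem := h.memLp_quot_timeTest hN hp hs1 hr hε hρ hM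
  have hm := measurable_quot (p := p) (s := s) (x₀ := x₀) (ρ := ρ)
    (measurable_timeTest (p := p) (r := r) (ε := ε) (x₀ := x₀) (ρ := ρ) (a := a) (b := b)
      h.measurable)
  have h1 := hmem.2
  rw [eLpNorm_lt_top_iff_lintegral_rpow_enorm_lt_top (by simpa using hp0) ENNReal.ofReal_ne_top,
    ENNReal.toReal_ofReal hp0.le, Measure.volume_eq_prod,
    lintegral_prod_symm _ (hm.enorm.pow_const p).aemeasurable] at h1
  filter_upwards [ae_lt_top (hm.enorm.pow_const p).lintegral_prod_left' h1.ne] with τ hτ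
  simp only [enorm_quot_rpow hp, lintegral_indicator (hB.prod hB)] at hτ
  exact sobolevEnergy_univ_lt_top hp hs hρ (fun x => abs_timeTest_le hp hr hε hρ hM h.mem_Icc x τ)
    (fun x hx => timeTest_eq_zero hp hρ hx τ) hτ

end TimeTest

/-! ### The energy form along time translates of the test function -/

/-- The energy form `∬ |w(x) - w(y)|^{p-2} (w(x) - w(y)) (f(x) - f(y)) k(x, y)` at time `τ`. -/
noncomputable def energy {N : ℕ} (p : ℝ) (w : EuclideanSpace ℝ (Fin N) → ℝ → ℝ)
    (k : EuclideanSpace ℝ (Fin N) → EuclideanSpace ℝ (Fin N) → ℝ → ℝ)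
    (f : EuclideanSpace ℝ (Fin N) → ℝ) (τ : ℝ) : ℝ :=
  ∫ z : EuclideanSpace ℝ (Fin N) × EuclideanSpace ℝ (Fin N),
    fluxDensity p w k z τ * (f z.1 - f z.2)

section Energy

variable {N : ℕ} {p s C₂ M ρ a b r ε : ℝ} {x₀ : EuclideanSpace ℝ (Fin N)}
  {w : EuclideanSpace ℝ (Fin N) → ℝ → ℝ}
  {k : EuclideanSpace ℝ (Fin N) → EuclideanSpace ℝ (Fin N) → ℝ → ℝ}
  {f : EuclideanSpace ℝ (Fin N) → ℝ → ℝ}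

lemma Regular.measurable_energyDensity (h : Regular p s C₂ M x₀ ρ a b w k)
    (hf : Measurable (Function.uncurry f)) :
    Measurable fun v : (EuclideanSpace ℝ (Fin N) × EuclideanSpace ℝ (Fin N)) × ℝ =>
      fluxDensity p w k v.1 v.2 * (f v.1.1 v.2 - f v.1.2 v.2) :=
  h.measurable_fluxDensity.mul ((measurable_fst_snd hf).sub (measurable_snd_snd hf))

lemma Regular.ae_integrable_energyDensity (h : Regular p s C₂ M x₀ ρ a b w k)
    (hf : Measurable (Function.uncurry f))
    (hfin : ∫⁻ τ in Ioo a b, ∫⁻ z, ‖fluxDensity p w k z τ * (f z.1 τ - f z.2 τ)‖ₑ < ∞) :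
    ∀ᵐ τ ∂(volume.restrict (Ioo a b)),
      Integrable fun z => fluxDensity p w k z τ * (f z.1 τ - f z.2 τ) := by
  have hm := h.measurable_energyDensity hf
  filter_upwards [ae_lt_top hm.enorm.lintegral_prod_left' hfin.ne] with τ hτ
  exact ⟨(hm.comp measurable_prodMk_right).aestronglyMeasurable, hτ⟩

lemma Regular.measurable_energy (h : Regular p s C₂ M x₀ ρ a b w k)
    (hf : Measurable (Function.uncurry f)) :
    Measurable fun τ => energy p w k (fun x => f x τ) τ :=
  (h.measurable_energyDensity hf).stronglyMeasurable.integral_prod_left'.measurable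

lemma Regular.integrableOn_energy (h : Regular p s C₂ M x₀ ρ a b w k)
    (hf : Measurable (Function.uncurry f))
    (hfin : ∫⁻ τ in Ioo a b, ∫⁻ z, ‖fluxDensity p w k z τ * (f z.1 τ - f z.2 τ)‖ₑ < ∞) :
    IntegrableOn (fun τ => energy p w k (fun x => f x τ) τ) (Ioo a b) :=
  ⟨(h.measurable_energy hf).aestronglyMeasurable,
    (lintegral_mono fun _ => enorm_integral_le_lintegral_enorm _).trans_lt hfin⟩

/-- A lower bound for the time integral of the energy form with translated test function. -/
lemma Regular.neg_integral_energy_le (h : Regular p s C₂ M x₀ ρ a b w k)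
    {g : EuclideanSpace ℝ (Fin N) → ℝ → ℝ} {R η t₁ t₂ : ℝ}
    (hf : Measurable (Function.uncurry f)) (hg : Measurable (Function.uncurry g))
    (hgfin : ∫⁻ τ in Ioo a b, ∫⁻ z, ‖fluxDensity p w k z τ * (g z.1 τ - g z.2 τ)‖ₑ < ∞)
    (hη : 0 ≤ η)
    (hsub : ∫⁻ τ in Ioo a b, ∫⁻ z, ‖fluxDensity p w k z τ *
      ((f z.1 τ - g z.1 τ) - (f z.2 τ - g z.2 τ))‖ₑ ≤ ENNReal.ofReal η)
    (hR : ∀ᵐ τ ∂(volume.restrict (Ioo a b)), -energy p w k (fun x => g x τ) τ ≤ R)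
    (h₁ : a ≤ t₁) (h₁₂ : t₁ ≤ t₂) (h₂ : t₂ < b) :
    -∫ τ in t₁..t₂, energy p w k (fun x => f x τ) τ ≤ (t₂ - t₁) * R + η := by
  have hd : Measurable (Function.uncurry fun x τ => f x τ - g x τ) := hf.sub hg
  have hdfin := hsub.trans_lt ENNReal.ofReal_lt_top
  have hI : Ioc t₁ t₂ ⊆ Ioo a b := fun τ hτ => ⟨h₁.trans_lt hτ.1, hτ.2.trans_lt h₂⟩
  have hle : volume.restrict (Ioc t₁ t₂) ≤ volume.restrict (Ioo a b) := Measure.restrict_mono_set _ hI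
  have hgi : IntegrableOn (fun τ => energy p w k (fun x => g x τ) τ) (Ioc t₁ t₂) :=
    (h.integrableOn_energy hg hgfin).mono_set hI
  have hdi : IntegrableOn (fun τ => energy p w k (fun x => f x τ - g x τ) τ) (Ioc t₁ t₂) :=
    (h.integrableOn_energy hd hdfin).mono_set hI
  -- Write `f = g + (f - g)`: the `g` part is bounded below through `R`, the remainder is the error
  -- `η`.
  have hsplit : ∀ᵐ τ ∂(volume.restrict (Ioc t₁ t₂)), energy p w k (fun x => f x τ) τ =
      energy p w k (fun x => g x τ) τ + energy p w k (fun x => f x τ - g x τ) τ := by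
    filter_upwards [ae_mono hle (h.ae_integrable_energyDensity hg hgfin),
      ae_mono hle (h.ae_integrable_energyDensity hd hdfin)] with τ i1 i2
    unfold energy
    rw [← integral_add i1 i2]
    refine integral_congr_ae (Eventually.of_forall fun z => ?_)
    simp only
    ring
  rw [intervalIntegral.integral_of_le h₁₂, integral_congr_ae hsplit, integral_add hgi hdi, neg_add]
  refine add_le_add ?_ ?_
  · rw [← integral_neg]
    calc _ ≤ ∫ τ in Ioc t₁ t₂, R := by
          refine integral_mono_ae hgi.neg (integrable_const R) ?_
          exact ae_mono hle hR
      _ = (t₂ - t₁) * R := by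
          rw [setIntegral_const, smul_eq_mul, Real.volume_real_Ioc_of_le h₁₂]
  · refine (neg_le_abs _).trans ?_
    have h3 : ‖∫ τ in Ioc t₁ t₂, energy p w k (fun x => f x τ - g x τ) τ‖ₑ ≤ ENNReal.ofReal η := by
      refine (enorm_integral_le_lintegral_enorm _).trans (le_trans ?_ hsub)
      refine (lintegral_mono_set hI).trans (lintegral_mono fun τ => ?_)
      exact enorm_integral_le_lintegral_enorm _
    rw [← ofReal_norm, ENNReal.ofReal_le_ofReal_iff hη] at h3
    exact h3

/-- The energy form tested with `(w + ε)^{r-1} ζ^p` is bounded below. -/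
lemma neg_energy_le_of_lintegral {g : EuclideanSpace ℝ (Fin N) → ℝ} {R τ : ℝ} (hR : 0 ≤ R)
    (hR' : ∫⁻ z : EuclideanSpace ℝ (Fin N) × EuclideanSpace ℝ (Fin N),
      ENNReal.ofReal (-(fluxDensity p w k z τ * (g z.1 - g z.2))) ≤ ENNReal.ofReal R) :
    -energy p w k g τ ≤ R := by
  unfold energy
  by_cases hi : Integrable fun z : EuclideanSpace ℝ (Fin N) × EuclideanSpace ℝ (Fin N) =>
      fluxDensity p w k z τ * (g z.1 - g z.2)
  · rw [integral_eq_lintegral_pos_part_sub_lintegral_neg_part hi]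
    have h1 := ENNReal.toReal_mono ENNReal.ofReal_ne_top hR'
    rw [ENNReal.toReal_ofReal hR] at h1
    have := ENNReal.toReal_nonneg (a := ∫⁻ z : EuclideanSpace ℝ (Fin N) × EuclideanSpace ℝ (Fin N),
      ENNReal.ofReal (fluxDensity p w k z τ * (g z.1 - g z.2)))
    linarith
  -- A non-integrable density has integral `0` by convention, and `0 ≤ R`.
  · rw [integral_undef hi, neg_zero]
    exact hR

end Energy

/-! ### The energy inequality in integrated form -/

/-- The weighted mass `∫ (v + ε)^r / r ζ^p`. -/
noncomputable def mass {N : ℕ} (p r ε : ℝ) (x₀ : EuclideanSpace ℝ (Fin N)) (ρ : ℝ)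
    (v : EuclideanSpace ℝ (Fin N) → ℝ) : ℝ :=
  ∫ x, (v x + ε) ^ r / r * cutoff x₀ ρ x ^ p

section Core

variable {N : ℕ} {p s C₂ M ρ a b r ε : ℝ} {x₀ : EuclideanSpace ℝ (Fin N)}
  {w : EuclideanSpace ℝ (Fin N) → ℝ → ℝ}
  {k : EuclideanSpace ℝ (Fin N) → EuclideanSpace ℝ (Fin N) → ℝ → ℝ}

lemma integrable_of_bounded_of_support {f : EuclideanSpace ℝ (Fin N) → ℝ} (hf : AEMeasurable f)
    {G R : ℝ} (hG : ∀ᵐ x, |f x| ≤ G) (hf0 : ∀ x ∉ Metric.ball x₀ R, f x = 0) :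
    Integrable f := by
  rw [← integrableOn_iff_integrable_of_support_subset (s := Metric.ball x₀ R)
    (fun x hx => by_contra fun h => hx (hf0 x h))]
  refine Measure.integrableOn_of_bounded (M := G) measure_ball_lt_top.ne hf.aestronglyMeasurable
    (ae_restrict_of_ae ?_)
  filter_upwards [hG] with x hx using hx

lemma abs_massDensity_le (hp : 1 < p) (hr : 1 < r) (hε : 0 < ε) (hρ : 0 < ρ)
    {v : EuclideanSpace ℝ (Fin N) → ℝ} {x : EuclideanSpace ℝ (Fin N)}
    (hv : x ∈ Metric.ball x₀ (3 * ρ) → v x ∈ Icc 0 M) :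
    |(v x + ε) ^ r / r * cutoff x₀ ρ x ^ p| ≤
      (Metric.ball x₀ (2 * ρ)).indicator (fun _ => (M + ε) ^ r / r) x := by
  by_cases hx : x ∈ Metric.ball x₀ (2 * ρ)
  · have h := hv (Metric.ball_subset_ball (by linarith) hx)
    have h0 : 0 ≤ v x + ε := by linarith [h.1]
    have hζ : 0 ≤ cutoff x₀ ρ x ^ p := Real.rpow_nonneg (cutoff_nonneg _) _
    rw [indicator_of_mem hx, abs_of_nonneg (by positivity)]
    refine (mul_le_of_le_one_right (by positivity)
      (Real.rpow_le_one (cutoff_nonneg _) (cutoff_le_one _) (by linarith))).trans ?_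
    gcongr
    exact h.2
  · rw [indicator_of_notMem hx, cutoff_eq_zero hρ hx, Real.zero_rpow (by linarith), mul_zero,
      abs_zero]

lemma integrable_indicator_ball (G R : ℝ) :
    Integrable ((Metric.ball x₀ R).indicator fun _ => G) :=
  (integrable_indicator_iff measurableSet_ball).2 (integrableOn_const measure_ball_lt_top.ne)

lemma integrable_massDensity (hp : 1 < p) (hr : 1 < r) (hε : 0 < ε) (hρ : 0 < ρ)
    {v : EuclideanSpace ℝ (Fin N) → ℝ}
    (hvm : AEMeasurable (fun x => (v x + ε) ^ r / r * cutoff x₀ ρ x ^ p))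
    (hv : ∀ᵐ x, x ∈ Metric.ball x₀ (3 * ρ) → v x ∈ Icc 0 M) :
    Integrable fun x => (v x + ε) ^ r / r * cutoff x₀ ρ x ^ p :=
  (integrable_indicator_ball ((M + ε) ^ r / r) (2 * ρ)).mono' hvm.aestronglyMeasurable
    (hv.mono fun _ hx => abs_massDensity_le hp hr hε hρ hx)

lemma Regular.measurable_massDensity (h : Regular p s C₂ M x₀ ρ a b w k) :
    Measurable fun z : EuclideanSpace ℝ (Fin N) × ℝ =>
      (w z.1 z.2 + ε) ^ r / r * cutoff x₀ ρ z.1 ^ p :=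
  (((h.measurable.add_const ε).pow_const r).div_const r).mul
    ((measurable_cutoff.comp measurable_fst).pow_const p)

lemma Regular.measurable_mass (h : Regular p s C₂ M x₀ ρ a b w k) :
    Measurable fun τ => mass p r ε x₀ ρ fun x => w x τ :=
  h.measurable_massDensity.stronglyMeasurable.integral_prod_left'.measurable

lemma Regular.integrableOn_mass (hp : 1 < p) (hr : 1 < r) (hε : 0 < ε) (hρ : 0 < ρ)
    (h : Regular p s C₂ M x₀ ρ a b w k) (c t₁ t₂ : ℝ) :
    IntegrableOn (fun τ => mass p r ε x₀ ρ fun x => w x (τ + c)) (Ioc t₁ t₂) := by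
  refine Measure.integrableOn_of_bounded
    (M := ∫ x, (Metric.ball x₀ (2 * ρ)).indicator (fun _ => (M + ε) ^ r / r) x)
    (by simp)
    (h.measurable_mass.comp (measurable_add_const c)).aestronglyMeasurable
    (Eventually.of_forall fun τ => ?_)
  refine norm_integral_le_of_norm_le (integrable_indicator_ball _ _)
    (Eventually.of_forall fun x => ?_)
  exact abs_massDensity_le (v := fun x => w x (τ + c)) hp hr hε hρ fun hx => h.mem_Icc x hx _

/-- Convexity: the increment of the mass is at most the increment of `w` times the test
function. -/
lemma Regular.mass_sub_le (hp : 1 < p) (hr : 1 < r) (hε : 0 < ε) (hρ : 0 < ρ) (hM : 0 ≤ M)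
    (h : Regular p s C₂ M x₀ ρ a b w k) {τ τ' : ℝ} (hτ : τ' ∈ Ioo a b) :
    (mass p r ε x₀ ρ fun x => w x τ') - (mass p r ε x₀ ρ fun x => w x τ) ≤
      ∫ x, (w x τ' - w x τ) * timeTest p r ε x₀ ρ a b w x τ' := by
  have hi : ∀ τ, Integrable fun x => (w x τ + ε) ^ r / r * cutoff x₀ ρ x ^ p := fun τ =>
    integrable_massDensity hp hr hε hρ
      (h.measurable_massDensity.comp measurable_prodMk_right).aemeasurable
      (Eventually.of_forall fun x hx => h.mem_Icc x hx τ)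
  have hwm : ∀ τ, Measurable fun x => w x τ := fun τ => h.measurable.of_uncurry_right
  have hgm : Measurable fun x => timeTest p r ε x₀ ρ a b w x τ' :=
    (measurable_timeTest h.measurable).of_uncurry_right
  unfold mass
  rw [← integral_sub (hi τ') (hi τ)]
  refine integral_mono ((hi τ').sub (hi τ)) ?_ fun x => ?_
  · refine integrable_of_bounded_of_support (x₀ := x₀) (R := 2 * ρ) (G := M * (M + ε) ^ (r - 1))
      (((hwm τ').sub (hwm τ)).mul hgm).aemeasurable (Eventually.of_forall fun x => ?_)
      fun x hx => by rw [timeTest_eq_zero hp hρ hx, mul_zero]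
    by_cases hx : x ∈ Metric.ball x₀ (2 * ρ)
    · have hx3 := Metric.ball_subset_ball (by linarith : 2 * ρ ≤ 3 * ρ) hx
      have h1 := h.mem_Icc x hx3 τ
      have h2 := h.mem_Icc x hx3 τ'
      rw [abs_mul]
      refine mul_le_mul ?_ (abs_timeTest_le hp hr hε hρ hM h.mem_Icc x τ') (abs_nonneg _) hM
      rw [abs_le]
      constructor <;> linarith [h1.1, h1.2, h2.1, h2.2]
    · rw [timeTest_eq_zero hp hρ hx, mul_zero, abs_zero]
      positivity
  · simp only [timeTest, indicator_of_mem hτ, testFun]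
    by_cases hx : x ∈ Metric.ball x₀ (2 * ρ)
    · have hx3 := Metric.ball_subset_ball (by linarith : 2 * ρ ≤ 3 * ρ) hx
      have h1 := h.mem_Icc x hx3 τ
      have h2 := h.mem_Icc x hx3 τ'
      have h3 := rpow_div_sub_le hr (a := w x τ' + ε) (b := w x τ + ε) (by linarith [h2.1])
        (by linarith [h1.1])
      have hζ : 0 ≤ cutoff x₀ ρ x ^ p := Real.rpow_nonneg (cutoff_nonneg _) _
      have h4 := mul_le_mul_of_nonneg_right h3 hζ
      rw [add_sub_add_right_eq_sub] at h4
      linarith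
    · simp [cutoff_eq_zero hρ hx, Real.zero_rpow (by linarith : p ≠ 0)]

/-- The weak formulation between two times of a set of full measure, for time-independent test
functions. -/
def WeakEqOn (p s : ℝ) (x₀ : EuclideanSpace ℝ (Fin N)) (ρ : ℝ)
    (w : EuclideanSpace ℝ (Fin N) → ℝ → ℝ)
    (k : EuclideanSpace ℝ (Fin N) → EuclideanSpace ℝ (Fin N) → ℝ → ℝ) (G : Set ℝ) : Prop :=
  ∀ τ₁ ∈ G, ∀ τ₂ ∈ G, τ₁ < τ₂ → ∀ f : EuclideanSpace ℝ (Fin N) → ℝ, Measurable f →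
    (∀ x ∉ Metric.ball x₀ (2 * ρ), f x = 0) → (∃ c, ∀ x, |f x| ≤ c) →
    sobolevEnergy p s univ f < ∞ →
    ∫ x, (w x τ₂ - w x τ₁) * f x = -∫ σ in τ₁..τ₂, energy p w k f σ

lemma measurable_translate {f : EuclideanSpace ℝ (Fin N) → ℝ → ℝ}
    (hf : Measurable (Function.uncurry f)) (c : ℝ) :
    Measurable (Function.uncurry fun x τ => f x (τ + c)) :=
  hf.comp (by fun_prop : Measurable fun z : EuclideanSpace ℝ (Fin N) × ℝ => (z.1, z.2 + c))

/-- The error made by translating the test function in time tends to zero. -/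
lemma Regular.exists_translate_error_le (hN : 1 ≤ N) (hp : 1 < p) (hp2 : p < 2) (hs : 0 < s)
    (hs1 : s < 1) (hr : 1 < r) (hC : 0 < C₂) (hε : 0 < ε) (hρ : 0 < ρ) (hM : 0 ≤ M)
    (h : Regular p s C₂ M x₀ ρ a b w k) {η : ℝ} (hη : 0 < η) :
    ∃ h₀ : ℝ, 0 < h₀ ∧ ∀ κ : ℝ, |κ| < h₀ →
      ∫⁻ τ in Ioo a b, ∫⁻ z, ‖fluxDensity p w k z τ *
        ((timeTest p r ε x₀ ρ a b w z.1 (τ + κ) - timeTest p r ε x₀ ρ a b w z.1 τ) -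
          (timeTest p r ε x₀ ρ a b w z.2 (τ + κ) - timeTest p r ε x₀ ρ a b w z.2 τ))‖ₑ ≤
        ENNReal.ofReal η := by
  obtain ⟨C, hC_lt, hCb⟩ := h.exists_energy_bound hp hp2 hs hC hρ
  set g := timeTest p r ε x₀ ρ a b w with hg
  have hgm : Measurable (Function.uncurry g) := measurable_timeTest h.measurable
  have t1 := tendsto_eLpNorm_time_translate (by simpa using hp.le) ENNReal.ofReal_ne_top
    (h.memLp_quot_timeTest hN hp hs1 hr hε hρ hM)
  have t2 := tendsto_eLpNorm_time_translate le_rfl ENNReal.one_ne_top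
    (h.memLp_timeTest hp hr hε hρ hM)
  have t3 := ENNReal.Tendsto.const_mul (t1.add t2) (Or.inr hC_lt.ne)
  rw [add_zero, mul_zero] at t3
  have h4 := t3.eventually_lt_const (ENNReal.ofReal_pos.2 hη)
  obtain ⟨h₀, h₀pos, hh₀⟩ := Metric.eventually_nhds_iff.1 h4
  refine ⟨h₀, h₀pos, fun κ hκ => ?_⟩
  have h5 := (hh₀ (show dist κ 0 < h₀ by simpa using hκ)).le
  refine le_trans (hCb (fun x τ => g x (τ + κ) - g x τ) ((measurable_translate hgm κ).sub hgm)
    fun x hx τ => ?_) (le_trans (le_of_eq ?_) h5)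
  · rw [hg, timeTest_eq_zero hp hρ hx, timeTest_eq_zero hp hρ hx, sub_zero]
  · congr 3
    ext z
    have := quot_sub_translate (p := p) (s := s) (x₀ := x₀) (ρ := ρ) g 0 κ z
    simpa using this

/-- The energy inequality, integrated in time, up to a small error. -/
lemma Regular.integral_mass_sub_le (hN : 1 ≤ N) (hp : 1 < p) (hp2 : p < 2) (hs : 0 < s)
    (hs1 : s < 1) (hr : 1 < r) (hC : 0 < C₂) (hε : 0 < ε) (hρ : 0 < ρ) (hM : 0 ≤ M)
    (h : Regular p s C₂ M x₀ ρ a b w k) {G : Set ℝ}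
    (hG : ∀ᵐ τ ∂(volume.restrict (Ioo a b)), τ ∈ G) (hweak : WeakEqOn p s x₀ ρ w k G) {R : ℝ}
    (hR : ∀ᵐ τ ∂(volume.restrict (Ioo a b)),
      -energy p w k (fun x => timeTest p r ε x₀ ρ a b w x τ) τ ≤ R)
    {t₁ t₂ : ℝ} (h₁ : a ≤ t₁) (h₁₂ : t₁ ≤ t₂) (h₂ : t₂ < b) {η : ℝ} (hη : 0 < η) :
    ∃ h₀ : ℝ, 0 < h₀ ∧ ∀ δ : ℝ, 0 < δ → δ < h₀ →
      ∫ τ in t₁..t₂, ((mass p r ε x₀ ρ fun x => w x (τ + δ)) - mass p r ε x₀ ρ fun x => w x τ) ≤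
        δ * ((t₂ - t₁) * R + η) := by
  obtain ⟨h₀, h₀pos, hh₀⟩ :=
    h.exists_translate_error_le (r := r) (ε := ε) hN hp hp2 hs hs1 hr hC hε hρ hM hη
  obtain ⟨C, hC_lt, hCb⟩ := h.exists_energy_bound hp hp2 hs hC hρ
  have hsob := h.ae_sobolevEnergy_timeTest (r := r) (ε := ε) hN hp hs hs1 hr hε hρ hM
  have hQ := h.memLp_quot_timeTest (r := r) (ε := ε) hN hp hs1 hr hε hρ hM
  have hL1 := h.memLp_timeTest (r := r) (ε := ε) hp hr hε hρ hM
  have hbd := abs_timeTest_le (a := a) (b := b) (p := p) (r := r) hp hr hε hρ hM h.mem_Icc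
  have hzero : ∀ x ∉ Metric.ball x₀ (2 * ρ), ∀ τ, timeTest p r ε x₀ ρ a b w x τ = 0 :=
    fun x hx τ => timeTest_eq_zero hp hρ hx τ
  have hmass : ∀ τ τ' : ℝ, τ' ∈ Ioo a b → _ := fun τ τ' hτ =>
    h.mass_sub_le (r := r) (ε := ε) hp hr hε hρ hM (τ := τ) hτ
  have hgm : Measurable (Function.uncurry (timeTest p r ε x₀ ρ a b w)) :=
    measurable_timeTest h.measurable
  -- From here on only the recorded properties of the test function matter: measurability, support,
  -- bounds, regularity, and the convexity inequality.
  generalize timeTest p r ε x₀ ρ a b w = g at *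
  have hgfin : ∀ κ, ∫⁻ τ in Ioo a b, ∫⁻ z,
      ‖fluxDensity p w k z τ * (g z.1 (τ + κ) - g z.2 (τ + κ))‖ₑ ≤
        C * (eLpNorm (quot p s x₀ ρ g) (ENNReal.ofReal p) volume +
          eLpNorm (Function.uncurry g) 1 volume) := by
    intro κ
    refine (hCb (fun x τ => g x (τ + κ)) (measurable_translate hgm κ)
      fun x hx τ => hzero x hx _).trans_eq ?_
    rw [← eLpNorm_time_translate hQ.1 κ, ← eLpNorm_time_translate hL1.1 κ]
    rfl
  set Cg := C * (eLpNorm (quot p s x₀ ρ g) (ENNReal.ofReal p) volume +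
    eLpNorm (Function.uncurry g) 1 volume)
  have hCg : Cg < ∞ := ENNReal.mul_lt_top hC_lt (ENNReal.add_lt_top.2 ⟨hQ.2, hL1.2⟩)
  -- The second bound keeps `τ + δ` inside `(a, b)` for every `τ ≤ t₂`.
  refine ⟨min h₀ (b - t₂), lt_min h₀pos (by linarith), fun δ hδ hδ' => ?_⟩
  have hδ1 : δ < h₀ := hδ'.trans_le (min_le_left _ _)
  have hδ2 : δ < b - t₂ := hδ'.trans_le (min_le_right _ _)
  -- The solution is taken at time `τ + σ`, while the test function stays frozen at the end `τ + δ`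
  -- of the step.
  set e : ℝ → ℝ → ℝ := fun τ σ => energy p w k (fun x => g x (τ + δ)) (τ + σ) with he
  -- joint integrability of the energy
  have hem : Measurable (Function.uncurry e) := by
    have m1 : Measurable fun v : (ℝ × ℝ) × (EuclideanSpace ℝ (Fin N) × EuclideanSpace ℝ (Fin N)) =>
        fluxDensity p w k v.2 (v.1.1 + v.1.2) :=
      h.measurable_fluxDensity.comp (by fun_prop : Measurable fun v :
        (ℝ × ℝ) × (EuclideanSpace ℝ (Fin N) × EuclideanSpace ℝ (Fin N)) =>
          (v.2, v.1.1 + v.1.2))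
    have m2 : Measurable fun v : (ℝ × ℝ) × (EuclideanSpace ℝ (Fin N) × EuclideanSpace ℝ (Fin N)) =>
        g v.2.1 (v.1.1 + δ) := hgm.comp (by fun_prop : Measurable fun v :
        (ℝ × ℝ) × (EuclideanSpace ℝ (Fin N) × EuclideanSpace ℝ (Fin N)) => (v.2.1, v.1.1 + δ))
    have m3 : Measurable fun v : (ℝ × ℝ) × (EuclideanSpace ℝ (Fin N) × EuclideanSpace ℝ (Fin N)) =>
        g v.2.2 (v.1.1 + δ) := hgm.comp (by fun_prop : Measurable fun v :
        (ℝ × ℝ) × (EuclideanSpace ℝ (Fin N) × EuclideanSpace ℝ (Fin N)) => (v.2.2, v.1.1 + δ))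
    exact (m1.mul (m2.sub m3)).stronglyMeasurable.integral_prod_right'.measurable
  -- Seen from the time `τ + σ` of the solution, the test function is translated by `δ - σ`, which
  -- is smaller than `δ` in size.
  have heq : ∀ σ τ, e τ σ = (fun τ' => energy p w k (fun x => g x (τ' + (δ - σ))) τ') (τ + σ) := by
    intro σ τ
    simp only [he]
    congr 1
    ext x
    congr 1
    ring
  have hint : Integrable (Function.uncurry e)
      ((volume.restrict (Ioc t₁ t₂)).prod (volume.restrict (Ioc 0 δ))) := by
    refine ⟨hem.aestronglyMeasurable, ?_⟩
    rw [hasFiniteIntegral_iff_enorm, lintegral_prod_symm _ hem.enorm.aemeasurable]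
    calc _ ≤ ∫⁻ σ in Ioc 0 δ, Cg := by
          refine setLIntegral_mono' measurableSet_Ioc fun σ hσ => ?_
          simp only [Function.uncurry, heq]
          refine le_trans ?_ (hgfin (δ - σ))
          rw [← lintegral_indicator measurableSet_Ioc, ← lintegral_indicator measurableSet_Ioo]
          refine le_trans (lintegral_mono fun τ => ?_) (lintegral_add_right_eq_self _ σ).le
          by_cases hτ : τ ∈ Ioc t₁ t₂
          · have : τ + σ ∈ Ioo a b := ⟨by linarith [hτ.1, hσ.1], by linarith [hτ.2, hσ.2]⟩
            rw [indicator_of_mem hτ, indicator_of_mem this]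
            exact enorm_integral_le_lintegral_enorm _
          · rw [indicator_of_notMem hτ]
            exact zero_le
      _ < ∞ := by
          rw [setLIntegral_const]
          exact ENNReal.mul_lt_top hCg (by simp)
  -- the weak formulation at almost every time
  have hstep : ∀ᵐ τ ∂(volume.restrict (Ioc t₁ t₂)),
      (mass p r ε x₀ ρ fun x => w x (τ + δ)) - (mass p r ε x₀ ρ fun x => w x τ) ≤
        -∫ σ in Ioc 0 δ, e τ σ := by
    rw [ae_restrict_iff' measurableSet_Ioo] at hG
    have qmp := (measurePreserving_add_right (volume : Measure ℝ) δ).quasiMeasurePreserving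
    rw [ae_restrict_iff' measurableSet_Ioc]
    filter_upwards [hG, qmp.ae hG, qmp.ae hsob] with τ i1 i2 i3 hτ
    have hτ1 : τ ∈ Ioo a b := ⟨h₁.trans_lt hτ.1, hτ.2.trans_lt h₂⟩
    have hτ2 : τ + δ ∈ Ioo a b := ⟨by linarith [hτ1.1], by linarith [hτ.2]⟩
    refine (hmass τ (τ + δ) hτ2).trans_eq ?_
    rw [hweak τ (i1 hτ1) (τ + δ) (i2 hτ2) (by linarith) (fun x => g x (τ + δ))
      hgm.of_uncurry_right (fun x hx => hzero x hx _) ⟨_, fun x => hbd x _⟩ i3,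
      ← intervalIntegral.integral_of_le hδ.le]
    have := intervalIntegral.integral_comp_add_left (a := 0) (b := δ)
      (fun σ => energy p w k (fun x => g x (τ + δ)) σ) τ
    rw [add_zero] at this
    rw [← this]
  -- With `σ` fixed, the substitution `τ' = τ + σ` moves the interval to `(t₁ + σ, t₂ + σ)` and
  -- keeps its length. The lower bound with small translation error applies there, and integrating
  -- over `σ` produces the factor `δ`.
  have hinner : ∀ σ ∈ Ioc 0 δ, -∫ τ in Ioc t₁ t₂, e τ σ ≤ (t₂ - t₁) * R + η := by
    intro σ hσ
    simp only [heq]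
    rw [← intervalIntegral.integral_of_le h₁₂, intervalIntegral.integral_comp_add_right
      (fun τ' => energy p w k (fun x => g x (τ' + (δ - σ))) τ') σ]
    have h3 := h.neg_integral_energy_le (measurable_translate hgm (δ - σ)) hgm
      (by simpa using (hgfin 0).trans_lt hCg) hη.le
      (hh₀ (δ - σ) (by rw [abs_of_nonneg (by linarith [hσ.2])]; linarith [hσ.1])) hR
      (t₁ := t₁ + σ) (t₂ := t₂ + σ) (by linarith [hσ.1]) (by linarith) (by linarith [hσ.2])
    rwa [add_sub_add_right_eq_sub] at h3
  have hm1 := h.integrableOn_mass (r := r) (ε := ε) hp hr hε hρ δ t₁ t₂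
  have hm0 := h.integrableOn_mass (r := r) (ε := ε) hp hr hε hρ 0 t₁ t₂
  simp only [add_zero] at hm0
  rw [intervalIntegral.integral_of_le h₁₂]
  calc _ ≤ ∫ τ in Ioc t₁ t₂, -∫ σ in Ioc 0 δ, e τ σ :=
        integral_mono_ae (hm1.sub hm0) hint.integral_prod_left.neg hstep
    _ = ∫ σ in Ioc 0 δ, -∫ τ in Ioc t₁ t₂, e τ σ := by
        rw [integral_neg, integral_neg, integral_integral_swap hint]
    _ ≤ ∫ σ in Ioc 0 δ, ((t₂ - t₁) * R + η) :=
        setIntegral_mono_on hint.integral_prod_right.neg (integrable_const _) measurableSet_Ioc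
          hinner
    _ = _ := by
        rw [setIntegral_const, smul_eq_mul, Real.volume_real_Ioc_of_le hδ.le, sub_zero]

end Core

/-! ### Passing from almost every time to every time -/

/-- The integral telescopes to the integral of `Φ` over `(t₂, t₂ + δ)` minus that over `(t₁, t₁ +
δ)`, which is `δ (Φ t₂ - Φ t₁)` up to a small multiple of `δ` by continuity. Each of these two
approximations and the hypothesis costs `η / 3`. -/
lemma sub_le_of_integral_sub_le {Φ : ℝ → ℝ} {c b t₁ t₂ R : ℝ} (hΦ : ContinuousOn Φ (Ico c b))
    (h₁ : c ≤ t₁) (h₁₂ : t₁ ≤ t₂) (h₂ : t₂ < b)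
    (h : ∀ η > 0, ∃ h₀ > 0, ∀ δ, 0 < δ → δ < h₀ →
      ∫ τ in t₁..t₂, (Φ (τ + δ) - Φ τ) ≤ δ * ((t₂ - t₁) * R + η)) :
    Φ t₂ - Φ t₁ ≤ (t₂ - t₁) * R := by
  have hnear : ∀ t ∈ Ico c b, ∀ η > 0, ∃ d > 0, ∀ τ ∈ Icc t (t + d), |Φ τ - Φ t| ≤ η := by
    intro t ht η hη
    obtain ⟨d, hd, hd'⟩ := Metric.continuousWithinAt_iff.1 (hΦ t ht) η hη
    refine ⟨min (d / 2) ((b - t) / 2), lt_min (by linarith) (by linarith [ht.2]), fun τ hτ => ?_⟩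
    have e1 := hτ.2.trans (add_le_add_right (min_le_left (d / 2) ((b - t) / 2)) t)
    have e2 := hτ.2.trans (add_le_add_right (min_le_right (d / 2) ((b - t) / 2)) t)
    have hm : τ ∈ Ico c b := ⟨ht.1.trans hτ.1, by linarith [ht.2]⟩
    refine (hd' hm ?_).le
    rw [Real.dist_eq, abs_of_nonneg (by linarith [hτ.1])]
    linarith
  refine le_of_forall_pos_le_add fun η hη => ?_
  obtain ⟨h₀, h₀pos, hh⟩ := h (η / 3) (by positivity)
  obtain ⟨d₁, hd₁, hd₁'⟩ := hnear t₁ ⟨h₁, h₁₂.trans_lt h₂⟩ (η / 3) (by positivity)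
  obtain ⟨d₂, hd₂, hd₂'⟩ := hnear t₂ ⟨h₁.trans h₁₂, h₂⟩ (η / 3) (by positivity)
  set δ := min (h₀ / 2) (min (min d₁ d₂) ((b - t₂) / 2)) with hδ
  have hδ0 : 0 < δ := lt_min (by linarith) (lt_min (lt_min hd₁ hd₂) (by linarith))
  have hδh : δ < h₀ := (min_le_left _ _).trans_lt (by linarith)
  have hδ1 : δ ≤ d₁ := (min_le_right _ _).trans ((min_le_left _ _).trans (min_le_left _ _))
  have hδ2 : δ ≤ d₂ := (min_le_right _ _).trans ((min_le_left _ _).trans (min_le_right _ _))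
  have hδb : δ ≤ (b - t₂) / 2 := (min_le_right _ _).trans (min_le_right _ _)
  have hii : ∀ x y, x ∈ Ico c b → y ∈ Ico c b → IntervalIntegrable Φ volume x y := fun x y hx hy =>
    (hΦ.mono ((ordConnected_Ico.uIcc_subset hx hy))).intervalIntegrable
  have m1 : t₁ ∈ Ico c b := ⟨h₁, h₁₂.trans_lt h₂⟩
  have m2 : t₂ ∈ Ico c b := ⟨h₁.trans h₁₂, h₂⟩
  have m1' : t₁ + δ ∈ Ico c b := ⟨by linarith, by linarith⟩
  have m2' : t₂ + δ ∈ Ico c b := ⟨by linarith, by linarith⟩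
  have hshift : IntervalIntegrable (fun τ => Φ (τ + δ)) volume t₁ t₂ := by
    have := (hii _ _ m1' m2').comp_add_right δ
    simpa using this
  have key := hh δ hδ0 hδh
  rw [intervalIntegral.integral_sub hshift (hii _ _ m1 m2),
    intervalIntegral.integral_comp_add_right,
    intervalIntegral.integral_interval_sub_interval_comm (hii _ _ m1' m2') (hii _ _ m1 m2)
      (hii _ _ m1' m1), intervalIntegral.integral_symm, intervalIntegral.integral_symm t₂] at key
  have l1 : ∫ τ in t₁..t₁ + δ, Φ τ ≤ δ * (Φ t₁ + η / 3) := by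
    calc _ ≤ ∫ τ in t₁..t₁ + δ, (Φ t₁ + η / 3) := by
          refine intervalIntegral.integral_mono_on (by linarith) (hii _ _ m1 m1') (by simp)
            fun τ hτ => ?_
          have := (abs_le.1 (hd₁' τ ⟨hτ.1, hτ.2.trans (by linarith)⟩)).2
          linarith
      _ = _ := by rw [intervalIntegral.integral_const, smul_eq_mul, add_sub_cancel_left]
  have l2 : δ * (Φ t₂ - η / 3) ≤ ∫ τ in t₂..t₂ + δ, Φ τ := by
    calc _ = ∫ τ in t₂..t₂ + δ, (Φ t₂ - η / 3) := by
          rw [intervalIntegral.integral_const, smul_eq_mul, add_sub_cancel_left]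
      _ ≤ _ := by
          refine intervalIntegral.integral_mono_on (by linarith) (by simp) (hii _ _ m2 m2')
            fun τ hτ => ?_
          have := (abs_le.1 (hd₂' τ ⟨hτ.1, hτ.2.trans (by linarith)⟩)).1
          linarith
  have l3 : δ * (Φ t₂ - Φ t₁) ≤ δ * ((t₂ - t₁) * R + η) := by nlinarith
  exact le_of_mul_le_mul_left l3 hδ0

/-- Fubini for null sets, with the time variable outermost. -/
lemma ae_time_of_ae_prod {X : Type*} [MeasureSpace X] [SigmaFinite (volume : Measure X)]
    {A : Set X} {I : Set ℝ} {P : X × ℝ → Prop}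
    (h : ∀ᵐ v ∂(volume.restrict (A ×ˢ I) : Measure (X × ℝ)), P v) :
    ∀ᵐ τ ∂(volume.restrict I), ∀ᵐ x ∂(volume.restrict A), P (x, τ) := by
  rw [Measure.volume_eq_prod, ← Measure.prod_restrict, ← Measure.prod_swap] at h
  have h' := ae_of_ae_map measurable_swap.aemeasurable h
  exact Measure.ae_ae_of_ae_prod h'

/-- Every interval to the right of `τ₀` has positive measure, so good times accumulate at `τ₀` from
the right; `τ₀ = 0` is included. -/
lemma frequently_nhdsWithin_of_ae {P : ℝ → Prop} {b τ₀ : ℝ} (h₀ : 0 ≤ τ₀) (hb : τ₀ < b)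
    (h : ∀ᵐ τ ∂(volume.restrict (Ioo 0 b)), P τ) : ∃ᶠ τ in 𝓝[>] τ₀, P τ := by
  intro hn
  obtain ⟨d, hd, hd'⟩ := (mem_nhdsGT_iff_exists_Ioo_subset' hb).1 hn
  have hsub : Ioo τ₀ (min d b) ⊆ Ioo 0 b := fun τ hτ =>
    ⟨h₀.trans_lt hτ.1, hτ.2.trans_le (min_le_right _ _)⟩
  have h1 := ae_restrict_of_ae_restrict_of_subset hsub h
  have h2 : ∀ᵐ τ ∂(volume.restrict (Ioo τ₀ (min d b))), False := by
    filter_upwards [h1, ae_restrict_mem measurableSet_Ioo] with τ i1 i2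
    exact hd' ⟨i2.1, i2.2.trans_le (min_le_left _ _)⟩ i1
  rw [eventually_false_iff_eq_bot, ae_eq_bot, Measure.restrict_eq_zero, Real.volume_Ioo,
    ENNReal.ofReal_eq_zero] at h2
  have : τ₀ < min d b := lt_min hd hb
  linarith

/-- Truncation is the nearest point projection onto `[0, M]`. -/
lemma abs_sub_clamp_le {M x y : ℝ} (hy : y ∈ Icc 0 M) :
    |x - max 0 (min M x)| ≤ |x - y| := by
  have h1 := hy.1
  have h2 := hy.2
  rcases le_total x 0 with h | h
  · rw [min_eq_right (by linarith), max_eq_left h, abs_of_nonpos (by linarith),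
      abs_of_nonpos (by linarith)]
    linarith
  rcases le_total x M with h' | h'
  · rw [min_eq_right h', max_eq_right h, sub_self, abs_zero]
    exact abs_nonneg _
  · rw [min_eq_left h', max_eq_right (by linarith), abs_of_nonneg (by linarith),
      abs_of_nonneg (by linarith)]
    linarith

lemma timeDomain₀_mem_nhdsGT {T : EReal} {τ₀ : ℝ} (h : τ₀ ∈ timeDomain₀ T) :
    timeDomain₀ T ∈ 𝓝[>] τ₀ := by
  obtain ⟨c, hc, hcT⟩ := EReal.lt_iff_exists_real_btwn.1 h.2
  have h1 : Ioo τ₀ c ∈ 𝓝[>] τ₀ := Ioo_mem_nhdsGT (by exact_mod_cast hc)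
  filter_upwards [h1] with τ hτ
  exact ⟨h.1.trans hτ.1.le, lt_trans (by exact_mod_cast hτ.2) hcT⟩

/-- Bounds valid at almost every time are valid at every time, by continuity in `L²`. -/
lemma mem_Icc_of_ae_time {N : ℕ} {U : Set (EuclideanSpace ℝ (Fin N))} {T : EReal}
    {u : EuclideanSpace ℝ (Fin N) → ℝ → ℝ} {M b τ₀ : ℝ} (hτ₀ : τ₀ ∈ timeDomain₀ T) (hb : τ₀ < b)
    (hmem : MemLp (fun x => u x τ₀) 2 (volume.restrict U))
    (hcont : Tendsto (fun τ => eLpNorm (fun x => u x τ - u x τ₀) 2 (volume.restrict U))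
      (𝓝[timeDomain₀ T] τ₀) (𝓝 0))
    (hae : ∀ᵐ τ ∂(volume.restrict (Ioo 0 b)), ∀ᵐ x ∂(volume.restrict U), u x τ ∈ Icc 0 M) :
    ∀ᵐ x ∂(volume.restrict U), u x τ₀ ∈ Icc 0 M := by
  set c : EuclideanSpace ℝ (Fin N) → ℝ := fun x => u x τ₀ - max 0 (min M (u x τ₀)) with hc
  -- The sign of `M` is read off from one good time and one good point, which exist unless the
  -- restricted measure vanishes, a trivial case.
  have hM : 0 ≤ M ∨ volume.restrict U = 0 := by
    by_contra! hcon
    obtain ⟨h1, h2⟩ := hcon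
    have hfr := frequently_nhdsWithin_of_ae hτ₀.1 hb hae
    obtain ⟨τ, hτ⟩ := hfr.exists
    have : (ae (volume.restrict U)).NeBot := ae_neBot.2 h2
    obtain ⟨x, hx⟩ := hτ.exists
    linarith [hx.1, hx.2]
  rcases hM with hM | hU
  swap
  · rw [hU]
    simp
  have hle : 𝓝[>] τ₀ ≤ 𝓝[timeDomain₀ T] τ₀ :=
    nhdsWithin_le_of_mem (timeDomain₀_mem_nhdsGT hτ₀)
  have hfr := frequently_nhdsWithin_of_ae hτ₀.1 hb hae
  -- The distance of `u(τ₀)` from its truncation is at most its `L²` distance from `u(τ)` at good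
  -- times `τ`, and this tends to zero as they approach `τ₀`.
  have hle0 : eLpNorm c 2 (volume.restrict U) ≤ 0 := by
    refine ge_of_tendsto_of_frequently (hcont.mono_left hle) (hfr.mono fun τ hτ => ?_)
    refine eLpNorm_mono_ae ?_
    filter_upwards [hτ] with x hx
    rw [Real.norm_eq_abs, Real.norm_eq_abs, abs_sub_comm (u x τ)]
    exact abs_sub_clamp_le hx
  have hcm : AEStronglyMeasurable c (volume.restrict U) := by
    have h1 := hmem.1.aemeasurable
    exact (h1.sub (aemeasurable_const.max (aemeasurable_const.min h1))).aestronglyMeasurable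
  have hc0 := (eLpNorm_eq_zero_iff hcm (by norm_num)).1 (le_antisymm hle0 zero_le)
  filter_upwards [hc0] with x hx
  have : u x τ₀ = max 0 (min M (u x τ₀)) := by
    have : u x τ₀ - max 0 (min M (u x τ₀)) = 0 := hx
    linarith
  rw [this]
  exact ⟨le_max_left _ _, max_le hM (min_le_left _ _)⟩

/-! ### Regular representatives of a local weak solution -/

section Representatives

variable {N : ℕ} {p s C₁ C₂ M ρ b r ε : ℝ} {x₀ : EuclideanSpace ℝ (Fin N)}
  {Ω : Set (EuclideanSpace ℝ (Fin N))} {T : EReal}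
  {K : EuclideanSpace ℝ (Fin N) → EuclideanSpace ℝ (Fin N) → ℝ → ℝ}
  {u : EuclideanSpace ℝ (Fin N) → ℝ → ℝ}

lemma compactlyInside_ball (hρ : 0 < ρ) (hΩ : Metric.ball x₀ (4 * ρ) ⊆ Ω) :
    CompactlyInside (Metric.ball x₀ (3 * ρ)) Ω := by
  have hsub : closure (Metric.ball x₀ (3 * ρ)) ⊆ Metric.closedBall x₀ (3 * ρ) :=
    Metric.closure_ball_subset_closedBall
  refine ⟨Metric.isOpen_ball, (isCompact_closedBall x₀ (3 * ρ)).of_isClosed_subset isClosed_closure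
    hsub, hsub.trans ((Metric.closedBall_subset_ball (by linarith)).trans hΩ)⟩

lemma Ioo_subset_timeDomain (hb : b ∈ timeDomain T) : Ioo 0 b ⊆ timeDomain T := fun τ hτ =>
  ⟨hτ.1, lt_trans (by exact_mod_cast hτ.2) hb.2⟩

lemma ae_prod_and {X : Type*} [MeasureSpace X] [SigmaFinite (volume : Measure X)] {P : X → Prop}
    (h : ∀ᵐ x, P x) : ∀ᵐ z : X × X, P z.1 ∧ P z.2 := by
  filter_upwards [Measure.quasiMeasurePreserving_fst.ae h,
    Measure.quasiMeasurePreserving_snd.ae h] with z h1 h2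
  exact ⟨h1, h2⟩

/-- A local weak solution and its kernel agree almost everywhere with regular representatives. -/
lemma exists_regular (hρ : 0 < ρ) (hM : 0 ≤ M) (hC₁ : 0 < C₁)
    (hC : 0 < C₂) (hΩ : Metric.ball x₀ (4 * ρ) ⊆ Ω) (hK : IsKernel N p s C₁ C₂ T K)
    (hu : IsLocalWeakSolution p s Ω T K u) (hb : b ∈ timeDomain T)
    (hbd : ∀ᵐ τ ∂(volume.restrict (Ioo 0 b)),
      ∀ᵐ x ∂(volume.restrict (Metric.ball x₀ (3 * ρ))), u x τ ∈ Icc 0 M) :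
    ∃ (w : EuclideanSpace ℝ (Fin N) → ℝ → ℝ)
      (k : EuclideanSpace ℝ (Fin N) → EuclideanSpace ℝ (Fin N) → ℝ → ℝ),
      (∀ a, 0 < a → a < b → Regular p s C₂ M x₀ ρ a b w k) ∧
      (∀ᵐ τ ∂(volume.restrict (Ioo 0 b)), ∀ᵐ x, w x τ = u x τ) ∧
      (∀ᵐ τ ∂(volume.restrict (Ioo 0 b)),
        ∀ᵐ z : EuclideanSpace ℝ (Fin N) × EuclideanSpace ℝ (Fin N),
          k z.1 z.2 τ = K z.1 z.2 τ) := by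
  classical
  set B := Metric.ball x₀ (3 * ρ)
  have hB : MeasurableSet B := measurableSet_ball
  set u' := hu.measurable.mk _ with hu'
  set K' := hK.measurable.mk _ with hK'
  have hu'm : Measurable u' := hu.measurable.measurable_mk
  have hK'm : Measurable K' := hK.measurable.measurable_mk
  have hsubT : ∀ {X : Type _} [MeasureSpace X], (univ : Set X) ×ˢ Ioo 0 b ⊆ univ ×ˢ timeDomain T :=
    fun {_} _ => prod_mono subset_rfl (Ioo_subset_timeDomain hb)
  -- Truncating measurable representatives of `u` and `K` makes the bounds valid everywhere and
  -- changes them only on null sets, at almost every time.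
  set w : EuclideanSpace ℝ (Fin N) → ℝ → ℝ := fun x τ =>
    if x ∈ B then max 0 (min M (u' (x, τ))) else u' (x, τ) with hw
  set k : EuclideanSpace ℝ (Fin N) → EuclideanSpace ℝ (Fin N) → ℝ → ℝ := fun x y τ =>
    max 0 (min (C₂ / ‖x - y‖ ^ ((N : ℝ) + p * s)) (K' ((x, y), τ))) with hk
  have hwu : ∀ᵐ τ ∂(volume.restrict (Ioo 0 b)), ∀ᵐ x, w x τ = u x τ := by
    have h1 := ae_time_of_ae_prod (ae_restrict_of_ae_restrict_of_subset hsubT hu.measurable.ae_eq_mk)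
    rw [Measure.restrict_univ] at h1
    filter_upwards [h1, hbd] with τ i1 i2
    rw [ae_restrict_iff' hB] at i2
    filter_upwards [i1, i2] with x j1 j2
    have j1' : u x τ = u' (x, τ) := j1
    simp only [hw]
    split_ifs with hx
    · rw [← j1', min_eq_right (j2 hx).2, max_eq_right (j2 hx).1]
    · exact j1'.symm
  have hkK : ∀ᵐ τ ∂(volume.restrict (Ioo 0 b)),
      ∀ᵐ z : EuclideanSpace ℝ (Fin N) × EuclideanSpace ℝ (Fin N), k z.1 z.2 τ = K z.1 z.2 τ := by
    have h1 := ae_time_of_ae_prod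
      (ae_restrict_of_ae_restrict_of_subset hsubT (hK.measurable.ae_eq_mk.and hK.bounds))
    rw [Measure.restrict_univ] at h1
    filter_upwards [h1] with τ i1
    filter_upwards [i1] with z j
    obtain ⟨j1, j2, j3⟩ := j
    have j1' : K z.1 z.2 τ = K' (z, τ) := j1
    -- The strictly positive lower bound `C₁` excludes points with zero weight and forces the kernel
    -- to be nonnegative, so the truncation of the kernel is inactive.
    have hne : 0 < ‖z.1 - z.2‖ ^ ((N : ℝ) + p * s) := by
      refine lt_of_le_of_ne (by positivity) fun h0 => ?_
      rw [← h0, mul_zero] at j2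
      linarith
    have hK0 : 0 ≤ K z.1 z.2 τ := by
      by_contra! hneg
      have := mul_neg_of_neg_of_pos hneg hne
      linarith
    simp only [hk]
    rw [← j1', min_eq_right ((le_div_iff₀ hne).2 j3), max_eq_right hK0]
  refine ⟨w, k, fun a ha hab => ?_, hwu, hkK⟩
  have haT : a ∈ timeDomain T := Ioo_subset_timeDomain hb ⟨ha, hab⟩
  have hsub : Ioo a b ⊆ Ioo 0 b := Ioo_subset_Ioo_left ha.le
  have hwu' := ae_restrict_of_ae_restrict_of_subset hsub hwu
  constructor
  · refine Measurable.ite (hB.preimage measurable_fst) ?_ hu'm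
    exact measurable_const.max (measurable_const.min hu'm)
  · exact measurable_const.max ((by fun_prop : Measurable fun z :
      (EuclideanSpace ℝ (Fin N) × EuclideanSpace ℝ (Fin N)) × ℝ =>
        C₂ / ‖z.1.1 - z.1.2‖ ^ ((N : ℝ) + p * s)).min hK'm)
  · exact fun x y τ => le_max_left _ _
  · exact fun x y τ => max_le (by positivity) (min_le_left _ _)
  · intro x hx τ
    have hx' : x ∈ B := hx
    simp only [hw, if_pos hx']
    exact ⟨le_max_left _ _, max_le hM (min_le_left _ _)⟩
  · refine lt_of_le_of_lt ?_ (hu.sobolev B (compactlyInside_ball hρ hΩ) a haT b hb hab)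
    refine lintegral_mono_ae ?_
    filter_upwards [hwu'] with τ i1
    refine le_trans (le_of_eq ?_) le_add_self
    refine lintegral_congr_ae (ae_restrict_of_ae ?_)
    filter_upwards [ae_prod_and i1] with z hz
    rw [hz.1, hz.2]
  · refine ⟨_, hu.tail a haT b hb hab, ?_⟩
    filter_upwards [hwu', ae_le_essSup (μ := volume.restrict (Ioo a b))
      (f := fun τ => ∫⁻ x, ENNReal.ofReal (|u x τ| ^ (p - 1) / (1 + ‖x‖) ^ ((N : ℝ) + p * s)))]
      with τ i1 i2
    refine le_trans (le_of_eq ?_) i2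
    refine lintegral_congr_ae ?_
    filter_upwards [i1] with x hx
    rw [hx]

/-- A function frozen in time has zero weak time derivative, so the weak formulation reduces to an
identity for the increment of `u` between two times. -/
lemma isTestFunction_const (hρ : 0 < ρ) {f : EuclideanSpace ℝ (Fin N) → ℝ}
    (hf : Measurable f) (hf0 : ∀ x ∉ Metric.ball x₀ (2 * ρ), f x = 0) (hfb : ∃ c, ∀ x, |f x| ≤ c)
    (hfs : sobolevEnergy p s univ f < ∞) :
    IsTestFunction p s T (Metric.ball x₀ (3 * ρ)) (fun x _ => f x) (fun _ _ => 0) where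
  measurable := (hf.comp measurable_fst).aemeasurable
  eq_zero := by
    have hT : MeasurableSet (timeDomain T) := by
      have : timeDomain T = Ioi 0 ∩ ((↑) : ℝ → EReal) ⁻¹' Iio T := rfl
      rw [this]
      exact measurableSet_Ioi.inter (measurableSet_Iio.preimage continuous_coe_real_ereal.measurable)
    filter_upwards [ae_restrict_mem (measurableSet_ball.compl.prod hT)] with z hz
    exact hf0 _ fun h => hz.1 (Metric.ball_subset_ball (by linarith) h)
  memLp := by
    intro t₁ _ t₂ _ _
    obtain ⟨c, hc⟩ := hfb
    have : IsFiniteMeasure (volume.restrict (Metric.ball x₀ (3 * ρ) ×ˢ Ioo t₁ t₂) :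
        Measure (EuclideanSpace ℝ (Fin N) × ℝ)) := by
      refine ⟨?_⟩
      rw [Measure.restrict_apply_univ, Measure.volume_eq_prod, Measure.prod_prod]
      exact ENNReal.mul_lt_top measure_ball_lt_top (by simp)
    exact MemLp.of_bound (hf.comp measurable_fst).aestronglyMeasurable c
      (Eventually.of_forall fun z => hc z.1)
  memLp_deriv := fun _ _ _ _ _ => MemLp.zero'
  deriv := fun _ _ _ _ _ => Eventually.of_forall fun x => by simp
  sobolev := by
    intro t₁ _ t₂ _ _
    rw [setLIntegral_const]
    exact ENNReal.mul_lt_top hfs (by simp)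

/-- The weak formulation for the regular representatives. -/
lemma Regular.weakEqOn {w : EuclideanSpace ℝ (Fin N) → ℝ → ℝ}
    {k : EuclideanSpace ℝ (Fin N) → EuclideanSpace ℝ (Fin N) → ℝ → ℝ} {a : ℝ} (ha : 0 ≤ a)
    (h : Regular p s C₂ M x₀ ρ a b w k) (hρ : 0 < ρ) (hM : 0 ≤ M) (hΩ : Metric.ball x₀ (4 * ρ) ⊆ Ω)
    (hu : IsLocalWeakSolution p s Ω T K u) (hb : b ∈ timeDomain T)
    (hwu : ∀ᵐ τ ∂(volume.restrict (Ioo 0 b)), ∀ᵐ x, w x τ = u x τ)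
    (hkK : ∀ᵐ τ ∂(volume.restrict (Ioo 0 b)),
        ∀ᵐ z : EuclideanSpace ℝ (Fin N) × EuclideanSpace ℝ (Fin N),
          k z.1 z.2 τ = K z.1 z.2 τ) :
    WeakEqOn p s x₀ ρ w k {τ | τ ∈ Ioo a b ∧ ∀ᵐ x, w x τ = u x τ} := by
  rintro τ₁ ⟨hτ₁, e₁⟩ τ₂ ⟨hτ₂, e₂⟩ h₁₂ f hf hf0 hfb hfs
  have hsub : Ioo a b ⊆ Ioo 0 b := Ioo_subset_Ioo_left ha
  have hT := Ioo_subset_timeDomain hb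
  have h1 := hu.weak_eq _ (compactlyInside_ball hρ hΩ) τ₁ (hT (hsub hτ₁)) τ₂ (hT (hsub hτ₂)) h₁₂ _ _
    (isTestFunction_const hρ hf hf0 hfb hfs)
  have hset : ∀ τ, (∀ᵐ x, w x τ = u x τ) →
      ∫ x in Metric.ball x₀ (3 * ρ), u x τ * f x = ∫ x, w x τ * f x := by
    intro τ hτ
    rw [setIntegral_eq_integral_of_forall_compl_eq_zero]
    · refine integral_congr_ae ?_
      filter_upwards [hτ] with x hx
      rw [hx]
    · intro x hx
      rw [hf0 x fun h' => hx (Metric.ball_subset_ball (by linarith) h'), mul_zero]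
  have hen : ∫ τ in τ₁..τ₂, ∫ z : EuclideanSpace ℝ (Fin N) × EuclideanSpace ℝ (Fin N),
      |u z.1 τ - u z.2 τ| ^ (p - 2) * (u z.1 τ - u z.2 τ) * (f z.1 - f z.2) * K z.1 z.2 τ =
      ∫ σ in τ₁..τ₂, energy p w k f σ := by
    refine intervalIntegral.integral_congr_ae_restrict ?_
    rw [uIoc_of_le h₁₂.le]
    have hI : Ioc τ₁ τ₂ ⊆ Ioo 0 b := fun τ hτ =>
      ⟨(hsub hτ₁).1.trans hτ.1, hτ.2.trans_lt hτ₂.2⟩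
    filter_upwards [ae_restrict_of_ae_restrict_of_subset hI hwu,
      ae_restrict_of_ae_restrict_of_subset hI hkK] with τ i1 i2
    refine integral_congr_ae ?_
    filter_upwards [ae_prod_and i1, i2] with z hz hz'
    simp only [fluxDensity, flux, hz.1, hz.2, hz']
    ring
  have hint : ∀ τ, Integrable fun x => w x τ * f x := by
    intro τ
    obtain ⟨c, hc⟩ := hfb
    refine integrable_of_bounded_of_support (x₀ := x₀) (R := 2 * ρ) (G := M * c)
      ((h.measurable.of_uncurry_right (y := τ)).mul hf).aemeasurable
      (Eventually.of_forall fun x => ?_) fun x hx => by rw [hf0 x hx, mul_zero]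
    by_cases hx : x ∈ Metric.ball x₀ (2 * ρ)
    · have h3 := h.mem_Icc x (Metric.ball_subset_ball (by linarith) hx) τ
      rw [abs_mul, abs_of_nonneg h3.1]
      exact mul_le_mul h3.2 (hc x) (abs_nonneg _) hM
    · rw [hf0 x hx, mul_zero, abs_zero]
      exact mul_nonneg hM ((abs_nonneg _).trans (hc x))
  rw [hset τ₁ e₁, hset τ₂ e₂, hen] at h1
  simp only [mul_zero, integral_zero, intervalIntegral.integral_zero, sub_zero] at h1
  simp only [sub_mul]
  rw [integral_sub (hint τ₂) (hint τ₁)]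
  linarith

end Representatives

/-! ### Evolution of the mass -/

section Mass

variable {N : ℕ} {p s C₁ C₂ M ρ b r ε : ℝ} {x₀ : EuclideanSpace ℝ (Fin N)}
  {Ω : Set (EuclideanSpace ℝ (Fin N))} {T : EReal}
  {K : EuclideanSpace ℝ (Fin N) → EuclideanSpace ℝ (Fin N) → ℝ → ℝ}
  {u : EuclideanSpace ℝ (Fin N) → ℝ → ℝ}

lemma massDensity_eq_zero (hp : 1 < p) (hρ : 0 < ρ) (v : EuclideanSpace ℝ (Fin N) → ℝ)
    {x : EuclideanSpace ℝ (Fin N)} (hx : x ∉ Metric.ball x₀ (2 * ρ)) :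
    (v x + ε) ^ r / r * cutoff x₀ ρ x ^ p = 0 := by
  rw [cutoff_eq_zero hρ hx, Real.zero_rpow (by linarith), mul_zero]

lemma integrable_massDensity_of_restrict (hp : 1 < p) (hr : 1 < r) (hε : 0 < ε) (hρ : 0 < ρ)
    {v : EuclideanSpace ℝ (Fin N) → ℝ}
    (hvm : AEMeasurable v (volume.restrict (Metric.ball x₀ (3 * ρ))))
    (hv : ∀ᵐ x ∂(volume.restrict (Metric.ball x₀ (3 * ρ))), v x ∈ Icc 0 M) :
    Integrable fun x => (v x + ε) ^ r / r * cutoff x₀ ρ x ^ p := by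
  refine integrable_massDensity hp hr hε hρ ?_ ((ae_restrict_iff' measurableSet_ball).1 hv)
  have h1 : (fun x => (v x + ε) ^ r / r * cutoff x₀ ρ x ^ p) =
      (Metric.ball x₀ (3 * ρ)).indicator fun x => (v x + ε) ^ r / r * cutoff x₀ ρ x ^ p := by
    refine (indicator_eq_self.2 fun x hx => by_contra fun h => hx ?_).symm
    exact massDensity_eq_zero hp hρ v fun h' => h (Metric.ball_subset_ball (by linarith) h')
  rw [h1, aemeasurable_indicator_iff measurableSet_ball]
  exact (((hvm.add_const ε).pow_const r).div_const r).mul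
    (measurable_cutoff.aemeasurable.pow_const p)

/-- On bounded functions `v ↦ (v + ε)^r` is Lipschitz and the cutoff is at most `1`, so the mass is
Lipschitz for the `L^1` norm on the ball. -/
lemma exists_enorm_mass_sub_le (hp : 1 < p) (hr : 1 < r) (hε : 0 < ε) (hρ : 0 < ρ) :
    ∃ L : ℝ, ∀ v₁ v₂ : EuclideanSpace ℝ (Fin N) → ℝ,
      AEMeasurable v₁ (volume.restrict (Metric.ball x₀ (3 * ρ))) →
      AEMeasurable v₂ (volume.restrict (Metric.ball x₀ (3 * ρ))) →
      (∀ᵐ x ∂(volume.restrict (Metric.ball x₀ (3 * ρ))), v₁ x ∈ Icc 0 M) →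
      (∀ᵐ x ∂(volume.restrict (Metric.ball x₀ (3 * ρ))), v₂ x ∈ Icc 0 M) →
      ‖mass p r ε x₀ ρ v₁ - mass p r ε x₀ ρ v₂‖ₑ ≤ ENNReal.ofReal L *
        eLpNorm (fun x => v₁ x - v₂ x) 1 (volume.restrict (Metric.ball x₀ (3 * ρ))) := by
  obtain ⟨L, hL0, hL⟩ := exists_rpow_lipschitz (M := M) r hε
  have hr0 : 0 < r := by linarith
  refine ⟨L / r, fun v₁ v₂ m₁ m₂ b₁ b₂ => ?_⟩
  have hB : MeasurableSet (Metric.ball x₀ (3 * ρ)) := measurableSet_ball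
  unfold mass
  rw [← integral_sub (integrable_massDensity_of_restrict hp hr hε hρ m₁ b₁)
    (integrable_massDensity_of_restrict hp hr hε hρ m₂ b₂)]
  refine (enorm_integral_le_lintegral_enorm _).trans ?_
  rw [eLpNorm_one_eq_lintegral_enorm, ← lintegral_const_mul' _ _ ENNReal.ofReal_ne_top,
    ← lintegral_indicator hB]
  rw [ae_restrict_iff' hB] at b₁ b₂
  refine lintegral_mono_ae ?_
  filter_upwards [b₁, b₂] with x h₁ h₂
  by_cases hx : x ∈ Metric.ball x₀ (3 * ρ)
  · rw [indicator_of_mem hx, ← ofReal_norm, ← ofReal_norm, ← ENNReal.ofReal_mul (by positivity)]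
    refine ENNReal.ofReal_le_ofReal ?_
    have h3 := hL _ (h₁ hx) _ (h₂ hx)
    have hζ0 : 0 ≤ cutoff x₀ ρ x ^ p := Real.rpow_nonneg (cutoff_nonneg _) _
    rw [← sub_mul, ← sub_div, Real.norm_eq_abs, Real.norm_eq_abs, abs_mul, abs_of_nonneg hζ0,
      abs_div, abs_of_pos hr0]
    calc _ ≤ |(v₁ x + ε) ^ r - (v₂ x + ε) ^ r| / r :=
          mul_le_of_le_one_right (by positivity)
            (Real.rpow_le_one (cutoff_nonneg _) (cutoff_le_one _) (by linarith))
      _ ≤ L * |v₁ x - v₂ x| / r := by gcongr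
      _ = _ := by ring
  · have hx2 : x ∉ Metric.ball x₀ (2 * ρ) := fun h => hx (Metric.ball_subset_ball (by linarith) h)
    rw [massDensity_eq_zero hp hρ v₁ hx2, massDensity_eq_zero hp hρ v₂ hx2, sub_zero, enorm_zero]
    exact zero_le

lemma Ico_subset_timeDomain₀ (hb : b ∈ timeDomain T) : Ico 0 b ⊆ timeDomain₀ T := fun τ hτ =>
  ⟨hτ.1, lt_trans (by exact_mod_cast hτ.2) hb.2⟩

/-- On a ball of finite measure the `L²` continuity of `u` gives `L^1` continuity, which passes to
the mass, the initial time included. -/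
lemma continuousOn_mass (hp : 1 < p) (hr : 1 < r) (hε : 0 < ε) (hρ : 0 < ρ)
    (hΩ : Metric.ball x₀ (4 * ρ) ⊆ Ω) (hu : IsLocalWeakSolution p s Ω T K u)
    (hb : b ∈ timeDomain T)
    (hbd : ∀ τ ∈ Ico 0 b, ∀ᵐ x ∂(volume.restrict (Metric.ball x₀ (3 * ρ))), u x τ ∈ Icc 0 M) :
    ContinuousOn (fun τ => mass p r ε x₀ ρ fun x => u x τ) (Ico 0 b) := by
  obtain ⟨L, hL⟩ := exists_enorm_mass_sub_le (x₀ := x₀) (M := M) hp hr hε hρ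
  have hci := compactlyInside_ball hρ hΩ
  have hT := Ico_subset_timeDomain₀ hb
  intro τ₀ hτ₀
  have hc := (hu.continuous _ hci τ₀ (hT hτ₀)).mono_left (nhdsWithin_mono τ₀ hT)
  set V := volume (Metric.ball x₀ (3 * ρ)) ^ (1 / (1 : ℝ≥0∞).toReal - 1 / (2 : ℝ≥0∞).toReal)
  have hV : V ≠ ∞ := ENNReal.rpow_ne_top_of_nonneg (by norm_num) measure_ball_lt_top.ne
  have h1 := ENNReal.Tendsto.const_mul (ENNReal.Tendsto.mul_const hc (Or.inr hV))
    (Or.inr (ENNReal.ofReal_ne_top (r := L)))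
  rw [zero_mul, mul_zero] at h1
  rw [ContinuousWithinAt, tendsto_iff_edist_tendsto_0]
  refine tendsto_of_tendsto_of_tendsto_of_le_of_le' tendsto_const_nhds h1
    (Eventually.of_forall fun _ => zero_le) ?_
  filter_upwards [self_mem_nhdsWithin] with τ hτ
  have m1 := hu.memLp _ hci τ (hT hτ)
  have m2 := hu.memLp _ hci τ₀ (hT hτ₀)
  rw [edist_eq_enorm_sub]
  refine (hL _ _ m1.1.aemeasurable m2.1.aemeasurable (hbd τ hτ) (hbd τ₀ hτ₀)).trans ?_
  gcongr
  have := eLpNorm_le_eLpNorm_mul_rpow_measure_univ (p := 1) (q := 2) (by norm_num)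
    (m1.1.sub m2.1)
  rw [Measure.restrict_apply_univ] at this
  exact this

/-- Growth of the mass of a local weak solution. -/
lemma mass_le (hN : 1 ≤ N) (hp : 1 < p) (hp2 : p < 2) (hs : 0 < s) (hs1 : s < 1) (hr : 1 < r)
    (hC₁ : 0 < C₁) (hC : 0 < C₂) (hε : 0 < ε) (hρ : 0 < ρ) (hM : 0 ≤ M)
    (hΩ : Metric.ball x₀ (4 * ρ) ⊆ Ω) (hK : IsKernel N p s C₁ C₂ T K)
    (hu : IsLocalWeakSolution p s Ω T K u) (hb : b ∈ timeDomain T)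
    (hbd : ∀ τ ∈ Ico 0 b, ∀ᵐ x ∂(volume.restrict (Metric.ball x₀ (3 * ρ))), u x τ ∈ Icc 0 M)
    {R S : ℝ} (hR : 0 ≤ R)
    (hS : ∀ᵐ τ ∂(volume.restrict (Ioo 0 b)),
      ∫⁻ x, ENNReal.ofReal (max (u x τ) 0 ^ r) ≤ ENNReal.ofReal S)
    (hRS : ∀ v : EuclideanSpace ℝ (Fin N) → ℝ, Measurable v →
      (∀ x ∈ Metric.ball x₀ (3 * ρ), 0 ≤ v x) →
      ∫⁻ x, ENNReal.ofReal (max (v x) 0 ^ r) ≤ ENNReal.ofReal S →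
      ∀ k : EuclideanSpace ℝ (Fin N) → EuclideanSpace ℝ (Fin N) → ℝ, (∀ x y, 0 ≤ k x y) →
      (∀ x y, k x y ≤ C₂ / ‖x - y‖ ^ ((N : ℝ) + p * s)) →
      ∫⁻ z : EuclideanSpace ℝ (Fin N) × EuclideanSpace ℝ (Fin N),
        ENNReal.ofReal (-(flux p (v z.1) (v z.2) * k z.1 z.2 *
          (testFun p r ε x₀ ρ v z.1 - testFun p r ε x₀ ρ v z.2))) ≤ ENNReal.ofReal R)
    {t₂ : ℝ} (ht₂ : t₂ ∈ Ioo 0 b) :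
    (mass p r ε x₀ ρ fun x => u x t₂) ≤ (mass p r ε x₀ ρ fun x => u x 0) + t₂ * R := by
  have hcont := continuousOn_mass (r := r) (ε := ε) hp hr hε hρ hΩ hu hb hbd
  have hbd' : ∀ᵐ τ ∂(volume.restrict (Ioo 0 b)),
      ∀ᵐ x ∂(volume.restrict (Metric.ball x₀ (3 * ρ))), u x τ ∈ Icc 0 M := by
    filter_upwards [ae_restrict_mem measurableSet_Ioo] with τ hτ using hbd τ ⟨hτ.1.le, hτ.2⟩
  obtain ⟨w, k, hreg, hwu, hkK⟩ := exists_regular hρ hM hC₁ hC hΩ hK hu hb hbd'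
  have hmass : ∀ᵐ τ ∂(volume.restrict (Ioo 0 b)),
      (mass p r ε x₀ ρ fun x => w x τ) = mass p r ε x₀ ρ fun x => u x τ := by
    filter_upwards [hwu] with τ hτ
    refine integral_congr_ae ?_
    filter_upwards [hτ] with x hx
    rw [hx]
  -- The start `t₁` is kept positive because the Sobolev and tail bounds hold only away from time
  -- `0`.
  have hpos : ∀ t₁ ∈ Ioo 0 t₂, (mass p r ε x₀ ρ fun x => u x t₂) -
      (mass p r ε x₀ ρ fun x => u x t₁) ≤ (t₂ - t₁) * R := by
    intro t₁ ht₁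
    have h := hreg t₁ ht₁.1 (ht₁.2.trans ht₂.2)
    have hsub : Ioo t₁ b ⊆ Ioo 0 b := Ioo_subset_Ioo_left ht₁.1.le
    have hG : ∀ᵐ τ ∂(volume.restrict (Ioo t₁ b)),
        τ ∈ {τ | τ ∈ Ioo t₁ b ∧ ∀ᵐ x, w x τ = u x τ} := by
      filter_upwards [ae_restrict_mem measurableSet_Ioo,
        ae_restrict_of_ae_restrict_of_subset hsub hwu] with τ i1 i2 using ⟨i1, i2⟩
    have hER : ∀ᵐ τ ∂(volume.restrict (Ioo t₁ b)),
        -energy p w k (fun x => timeTest p r ε x₀ ρ t₁ b w x τ) τ ≤ R := by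
      filter_upwards [ae_restrict_mem measurableSet_Ioo,
        ae_restrict_of_ae_restrict_of_subset hsub hwu,
        ae_restrict_of_ae_restrict_of_subset hsub hS] with τ i1 i2 i3
      refine neg_energy_le_of_lintegral hR ?_
      simp only [timeTest, indicator_of_mem i1]
      refine hRS (fun x => w x τ) h.measurable.of_uncurry_right
        (fun x hx => (h.mem_Icc x hx τ).1) ?_ (fun x y => k x y τ)
        (fun x y => h.kernel_nonneg x y τ) (fun x y => h.kernel_le x y τ)
      refine le_trans (le_of_eq (lintegral_congr_ae ?_)) i3
      filter_upwards [i2] with x hx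
      rw [hx]
    refine sub_le_of_integral_sub_le hcont ht₁.1.le ht₁.2.le ht₂.2 fun η hη => ?_
    obtain ⟨h₀, h₀pos, hh₀⟩ := h.integral_mass_sub_le hN hp hp2 hs hs1 hr hC hε hρ hM hG
      (h.weakEqOn ht₁.1.le hρ hM hΩ hu hb hwu hkK) hER le_rfl ht₁.2.le ht₂.2 hη
    refine ⟨min h₀ (b - t₂), lt_min h₀pos (by linarith [ht₂.2]), fun δ hδ hδ' => ?_⟩
    refine le_trans (le_of_eq ?_) (hh₀ δ hδ (hδ'.trans_le (min_le_left _ _)))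
    refine intervalIntegral.integral_congr_ae_restrict ?_
    rw [uIoc_of_le ht₁.2.le]
    have hδb := hδ'.trans_le (min_le_right _ _)
    rw [ae_restrict_iff' measurableSet_Ioo] at hmass
    have qmp := (measurePreserving_add_right (volume : Measure ℝ) δ).quasiMeasurePreserving
    rw [EventuallyEq, ae_restrict_iff' measurableSet_Ioc]
    filter_upwards [hmass, qmp.ae hmass] with τ i1 i2 hτ
    rw [i1 ⟨ht₁.1.trans hτ.1, hτ.2.trans_lt ht₂.2⟩,
      i2 ⟨by linarith [ht₁.1, hτ.1], by linarith [hτ.2]⟩]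
  -- Continuity of the mass at time `0` allows `t₁` to tend to `0`.
  have hlim : Tendsto (fun τ => mass p r ε x₀ ρ fun x => u x τ) (𝓝[>] 0)
      (𝓝 (mass p r ε x₀ ρ fun x => u x 0)) := by
    have h1 := hcont 0 ⟨le_rfl, ht₂.1.trans ht₂.2⟩
    refine h1.mono_left (nhdsWithin_le_of_mem ?_)
    filter_upwards [Ioo_mem_nhdsGT (ht₂.1.trans ht₂.2)] with τ hτ using ⟨hτ.1.le, hτ.2⟩
  refine ge_of_tendsto (hlim.add_const (t₂ * R)) ?_
  filter_upwards [Ioo_mem_nhdsGT ht₂.1] with t₁ ht₁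
  have h1 := hpos t₁ ht₁
  have h2 : 0 ≤ t₁ * R := mul_nonneg ht₁.1.le hR
  linarith

/-- The cutoff is `1` on `B_ρ` and `v ≤ v + ε`; the factor `r` undoes the normalization of the mass.
-/
lemma lintegral_rpow_le_mass (hp : 1 < p) (hr : 1 < r) (hε : 0 < ε) (hρ : 0 < ρ)
    {v : EuclideanSpace ℝ (Fin N) → ℝ}
    (hvm : AEMeasurable v (volume.restrict (Metric.ball x₀ (3 * ρ))))
    (hv : ∀ᵐ x ∂(volume.restrict (Metric.ball x₀ (3 * ρ))), v x ∈ Icc 0 M) :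
    ∫⁻ x in Metric.ball x₀ ρ, ENNReal.ofReal (v x ^ r) ≤
      ENNReal.ofReal (r * mass p r ε x₀ ρ v) := by
  have hr0 : 0 < r := by linarith
  have hi := (integrable_massDensity_of_restrict hp hr hε hρ hvm hv).const_mul r
  unfold mass
  rw [ae_restrict_iff' measurableSet_ball] at hv
  rw [← integral_const_mul, ofReal_integral_eq_lintegral_ofReal hi,
    ← lintegral_indicator measurableSet_ball]
  · refine lintegral_mono_ae ?_
    filter_upwards [hv] with x hx
    by_cases hx1 : x ∈ Metric.ball x₀ ρ
    · have h1 := hx (Metric.ball_subset_ball (by linarith) hx1)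
      rw [indicator_of_mem hx1, cutoff_eq_one hρ hx1, Real.one_rpow, mul_one,
        mul_div_cancel₀ _ hr0.ne']
      exact ENNReal.ofReal_le_ofReal (Real.rpow_le_rpow h1.1 (by linarith) hr0.le)
    · rw [indicator_of_notMem hx1]
      exact zero_le
  · filter_upwards [hv] with x hx
    by_cases hx2 : x ∈ Metric.ball x₀ (2 * ρ)
    · have h1 := hx (Metric.ball_subset_ball (by linarith) hx2)
      have h2 : 0 ≤ v x + ε := by linarith [h1.1]
      have hζ0 : 0 ≤ cutoff x₀ ρ x ^ p := Real.rpow_nonneg (cutoff_nonneg _) _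
      simp only [Pi.zero_apply]
      positivity
    · rw [massDensity_eq_zero hp hρ v hx2, mul_zero]
      rfl

/-- The converse comparison: the cutoff lives in `B_{2ρ}`, and `(v + ε)^r ≤ 2^r (v^r + ε^r)`
separates the cost of the regularization. -/
lemma mass_le_lintegral_rpow (hp : 1 < p) (hr : 1 < r) (hε : 0 < ε) (hρ : 0 < ρ)
    {v : EuclideanSpace ℝ (Fin N) → ℝ}
    (hv : ∀ᵐ x ∂(volume.restrict (Metric.ball x₀ (3 * ρ))), v x ∈ Icc 0 M) :
    ENNReal.ofReal (r * mass p r ε x₀ ρ v) ≤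
      ENNReal.ofReal (2 ^ r) * ((∫⁻ x in Metric.ball x₀ (2 * ρ), ENNReal.ofReal (v x ^ r)) +
        ENNReal.ofReal (2 ^ N * unitVol N * (ε ^ r * ρ ^ N))) := by
  have hr0 : 0 < r := by linarith
  have hω := unitVol_nonneg (N := N)
  have hB : MeasurableSet (Metric.ball x₀ (2 * ρ)) := measurableSet_ball
  unfold mass
  rw [ae_restrict_iff' measurableSet_ball] at hv
  rw [← integral_const_mul]
  refine (ENNReal.ofReal_le_ofReal (le_abs_self _)).trans ?_
  rw [← Real.norm_eq_abs, ofReal_norm]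
  refine (enorm_integral_le_lintegral_enorm _).trans ?_
  have hc : ENNReal.ofReal (2 ^ N * unitVol N * (ε ^ r * ρ ^ N)) =
      ∫⁻ x in Metric.ball x₀ (2 * ρ), ENNReal.ofReal (ε ^ r) := by
    rw [setLIntegral_const, volume_ball_mul x₀ (by norm_num) hρ, ← ENNReal.ofReal_mul (by positivity)]
    congr 1
    ring
  rw [hc, ← lintegral_add_right _ measurable_const, ← lintegral_const_mul' _ _ ENNReal.ofReal_ne_top,
    ← lintegral_indicator hB]
  refine lintegral_mono_ae ?_
  filter_upwards [hv] with x hx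
  by_cases hx2 : x ∈ Metric.ball x₀ (2 * ρ)
  · have h1 := hx (Metric.ball_subset_ball (by linarith) hx2)
    have h2 : 0 ≤ v x + ε := by linarith [h1.1]
    have h3 := h1.1
    have hζ0 : 0 ≤ cutoff x₀ ρ x ^ p := Real.rpow_nonneg (cutoff_nonneg _) _
    rw [indicator_of_mem hx2, ← ENNReal.ofReal_add (by positivity) (by positivity),
      ← ENNReal.ofReal_mul (by positivity), ← ofReal_norm, Real.norm_of_nonneg (by positivity)]
    refine ENNReal.ofReal_le_ofReal ?_
    calc r * ((v x + ε) ^ r / r * cutoff x₀ ρ x ^ p)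
        = (v x + ε) ^ r * cutoff x₀ ρ x ^ p := by field_simp
      _ ≤ (v x + ε) ^ r := mul_le_of_le_one_right (by positivity)
          (Real.rpow_le_one (cutoff_nonneg _) (cutoff_le_one _) (by linarith))
      _ ≤ _ := add_rpow_le_two_rpow_mul h1.1 hε.le hr0
  · rw [massDensity_eq_zero hp hρ v hx2, mul_zero, enorm_zero]
    exact zero_le

end Mass

/-! ### Absorption -/

/-- Young's inequality by dichotomy, with threshold `κ` given by `κ^θ = 4c`. If `S ≤ κ Y`, the left
side is at most a multiple of `Y`; otherwise `4 c Y^θ ≤ S^θ` and it is at most `S / 4`. -/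
lemma mul_rpow_mul_rpow_le {c θ S Y : ℝ} (hc : 0 < c) (hθ : 0 < θ) (hθ1 : θ < 1) (hS : 0 < S)
    (hY : 0 < Y) :
    c * S ^ (1 - θ) * Y ^ θ ≤ S / 4 + c * ((4 * c) ^ (1 / θ)) ^ (1 - θ) * Y := by
  set κ := (4 * c) ^ (1 / θ) with hκ
  have hκ0 : 0 < κ := by positivity
  rcases le_total S (κ * Y) with h | h
  · have h1 : S ^ (1 - θ) ≤ κ ^ (1 - θ) * Y ^ (1 - θ) := by
      rw [← Real.mul_rpow hκ0.le hY.le]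
      exact Real.rpow_le_rpow hS.le h (by linarith)
    have h2 : Y ^ (1 - θ) * Y ^ θ = Y := by
      rw [← Real.rpow_add hY, sub_add_cancel, Real.rpow_one]
    calc c * S ^ (1 - θ) * Y ^ θ ≤ c * (κ ^ (1 - θ) * Y ^ (1 - θ)) * Y ^ θ := by gcongr
      _ = c * κ ^ (1 - θ) * (Y ^ (1 - θ) * Y ^ θ) := by ring
      _ = c * κ ^ (1 - θ) * Y := by rw [h2]
      _ ≤ _ := by linarith
  · have h1 : 4 * c * Y ^ θ ≤ S ^ θ := by
      have h2 : κ ^ θ = 4 * c := by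
        rw [hκ, ← Real.rpow_mul (by positivity), one_div_mul_cancel hθ.ne', Real.rpow_one]
      rw [← h2, ← Real.mul_rpow hκ0.le hY.le]
      exact Real.rpow_le_rpow (by positivity) h hθ.le
    have h3 : S ^ (1 - θ) * S ^ θ = S := by
      rw [← Real.rpow_add hS, sub_add_cancel, Real.rpow_one]
    have h4 := mul_le_mul_of_nonneg_left h1 (by positivity : 0 ≤ S ^ (1 - θ))
    rw [h3] at h4
    have h5 : 0 ≤ c * κ ^ (1 - θ) * Y := by positivity
    linarith

/-- The constant of the final estimate, in terms of the constant of the energy inequality. -/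
noncomputable def finalConst (N : ℕ) (p r A : ℝ) : ℝ :=
  2 * (2 ^ r + 2 ^ r * (2 ^ N * unitVol N) + 1 / 4 +
    r * A * ((4 * (r * A)) ^ (1 / ((2 - p) / r))) ^ (1 - (2 - p) / r))

lemma finalConst_pos {N : ℕ} {p r A : ℝ} (hr : 1 < r) (hA : 0 < A) :
    0 < finalConst N p r A := by
  have hω := unitVol_nonneg (N := N)
  unfold finalConst
  positivity

/-- The estimate on a time interval `(0, b)` with `b < t`, in which the solution is bounded. -/
lemma iSup_lintegral_le {N : ℕ} {p s C₁ C₂ r A : ℝ} (hN : 1 ≤ N) (hp : 1 < p) (hp2 : p < 2)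
    (hs : 0 < s) (hs1 : s < 1) (hr : 1 < r) (hC₁ : 0 < C₁) (hC : 0 < C₂) (hA : 0 < A)
    (hE : ∀ (x₀ : EuclideanSpace ℝ (Fin N)) (ρ ε S : ℝ), 0 < ρ → 0 < ε →
      ∀ u : EuclideanSpace ℝ (Fin N) → ℝ, Measurable u →
      (∀ x ∈ Metric.ball x₀ (3 * ρ), 0 ≤ u x) →
      ∫⁻ x, ENNReal.ofReal (max (u x) 0 ^ r) ≤ ENNReal.ofReal S → ε ^ r * ρ ^ N ≤ S →
      ∀ k : EuclideanSpace ℝ (Fin N) → EuclideanSpace ℝ (Fin N) → ℝ, (∀ x y, 0 ≤ k x y) →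
      (∀ x y, k x y ≤ C₂ / ‖x - y‖ ^ ((N : ℝ) + p * s)) →
      ∫⁻ z : EuclideanSpace ℝ (Fin N) × EuclideanSpace ℝ (Fin N),
        ENNReal.ofReal (-(flux p (u z.1) (u z.2) * k z.1 z.2 *
          (testFun p r ε x₀ ρ u z.1 - testFun p r ε x₀ ρ u z.2))) ≤
        ENNReal.ofReal (A * S ^ (1 - (2 - p) / r) * ρ ^ (-lam N p s r / r)))
    {Ω : Set (EuclideanSpace ℝ (Fin N))} {T : EReal}
    {K : EuclideanSpace ℝ (Fin N) → EuclideanSpace ℝ (Fin N) → ℝ → ℝ}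
    {u : EuclideanSpace ℝ (Fin N) → ℝ → ℝ} {x₀ : EuclideanSpace ℝ (Fin N)} {ρ t b M : ℝ}
    (hK : IsKernel N p s C₁ C₂ T K) (hu : IsLocalWeakSolution p s Ω T K u) (hρ : 0 < ρ)
    (hΩ : Metric.ball x₀ (4 * ρ) ⊆ Ω) (hb : b ∈ timeDomain T) (hbt : b ≤ t) (hM : 0 ≤ M)
    (hbd : ∀ τ ∈ Ico 0 b, ∀ᵐ x ∂(volume.restrict (Metric.ball x₀ (3 * ρ))), u x τ ∈ Icc 0 M) :
    (⨆ τ ∈ Ioo (0 : ℝ) b, ∫⁻ x in Metric.ball x₀ ρ, ENNReal.ofReal (u x τ ^ r)) ≤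
      max
        (essSup (fun τ => ∫⁻ x in (Metric.ball x₀ ρ)ᶜ, ENNReal.ofReal (max (u x τ) 0 ^ r))
          (volume.restrict (Ioo 0 t)))
        (ENNReal.ofReal (finalConst N p r A) *
            (∫⁻ x in Metric.ball x₀ (2 * ρ), ENNReal.ofReal (u x 0 ^ r)) +
          ENNReal.ofReal (finalConst N p r A *
            (t ^ r / ρ ^ lam N p s r) ^ (1 / (2 - p)))) := by
  have hr0 : 0 < r := by linarith
  have h2p : 0 < 2 - p := by linarith
  have ht : 0 < t := hb.1.trans_le hbt
  have hω := unitVol_nonneg (N := N)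
  set X := ⨆ τ ∈ Ioo (0 : ℝ) b, ∫⁻ x in Metric.ball x₀ ρ, ENNReal.ofReal (u x τ ^ r) with hX
  set Es := essSup (fun τ => ∫⁻ x in (Metric.ball x₀ ρ)ᶜ, ENNReal.ofReal (max (u x τ) 0 ^ r))
    (volume.restrict (Ioo 0 t)) with hEs
  set I₀ := ∫⁻ x in Metric.ball x₀ (2 * ρ), ENNReal.ofReal (u x 0 ^ r)
  set Y := (t ^ r / ρ ^ lam N p s r) ^ (1 / (2 - p)) with hY
  set θ := (2 - p) / r with hθ
  have hθ0 : 0 < θ := by positivity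
  have hθ1 : θ < 1 := by
    rw [hθ, div_lt_one hr0]
    linarith
  have hY0 : 0 < Y := by positivity
  set γ := finalConst N p r A with hγ
  have hγ0 : 0 < γ := finalConst_pos hr hA
  -- If the exterior mass dominates there is nothing to prove. In the other case it is smaller than
  -- `X`, and the estimate closes on `X` alone.
  rcases le_or_gt X Es with hcase | hcase
  · exact le_max_of_le_left hcase
  refine le_max_of_le_right ?_
  rcases eq_or_ne I₀ ∞ with hI | hI
  · rw [hI, ENNReal.mul_top (ENNReal.ofReal_pos.2 hγ0).ne']
    simp
  have hsub : Metric.ball x₀ ρ ⊆ Metric.ball x₀ (3 * ρ) := Metric.ball_subset_ball (by linarith)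
  -- finiteness of the supremum
  have hXfin : X ≠ ∞ := by
    refine ne_top_of_le_ne_top (b := ENNReal.ofReal (M ^ r) * volume (Metric.ball x₀ ρ))
      (ENNReal.mul_lt_top ENNReal.ofReal_lt_top measure_ball_lt_top).ne
      (iSup₂_le fun τ hτ => ?_)
    rw [← setLIntegral_const]
    refine lintegral_mono_ae ?_
    filter_upwards [ae_restrict_of_ae_restrict_of_subset hsub (hbd τ ⟨hτ.1.le, hτ.2⟩)] with x hx
    exact ENNReal.ofReal_le_ofReal (Real.rpow_le_rpow hx.1 hx.2 hr0.le)
  set Xr := X.toReal with hXr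
  have hXeq : X = ENNReal.ofReal Xr := (ENNReal.ofReal_toReal hXfin).symm
  have hXr0 : 0 ≤ Xr := ENNReal.toReal_nonneg
  -- `2 * Xr` bounds the total mass, interior plus exterior; the summand `Y` makes `S` positive and
  -- ensures `ε^r ρ^N = Y ≤ S`.
  set S := 2 * Xr + Y with hS
  have hS0 : 0 < S := by positivity
  -- the choice of the regularization parameter
  set ε := (Y / ρ ^ N) ^ (1 / r) with hε
  have hε0 : 0 < ε := by positivity
  have hεr : ε ^ r * ρ ^ N = Y := by
    rw [hε, ← Real.rpow_mul (by positivity), one_div_mul_cancel hr0.ne', Real.rpow_one,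
      div_mul_cancel₀ _ (by positivity)]
  have hSae : ∀ᵐ τ ∂(volume.restrict (Ioo 0 b)),
      ∫⁻ x, ENNReal.ofReal (max (u x τ) 0 ^ r) ≤ ENNReal.ofReal S := by
    have hess : ∀ᵐ τ ∂(volume.restrict (Ioo 0 b)),
        ∫⁻ x in (Metric.ball x₀ ρ)ᶜ, ENNReal.ofReal (max (u x τ) 0 ^ r) ≤ Es :=
      ae_restrict_of_ae_restrict_of_subset (Ioo_subset_Ioo_right hbt) ae_le_essSup
    filter_upwards [hess, ae_restrict_mem measurableSet_Ioo] with τ i1 i2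
    rw [← lintegral_add_compl _ (measurableSet_ball (x := x₀) (ε := ρ))]
    have h1 : ∫⁻ x in Metric.ball x₀ ρ, ENNReal.ofReal (max (u x τ) 0 ^ r) ≤ X := by
      refine le_trans (le_of_eq (lintegral_congr_ae ?_))
        (le_iSup₂ (f := fun τ (_ : τ ∈ Ioo (0 : ℝ) b) =>
          ∫⁻ x in Metric.ball x₀ ρ, ENNReal.ofReal (u x τ ^ r)) τ i2)
      filter_upwards [ae_restrict_of_ae_restrict_of_subset hsub (hbd τ ⟨i2.1.le, i2.2⟩)] with x hx
      rw [max_eq_left hx.1]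
    calc _ ≤ X + X := add_le_add h1 (i1.trans hcase.le)
      _ = ENNReal.ofReal (2 * Xr) := by
          rw [hXeq, ← ENNReal.ofReal_add hXr0 hXr0]
          congr 1
          ring
      _ ≤ _ := ENNReal.ofReal_le_ofReal (by linarith)
  set R := A * S ^ (1 - θ) * ρ ^ (-lam N p s r / r) with hR
  have hR0 : 0 ≤ R := by positivity
  -- `Y` is defined so that `Y^θ = t ρ^{-λ_r/r}`.
  have htR : t * R = A * S ^ (1 - θ) * Y ^ θ := by
    have h1 : Y ^ θ = t * ρ ^ (-lam N p s r / r) := by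
      rw [hY, hθ, ← Real.rpow_mul (by positivity),
        show 1 / (2 - p) * ((2 - p) / r) = 1 / r by field_simp,
        Real.div_rpow (by positivity) (by positivity), ← Real.rpow_mul ht.le,
        mul_one_div_cancel hr0.ne', Real.rpow_one, ← Real.rpow_mul hρ.le, div_eq_mul_inv,
        ← Real.rpow_neg hρ.le]
      congr 2
      ring
    rw [h1, hR]
    ring
  have hci := compactlyInside_ball hρ hΩ
  have hT := Ico_subset_timeDomain₀ hb
  have hb0 : (0 : ℝ) ∈ Ico 0 b := ⟨le_rfl, hb.1⟩
  -- the growth estimate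
  have hgrow : X ≤ ENNReal.ofReal (2 ^ r) * (I₀ + ENNReal.ofReal (2 ^ N * unitVol N * Y)) +
      ENNReal.ofReal (r * A * S ^ (1 - θ) * Y ^ θ) := by
    refine iSup₂_le fun τ hτ => ?_
    have hτ' : τ ∈ Ico 0 b := ⟨hτ.1.le, hτ.2⟩
    have h1 := lintegral_rpow_le_mass (ε := ε) hp hr hε0 hρ
      (hu.memLp _ hci τ (hT hτ')).1.aemeasurable (hbd τ hτ')
    have h2 := mass_le_lintegral_rpow (ε := ε) hp hr hε0 hρ (hbd 0 hb0)
    rw [hεr] at h2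
    have h3 := mass_le hN hp hp2 hs hs1 hr hC₁ hC hε0 hρ hM hΩ hK hu hb hbd hR0 hSae
      (fun v hv hv0 hvS k hk0 hk => hE x₀ ρ ε S hρ hε0 v hv hv0 hvS
        (by rw [hεr]; linarith) k hk0 hk) hτ
    refine h1.trans (le_trans ?_ (add_le_add_left h2 _))
    refine le_trans (ENNReal.ofReal_le_ofReal ?_) ENNReal.ofReal_add_le
    have h4 : τ * R ≤ t * R := mul_le_mul_of_nonneg_right (hτ.2.le.trans hbt) hR0
    rw [htR] at h4
    have h5 := mul_le_mul_of_nonneg_left (h3.trans (add_le_add_right h4 _)) hr0.le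
    linarith
  have habs := mul_rpow_mul_rpow_le (c := r * A) (by positivity) hθ0 hθ1 hS0 hY0
  set c₁ := r * A * ((4 * (r * A)) ^ (1 / θ)) ^ (1 - θ) with hc₁
  have hc₁0 : 0 ≤ c₁ := by positivity
  have hI0 : 0 ≤ I₀.toReal := ENNReal.toReal_nonneg
  have hreal : Xr ≤ 2 ^ r * (I₀.toReal + 2 ^ N * unitVol N * Y) + (S / 4 + c₁ * Y) := by
    rw [hXeq, ← ENNReal.ofReal_toReal hI, ← ENNReal.ofReal_add hI0 (by positivity),
      ← ENNReal.ofReal_mul (by positivity), ← ENNReal.ofReal_add (by positivity) (by positivity),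
      ENNReal.ofReal_le_ofReal_iff (by positivity)] at hgrow
    linarith
  -- Since `S / 4 = Xr / 2 + Y / 4` and `Xr` is finite, half of `Xr` moves to the left side; the
  -- doubling that follows is the leading `2` in `finalConst`.
  have hfin : Xr ≤ γ * I₀.toReal + γ * Y := by
    have hγeq : γ = 2 * (2 ^ r + 2 ^ r * (2 ^ N * unitVol N) + 1 / 4 + c₁) := rfl
    have hw : 0 ≤ (2 ^ r * (2 ^ N * unitVol N) + 1 / 4 + c₁) * I₀.toReal := by positivity
    have hw' : 0 ≤ 2 ^ r * Y := by positivity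
    rw [hγeq]
    rw [hS] at hreal
    linarith
  rw [hXeq, ← ENNReal.ofReal_toReal hI, ← ENNReal.ofReal_mul hγ0.le,
    ← ENNReal.ofReal_add (by positivity) (by positivity)]
  exact ENNReal.ofReal_le_ofReal hfin

end FracPLap

/-! ### Conclusion: from intervals where the solution is bounded up to time `t`. -/

theorem theorem1p4 (N : ℕ) (hN : 1 ≤ N) (p s C₁ C₂ r : ℝ) (hp₁ : 1 < p) (hp₂ : p < 2)
    (hs₀ : 0 < s) (hs₁ : s < 1) (hC₁ : 0 < C₁) (hC₂ : C₁ ≤ C₂) (hr : 1 < r) :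
    ∃ γ : ℝ, 0 < γ ∧
      ∀ (Ω : Set (EuclideanSpace ℝ (Fin N))) (T : EReal)
        (K : EuclideanSpace ℝ (Fin N) → EuclideanSpace ℝ (Fin N) → ℝ → ℝ)
        (u : EuclideanSpace ℝ (Fin N) → ℝ → ℝ)
        (x₀ : EuclideanSpace ℝ (Fin N)) (ρ t : ℝ),
        IsOpen Ω → 0 < T → FracPLap.IsKernel N p s C₁ C₂ T K →
        FracPLap.IsLocalWeakSolution p s Ω T K u →
        FracPLap.LocallyBounded Ω T u →
        0 < ρ → 0 < t → Metric.ball x₀ (4 * ρ) ⊆ Ω → (t : EReal) ≤ T →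
        (∀ᵐ z : EuclideanSpace ℝ (Fin N) × ℝ
          ∂(volume.restrict (Metric.ball x₀ (4 * ρ) ×ˢ Ioo 0 t)), 0 ≤ u z.1 z.2) →
        MemLp (Function.uncurry u) (ENNReal.ofReal r)
          (volume.restrict (univ ×ˢ FracPLap.timeDomain T)) →
        (⨆ τ ∈ Ioo (0 : ℝ) t, ∫⁻ x in Metric.ball x₀ ρ, ENNReal.ofReal (u x τ ^ r)) ≤
          max
            (essSup (fun τ => ∫⁻ x in (Metric.ball x₀ ρ)ᶜ, ENNReal.ofReal (max (u x τ) 0 ^ r))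
              (volume.restrict (Ioo 0 t)))
            (ENNReal.ofReal γ * (∫⁻ x in Metric.ball x₀ (2 * ρ), ENNReal.ofReal (u x 0 ^ r)) +
              ENNReal.ofReal (γ * (t ^ r / ρ ^ FracPLap.lam N p s r) ^ (1 / (2 - p)))) := by
  have hC : 0 < C₂ := hC₁.trans_le hC₂
  obtain ⟨A, hA, hE⟩ := FracPLap.exists_lintegral_neg_energy_le hN hp₁ hp₂ hs₀ hs₁ hr hC
  refine ⟨FracPLap.finalConst N p r A, FracPLap.finalConst_pos hr hA, ?_⟩
  intro Ω T K u x₀ ρ t _ _ hK hu hbdd hρ ht hΩ htT hpos _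
  refine iSup₂_le fun τ hτ => ?_
  -- When `t = T`, local boundedness is available only up to times below `t`. Each `τ` is therefore
  -- treated on an interval `(0, b)` with `τ < b < t`; the bound `M` depends on `b`, but the
  -- constant of the estimate does not.
  set b := (τ + t) / 2 with hb
  have hτb : τ < b := by linarith [hτ.2]
  have hbt : b < t := by linarith [hτ.2]
  have hbT : b ∈ FracPLap.timeDomain T :=
    ⟨hτ.1.trans hτb, lt_of_lt_of_le (by exact_mod_cast hbt) htT⟩
  obtain ⟨M, hM⟩ := hbdd (Metric.closedBall x₀ (3 * ρ))
    ((Metric.closedBall_subset_ball (by linarith)).trans hΩ) (isCompact_closedBall _ _) b hbT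
  have hae : ∀ᵐ τ ∂(volume.restrict (Ioo 0 b)),
      ∀ᵐ x ∂(volume.restrict (Metric.ball x₀ (3 * ρ))), u x τ ∈ Icc 0 (max M 0) := by
    have h1 := FracPLap.ae_time_of_ae_prod hM
    have h2 := ae_restrict_of_ae_restrict_of_subset (Ioo_subset_Ioo_right hbt.le)
      (FracPLap.ae_time_of_ae_prod hpos)
    filter_upwards [h1, h2] with τ i1 i2
    filter_upwards [ae_restrict_of_ae_restrict_of_subset Metric.ball_subset_closedBall i1,
      ae_restrict_of_ae_restrict_of_subset (Metric.ball_subset_ball (by linarith)) i2] with x j1 j2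
    exact ⟨j2, ((le_abs_self _).trans j1).trans (le_max_left _ _)⟩
  have hci := FracPLap.compactlyInside_ball hρ hΩ
  have hT := FracPLap.Ico_subset_timeDomain₀ hbT
  have hbd : ∀ τ ∈ Ico 0 b, ∀ᵐ x ∂(volume.restrict (Metric.ball x₀ (3 * ρ))),
      u x τ ∈ Icc 0 (max M 0) := fun τ hτ =>
    FracPLap.mem_Icc_of_ae_time (hT hτ) hτ.2 (hu.memLp _ hci τ (hT hτ))
      (hu.continuous _ hci τ (hT hτ)) hae
  refine le_trans ?_ (FracPLap.iSup_lintegral_le hN hp₁ hp₂ hs₀ hs₁ hr hC₁ hC hA hE hK hu hρ hΩ hbT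
    hbt.le (le_max_right M 0) hbd)
  exact le_iSup₂ (f := fun τ (_ : τ ∈ Ioo (0 : ℝ) b) =>
    ∫⁻ x in Metric.ball x₀ ρ, ENNReal.ofReal (u x τ ^ r)) τ ⟨hτ.1, hτb⟩
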